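/- **Setting.** Let $q_0=(\frac1{\sqrt3},1)$, $q_1=(0,0)$, $q_2=(\frac2{\sqrt3},0)$, let $F_i(z)=\frac13z+\frac23q_i$ for $i=0,1,2$, $F_3(z)=\frac13(z+q_1+q_2)$, $F_4(z)=\frac13(z+q_0+q_2)$, $F_5(z)=\frac13(z+q_0+q_1)$, and let $\mathcal{SG}_3$ be the unique nonempty compact set with $\mathcal{SG}_3=\bigcup_{i=0}^5F_i\mathcal{SG}_3$. Put $V_0=\{q_0,q_1,q_2\}$ and $V_m=\bigcup_iF_iV_{m-1}$. An $m$-cell is a set $F_w\mathcal{SG}_3=F_{w_1}\circ\cdots\circ F_{w_m}(\mathcal{SG}_3)$, and $x\sim_my$ means that $x\ne y$ are points of $V_m$ in a common $m$-cell. For $0<\lambda\le1$ let $$\Omega_\lambda=\{(x,y)\in\mathcal{SG}_3\setminus V_0: y>1-\lambda\},\quad X=X_\lambda=\{(x,y)\in\mathcal{SG}_3:y=1-\lambda\},\quad \partial\Omega_\lambda=\{q_0\}\cup X,\quad \bar\Omega_\lambda=\Omega_\lambda\cup\partial\Omega_\lambda .$$ For $f\in C(\partial\Omega_\lambda)$,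 a solution of the Dirichlet problem with boundary data $f$ is a continuous function $u$ on $\bar\Omega_\lambda$ with $u|_{\partial\Omega_\lambda}=f$ that is harmonic in $\Omega_\lambda$: $\sum_{y\sim_mx}(u(x)-u(y))=0$ for all $m$ and all $x\in V_m\cap\Omega_\lambda$ such that every $m$-cell containing $x$ lies in $\Omega_\lambda\cup\{q_0\}$. The normal derivative at $q_0$ is $$\partial_n^\uparrow u(q_0)=\lim_{m\to\infty}\left(\tfrac{15}7\right)^m\bigl(2u(q_0)-u(F_0^mq_1)-u(F_0^mq_2)\bigr).$$ The energy form is $$\mathcal E_{\Omega_\lambda}(u,v)=\lim_{m\to\infty}\left(\tfrac{15}7\right)^m\sum_{\{x,y\}}(u(x)-u(y))(v(x)-v(y)),$$ the sum running over the unordered edges $x\sim_my$ of the $m$-cells contained in $\Omega_\lambda\cup\{q_0\}$, and $u\in \mathrm{dom}\,\mathcal E_{\Omega_\lambda}$ means that $\mathcal E_{\Omega_\lambda}(u,u)$ is finite. Let $h_0=h_0^\lambda$ be the solution with value $1$ at $q_0$ and $0$ on $X$, and $\eta(\lambda)=\partial_n^\uparrow h_0^\lambda(q_0)$. Write uniquely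 $\lambda=\sum_{k\ge1}\iota_k3^{-m_k}$ with integers $0<m_1<m_2<\cdots$ and $\iota_k\in\{1,2\}$. Put $m_0=0$ and $R\lambda=\sum_{k\ge2}\iota_k3^{-(m_k-m_1)}$, let $\lambda_n=R^n\lambda$, $S_1=\{4,5\}$, $S_2=\{1,2,3\}$, $W^\lambda_n=\prod_{k=1}^nS_{\iota_k}$, and for $w\in W^\lambda_n$ $$F^\lambda_w=F_0^{m_1-1}F_{w_1}F_0^{m_2-m_1-1}F_{w_2}\cdots F_0^{m_n-m_{n-1}-1}F_{w_n},\qquad X_w=F^\lambda_w\mathcal{SG}_3\cap X .$$ If $\iota_1=1$, let $\mu^\lambda_4=\mu^\lambda_5=\frac12$. If $\iota_1=2$, let $$\mu^\lambda_1=\mu^\lambda_2=\frac{6+\eta(R\lambda)}{18+4\eta(R\lambda)},\qquad \mu^\lambda_3=\frac{3+\eta(R\lambda)}{9+2\eta(R\lambda)} .$$ Let $\mu^\lambda$ be the Borel probability measure on $X$ with $\mu^\lambda(X_w)=\prod_{k=1}^{n}\mu^{\lambda_{k-1}}_{w_k}$ for all $n\ge0$ and $w\in W^\lambda_n$. **Theorem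 3.4.** Let $0<\lambda\le1$. The solution $h_0$, its normal derivative $\eta(\lambda)$ at $q_0$ and the measure $\mu^\lambda$ exist, and $\mu^\lambda$ is unique. If $f\in C(\partial\Omega_\lambda)$ and $u$ is a solution of the Dirichlet problem with boundary data $f$, then $\partial_n^\uparrow u(q_0)$ exists and $$\partial^\uparrow_nu(q_0)=\eta(\lambda)\Bigl(f(q_0)-\int_Xf\,d\mu^\lambda\Bigr).$$ If in addition $u\in \mathrm{dom}\,\mathcal E_{\Omega_\lambda}$, then $\mathcal E_{\Omega_\lambda}(h_0,u)$ exists and $$\mathcal E_{\Omega_\lambda}(h_0,u)=\partial^\uparrow_nu(q_0)=\eta(\lambda)\Bigl(f(q_0)-\int_Xf\,d\mu^\lambda\Bigr).$$ -/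

import Mathlib

open Set Filter Topology MeasureTheory

noncomputable section

namespace UpperDomain

/-- The three boundary vertices `q₀`, `q₁`, `q₂`, in coordinates. -/
def corner : Fin 3 → ℝ × ℝ :=
  ![(1 / Real.sqrt 3, 1), (0, 0), (2 / Real.sqrt 3, 0)]

/-- Translation parts: `F i z = (z + shift i) / 3`. -/
def shift : Fin 6 → ℝ × ℝ :=
  ![(2 : ℝ) • corner 0, (2 : ℝ) • corner 1, (2 : ℝ) • corner 2,
    corner 1 + corner 2, corner 0 + corner 2, corner 0 + corner 1]

/-- The six contractions of ratio `1/3`; `F i` fixes `q_i` for `i = 0, 1, 2`, and `F 3`, `F 4`,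
`F 5` map to the cell in the middle of the side opposite to `q₀`, `q₁`, `q₂`. -/
def F (i : Fin 6) (z : ℝ × ℝ) : ℝ × ℝ := (1 / 3 : ℝ) • (z + shift i)

/-- The vertex sets `V_m`. -/
def V : ℕ → Set (ℝ × ℝ)
  | 0 => range corner
  | m + 1 => ⋃ i, F i '' V m

/-- The level-3 Sierpinski gasket, as the closure of `V_* = ⋃ V_m`. That this is the unique
nonempty compact set `K` with `K = ⋃ F_i K` is proved below. -/
def SG : Set (ℝ × ℝ) := closure (⋃ m, V m)

theorem corner_fixed (i : Fin 3) : F (i.castLE (by norm_num)) (corner i) = corner i := by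
  fin_cases i <;> ext <;> simp [F, shift, corner] <;> ring

theorem dist_F (i : Fin 6) (x y : ℝ × ℝ) : dist (F i x) (F i y) = 1 / 3 * dist x y := by
  unfold F
  rw [dist_smul₀, dist_add_right]
  norm_num

theorem continuous_F (i : Fin 6) : Continuous (F i) := by
  unfold F; fun_prop

theorem SG_nonempty : SG.Nonempty :=
  ⟨corner 0, subset_closure (mem_iUnion.2 ⟨0, mem_range_self 0⟩)⟩

theorem SG_isCompact : IsCompact SG := by
  obtain ⟨C, hC⟩ : ∃ C : ℝ, ∀ i, ‖shift i‖ ≤ C := by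
    obtain ⟨C, hC⟩ := (Set.finite_range fun i => ‖shift i‖).bddAbove
    exact ⟨C, fun i => hC (mem_range_self i)⟩
  obtain ⟨D, hD⟩ : ∃ D : ℝ, ∀ i, ‖corner i‖ ≤ D := by
    obtain ⟨D, hD⟩ := (Set.finite_range fun i => ‖corner i‖).bddAbove
    exact ⟨D, fun i => hD (mem_range_self i)⟩
  have key : ∀ m, ∀ x ∈ V m, ‖x‖ ≤ max C D := by
    intro m
    induction m with
    | zero => rintro x ⟨i, rfl⟩; exact (hD i).trans (le_max_right _ _)
    | succ m ih =>
      intro x hx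
      obtain ⟨i, y, hy, rfl⟩ := mem_iUnion.1 hx
      have h1 := ih y hy
      have h2 := (hC i).trans (le_max_left C D)
      have h3 := norm_add_le y (shift i)
      have h4 := norm_nonneg (shift i)
      have : ‖F i y‖ = 1 / 3 * ‖y + shift i‖ := by
        unfold F; rw [norm_smul]; norm_num
      rw [this]; linarith
  have hb : Bornology.IsBounded (⋃ m, V m) := by
    refine (Metric.isBounded_closedBall (x := (0 : ℝ × ℝ)) (r := max C D)).subset ?_
    intro x hx
    obtain ⟨m, hm⟩ := mem_iUnion.1 hx
    simpa using key m x hm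
  exact hb.isCompact_closure

theorem SG_invariant : SG = ⋃ i, F i '' SG := by
  have hV : (⋃ m, V m) = ⋃ i, F i '' (⋃ m, V m) := by
    apply Subset.antisymm
    · refine iUnion_subset fun m => ?_
      cases m with
      | zero =>
        rintro x ⟨i, rfl⟩
        exact mem_iUnion.2 ⟨_, corner i, mem_iUnion.2 ⟨0, mem_range_self i⟩, corner_fixed i⟩
      | succ m =>
        intro x hx
        obtain ⟨i, y, hy, rfl⟩ := mem_iUnion.1 hx
        exact mem_iUnion.2 ⟨i, y, mem_iUnion.2 ⟨m, hy⟩, rfl⟩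
    · refine iUnion_subset fun i => ?_
      rintro _ ⟨y, hy, rfl⟩
      obtain ⟨m, hm⟩ := mem_iUnion.1 hy
      exact mem_iUnion.2 ⟨m + 1, mem_iUnion.2 ⟨i, y, hm, rfl⟩⟩
  have hc : ∀ i, F i '' SG = closure (F i '' ⋃ m, V m) := fun i =>
    image_closure_of_isCompact SG_isCompact (continuous_F i).continuousOn
  simp_rw [hc]
  rw [← closure_iUnion_of_finite, ← hV]
  rfl

theorem SG_unique (K : Set (ℝ × ℝ)) (hne : K.Nonempty) (hK : IsCompact K)
    (hinv : K = ⋃ i, F i '' K) : K = SG := by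
  have key : ∀ A B : Set (ℝ × ℝ), A.Nonempty → B.Nonempty → IsCompact A → IsCompact B →
      A = (⋃ i, F i '' A) → B = (⋃ i, F i '' B) → A ⊆ B := by
    intro A B hA hB cA cB iA iB
    obtain ⟨x, hx, hmax⟩ := cA.exists_isMaxOn hA
      (Metric.continuous_infDist_pt B).continuousOn
    have hx' := hx
    rw [iA] at hx'
    obtain ⟨i, y, hy, rfl⟩ := mem_iUnion.1 hx'
    obtain ⟨b, hb, hyb⟩ := cB.exists_infDist_eq_dist hB y
    have hFb : F i b ∈ B := by rw [iB]; exact mem_iUnion.2 ⟨i, b, hb, rfl⟩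
    have h1 : Metric.infDist (F i y) B ≤ 1 / 3 * Metric.infDist y B := by
      rw [hyb, ← dist_F i]; exact Metric.infDist_le_dist_of_mem hFb
    have h2 : Metric.infDist y B ≤ Metric.infDist (F i y) B := hmax hy
    have h3 := Metric.infDist_nonneg (x := y) (s := B)
    intro a ha
    have h4 : Metric.infDist a B ≤ Metric.infDist (F i y) B := hmax ha
    have h5 := Metric.infDist_nonneg (x := a) (s := B)
    exact (cB.isClosed.mem_iff_infDist_zero hB).2 (by linarith)
  exact Subset.antisymm (key K SG hne SG_nonempty hK SG_isCompact hinv SG_invariant)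
    (key SG K SG_nonempty hne SG_isCompact hK SG_invariant hinv)

/-- `F_w = F_{w_1} ∘ ⋯ ∘ F_{w_m}`. -/
def cellMap {m : ℕ} (w : Fin m → Fin 6) (z : ℝ × ℝ) : ℝ × ℝ :=
  (List.ofFn w).foldr F z

/-- The `m`-cell `F_w SG`. -/
def cell {m : ℕ} (w : Fin m → Fin 6) : Set (ℝ × ℝ) := cellMap w '' SG

/-- The upper domain above the cut at height `1 - lam`. -/
def Omega (lam : ℝ) : Set (ℝ × ℝ) := {z | z ∈ SG ∧ z ∉ V 0 ∧ 1 - lam < z.2}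

/-- The cut set. -/
def X (lam : ℝ) : Set (ℝ × ℝ) := {z | z ∈ SG ∧ z.2 = 1 - lam}

/-- The boundary of the upper domain. -/
def bdry (lam : ℝ) : Set (ℝ × ℝ) := {corner 0} ∪ X lam

/-- The closed upper domain. -/
def OmegaBar (lam : ℝ) : Set (ℝ × ℝ) := Omega lam ∪ bdry lam

/-- The cell `F_w SG` lies above the cut and does not meet it (it may contain `q₀`). -/
def CellInside (lam : ℝ) {m : ℕ} (w : Fin m → Fin 6) : Prop :=
  cell w ⊆ Omega lam ∪ {corner 0}

open Classical in
/-- The graph Laplacian `∑_{y ∼ₘ x} (u x - u y)`. Two different `m`-cells have at most one point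
in common, so every neighbour of `x` occurs in exactly one `m`-cell with corner `x`. -/
def graphLaplacian (m : ℕ) (u : ℝ × ℝ → ℝ) (x : ℝ × ℝ) : ℝ :=
  ∑ w : Fin m → Fin 6, ∑ i : Fin 3,
    if cellMap w (corner i) = x then ∑ j : Fin 3, (u x - u (cellMap w (corner j))) else 0

/-- `u` is harmonic in the upper domain: the mean value property holds on every graph
approximation, at every vertex of the domain around which the domain contains all cells of that
level. -/
def IsHarmonic (lam : ℝ) (u : ℝ × ℝ → ℝ) : Prop :=
  ∀ (m : ℕ) (x : ℝ × ℝ), x ∈ V m → x ∈ Omega lam →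
    (∀ w : Fin m → Fin 6, x ∈ cell w → CellInside lam w) → graphLaplacian m u x = 0

/-- `u` solves the Dirichlet problem with boundary data `f`. Only the values of `u` on the closed
domain and of `f` on the boundary matter. -/
def IsSolution (lam : ℝ) (f u : ℝ × ℝ → ℝ) : Prop :=
  ContinuousOn u (OmegaBar lam) ∧ IsHarmonic lam u ∧ EqOn u f (bdry lam)

/-- The difference quotients of the normal derivative at `q₀`. -/
def normalQuot (u : ℝ × ℝ → ℝ) (m : ℕ) : ℝ :=
  (15 / 7 : ℝ) ^ m *
    (2 * u (corner 0) - u ((F 0)^[m] (corner 1)) - u ((F 0)^[m] (corner 2)))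

/-- The normal derivative of `u` at `q₀` exists and equals `d`. -/
def HasNormalDeriv (u : ℝ × ℝ → ℝ) (d : ℝ) : Prop :=
  Tendsto (normalQuot u) atTop (𝓝 d)

/-- The boundary data `1` at `q₀` and `0` on the cut set. -/
def unitData : ℝ × ℝ → ℝ := Set.indicator {corner 0} 1

/-- The harmonic function with boundary values `1` at `q₀` and `0` on the cut set. -/
def h0 (lam : ℝ) : ℝ × ℝ → ℝ := Classical.epsilon fun h => IsSolution lam unitData h

/-- The normal derivative of `h0 lam` at `q₀`. -/
def eta (lam : ℝ) : ℝ := limUnder atTop (normalQuot (h0 lam))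

open Classical in
/-- The `m`-th graph energy on the upper domain, over the edges of the `m`-cells inside it. -/
def graphEnergy (lam : ℝ) (m : ℕ) (u v : ℝ × ℝ → ℝ) : ℝ :=
  (15 / 7 : ℝ) ^ m * ∑ w : Fin m → Fin 6,
    if CellInside lam w then
      ∑ i : Fin 3, (u (cellMap w (corner i)) - u (cellMap w (corner (i + 1)))) *
        (v (cellMap w (corner i)) - v (cellMap w (corner (i + 1))))
    else 0

/-- The energy form of the upper domain at `(u, v)` exists and equals `e`. -/
def HasEnergy (lam : ℝ) (u v : ℝ × ℝ → ℝ) (e : ℝ) : Prop :=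
  Tendsto (fun m => graphEnergy lam m u v) atTop (𝓝 e)

/-- `u` has finite energy on the upper domain. -/
def FiniteEnergy (lam : ℝ) (u : ℝ × ℝ → ℝ) : Prop := ∃ e, HasEnergy lam u u e

/-- The first exponent `m₁` in the expansion `lam = ∑ ι_k 3^(-m_k)`. -/
def exp1 (lam : ℝ) : ℕ := sInf {m : ℕ | 1 < 3 ^ m * lam}

open Classical in
/-- The first digit `ι₁ ∈ {1, 2}` in the expansion `lam = ∑ ι_k 3^(-m_k)`. -/
def digit1 (lam : ℝ) : ℕ := if 3 ^ exp1 lam * lam ≤ 2 then 1 else 2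

/-- The shift `R lam = ∑_{k ≥ 2} ι_k 3^(-(m_k - m₁))`. -/
def R (lam : ℝ) : ℝ := 3 ^ exp1 lam * lam - digit1 lam

theorem one_le_exp1 {lam : ℝ} (h0 : 0 < lam) (h1 : lam ≤ 1) :
    1 ≤ exp1 lam ∧ 1 < 3 ^ exp1 lam * lam ∧ 3 ^ exp1 lam * lam ≤ 3 := by
  have hne : {m : ℕ | 1 < 3 ^ m * lam}.Nonempty := by
    obtain ⟨n, hn⟩ := pow_unbounded_of_one_lt (1 / lam) (by norm_num : (1 : ℝ) < 3)
    exact ⟨n, by rwa [div_lt_iff₀ h0] at hn⟩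
  have hmem : 1 < 3 ^ exp1 lam * lam := Nat.sInf_mem hne
  have hpos : exp1 lam ≠ 0 := by
    intro h; rw [h] at hmem; simp at hmem; linarith
  obtain ⟨k, hk⟩ := Nat.exists_eq_succ_of_ne_zero hpos
  refine ⟨Nat.one_le_iff_ne_zero.2 hpos, hmem, ?_⟩
  have : ¬ 1 < 3 ^ k * lam := fun h => by
    have : exp1 lam ≤ k := Nat.sInf_le h
    omega
  rw [hk, pow_succ]; linarith

theorem R_mem {lam : ℝ} (h0 : 0 < lam) (h1 : lam ≤ 1) : 0 < R lam ∧ R lam ≤ 1 := by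
  obtain ⟨-, h2, h3⟩ := one_le_exp1 h0 h1
  unfold R digit1
  split_ifs with h
  · constructor <;> push_cast <;> linarith
  · push Not at h; constructor <;> push_cast <;> linarith

/-- The exponents and digits produced by iterating `R` are those of the expansion
`lam = ∑ ι_k 3^(-m_k)`, whose digits `ι_k` are `1` or `2` by definition. -/
theorem hasSum_expansion {lam : ℝ} (h0 : 0 < lam) (h1 : lam ≤ 1) :
    HasSum (fun k => (digit1 (R^[k] lam) : ℝ) *
      (1 / 3) ^ (∑ j ∈ Finset.range (k + 1), exp1 (R^[j] lam))) lam := by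
  have hm : ∀ k, 0 < R^[k] lam ∧ R^[k] lam ≤ 1 := by
    intro k
    induction k with
    | zero => exact ⟨h0, h1⟩
    | succ k ih => rw [Function.iterate_succ_apply']; exact R_mem ih.1 ih.2
  rw [hasSum_iff_tendsto_nat_of_nonneg (fun k => by positivity)]
  have hs : ∀ n, ∑ k ∈ Finset.range n, (digit1 (R^[k] lam) : ℝ) *
      (1 / 3) ^ (∑ j ∈ Finset.range (k + 1), exp1 (R^[j] lam)) =
      lam - (1 / 3) ^ (∑ j ∈ Finset.range n, exp1 (R^[j] lam)) * R^[n] lam := by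
    intro n
    induction n with
    | zero => simp
    | succ n ih =>
      rw [Finset.sum_range_succ, ih, Function.iterate_succ_apply',
        Finset.sum_range_succ _ n, pow_add]
      have : R (R^[n] lam) = 3 ^ exp1 (R^[n] lam) * R^[n] lam - digit1 (R^[n] lam) := rfl
      have h3 : (1 / 3 : ℝ) ^ exp1 (R^[n] lam) * 3 ^ exp1 (R^[n] lam) = 1 := by
        rw [← mul_pow]; norm_num
      rw [this]
      linear_combination ((1 / 3 : ℝ) ^ (∑ j ∈ Finset.range n, exp1 (R^[j] lam)) *
        R^[n] lam) * h3
  simp_rw [hs]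
  have hz : Tendsto (fun n => (1 / 3 : ℝ) ^ (∑ j ∈ Finset.range n, exp1 (R^[j] lam)) *
      R^[n] lam) atTop (𝓝 0) := by
    refine squeeze_zero (fun n => mul_nonneg (by positivity) (hm n).1.le) (fun n => ?_)
      (tendsto_pow_atTop_nhds_zero_of_lt_one (by norm_num : (0 : ℝ) ≤ 1 / 3) (by norm_num))
    have hn : n ≤ ∑ j ∈ Finset.range n, exp1 (R^[j] lam) := by
      calc n = ∑ j ∈ Finset.range n, 1 := by simp
        _ ≤ _ := Finset.sum_le_sum fun j _ => (one_le_exp1 (hm j).1 (hm j).2).1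
    calc _ ≤ (1 / 3 : ℝ) ^ (∑ j ∈ Finset.range n, exp1 (R^[j] lam)) * 1 :=
          mul_le_mul_of_nonneg_left (hm n).2 (by positivity)
      _ ≤ (1 / 3 : ℝ) ^ n := by
          rw [mul_one]; exact pow_le_pow_of_le_one (by norm_num) (by norm_num) hn
  simpa using tendsto_const_nhds.sub hz

/-- The alphabets `S₁ = {4, 5}` and `S₂ = {1, 2, 3}`. -/
def letters (k : ℕ) : Set (Fin 6) := if k = 1 then {4, 5} else {1, 2, 3}

/-- The words `w` with `w_k ∈ S_{ι_k}` for all `k`. -/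
def IsCutWord : ℝ → List (Fin 6) → Prop
  | _, [] => True
  | lam, i :: w => i ∈ letters (digit1 lam) ∧ IsCutWord (R lam) w

/-- The map `F_0^(m₁-1) F_{w_1} F_0^(m₂-m₁-1) F_{w_2} ⋯ F_0^(m_n-m_{n-1}-1) F_{w_n}`. -/
def cutMap : ℝ → List (Fin 6) → ℝ × ℝ → ℝ × ℝ
  | _, [], z => z
  | lam, i :: w, z => (F 0)^[exp1 lam - 1] (F i (cutMap (R lam) w z))

/-- The part `X_w` of the cut set. -/
def XPart (lam : ℝ) (w : List (Fin 6)) : Set (ℝ × ℝ) := cutMap lam w '' SG ∩ X lam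

/-- The weights of the letters of the first alphabet. -/
def weight (lam : ℝ) (i : Fin 6) : ℝ :=
  if digit1 lam = 1 then 1 / 2
  else if i = 3 then (3 + eta (R lam)) / (9 + 2 * eta (R lam))
  else (6 + eta (R lam)) / (18 + 4 * eta (R lam))

/-- The product `∏ₖ μ_{w_k}` of the weights belonging to `lam, R lam, R (R lam), …`. -/
def mass : ℝ → List (Fin 6) → ℝ
  | _, [] => 1
  | lam, i :: w => weight lam i * mass (R lam) w

/-- `μ` is a Borel probability measure on the cut set (the empty word gives `μ X = 1`) whose value
on each part `X_w` is the product of the weights. -/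
def IsCutMeasure (lam : ℝ) (μ : Measure (ℝ × ℝ)) : Prop :=
  IsProbabilityMeasure μ ∧
    ∀ w, IsCutWord lam w → μ (XPart lam w) = ENNReal.ofReal (mass lam w)

end UpperDomain

end

open UpperDomain

/-!
The gasket is unfolded one level at a time. For a real number `lam`, the part of depth less than
`lam` of the cell `F i` is a scaled copy of the part of depth less than `3 * lam - row i` of the
gasket, so it is convenient to allow every real `lam`: values above `1` stand for full cells, values
in `(0, 1]` for cells met by the cut, and values `≤ 0` for cells without points above it.
Harmonicity is the vanishing of the fluxes at the points of `V 1` where first-level cells meet,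
together with harmonicity in the cells (`Harm.junction`, `Harm.sum_flux`), and on a full cell a
harmonic function is explicit (`Harm.fullVal`).

Solving these finitely many linear equations expresses the conductance between the apex and the cut
as `15 / 7` times an increasing rational function of the conductance of the cut subcells. The
function `conductance` is defined as the limit of the iterates of this recursion. For a harmonic
function `u` put `cutMean lam u = u (corner 0) - nd u / conductance lam`, where `nd` is the normal
derivative. The same equations show that `cutMean` is the convex combination of the numbers
`cutMean` of the cut subcells, with exactly the weights that define the measure on the cut
(`Harm.cutMean_middle`, `Harm.cutMean_bottom`). Moreover `cutMean` differs from the apex value by at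
most a multiple of the oscillation of `u` (`Harm.abs_cutMean_sub_le`). Iterating down to small
cells, where `u` is almost constant by uniform continuity, turns `cutMean` into a Riemann sum of the
boundary values: it is their integral over the cut (`IsCutMeasure.hasNormalDeriv`). For boundary
values vanishing on the cut this gives `nd u = conductance lam * u (corner 0)`, whence `conductance`
is `eta` (`eta_eq_conductance`).

Existence of `h0` is obtained from a recursion that prescribes the values on `V 1` by the linear
equations and starts from affine functions; since the oscillation, together with the product of
conductance and apex value, is at least halved in every subcell, the approximations converge
uniformly (`isSolution_h0`). The measure is the law of an independent sequence of letters under the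
coding map of the cut (`isCutMeasure_map_point`); a point of the cut has at most two codes, so that
shared boundary points are null sets. Riemann sums determine its integrals of continuous functions,
which gives uniqueness (`IsCutMeasure.unique`).

For the energy, Green's formula on the cells above the cut shows that the difference between the
energy at level `m` and `h (corner 0) * nd u` is a sum over the cut cells of level `m` of
renormalized terms `h (corner 0) * nd u` (`defect_succ`). Each of these is dominated by the energies
of `h` and `u` in that cell, so that their sum is bounded by tails of two convergent sequences
(`eventually_abs_defect_le`).
-/

namespace UpperDomain

/-! ### Barycentric coordinates and the first-level cells -/

/-- Barycentric coordinates with respect to `q₀, q₁, q₂`. -/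
noncomputable def bary (z : ℝ × ℝ) : Fin 3 → ℝ :=
  ![z.2, 1 - z.2 / 2 - Real.sqrt 3 * z.1 / 2, (Real.sqrt 3 * z.1 - z.2) / 2]

/-- Three times the translation part of `F i` in barycentric coordinates. -/
def baryShift : Fin 6 → Fin 3 → ℕ :=
  ![![2, 0, 0], ![0, 2, 0], ![0, 0, 2], ![0, 1, 1], ![1, 0, 1], ![1, 1, 0]]

/-- The ten points of `V 1` are numbered as follows: `0, 1, 2` are the corners, `3, 4` the bottom
corners of the cell `0`, `5, 6, 7` the bottom corners of the middle row from left to right, and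
`8, 9` the inner points of the bottom side. `label i k` is the number of `F i (corner k)`. -/
def label : Fin 6 → Fin 3 → Fin 10 :=
  ![![0, 3, 4], ![5, 1, 8], ![7, 9, 2], ![6, 8, 9], ![4, 6, 7], ![3, 5, 6]]

/-- The number of rows of first-level cells above the cell `i`. -/
def row : Fin 6 → ℝ := ![0, 2, 2, 2, 1, 1]

/-- The inverse of `F i` on the plane. -/
noncomputable def G (i : Fin 6) (z : ℝ × ℝ) : ℝ × ℝ := (3 : ℝ) • z - shift i

theorem G_F (i : Fin 6) (z : ℝ × ℝ) : G i (F i z) = z := by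
  unfold G F; rw [smul_smul]; norm_num

theorem F_G (i : Fin 6) (z : ℝ × ℝ) : F i (G i z) = z := by
  unfold G F; rw [sub_add_cancel, smul_smul]; norm_num

theorem F_injective (i : Fin 6) : Function.Injective (F i) :=
  Function.LeftInverse.injective (G_F i)

theorem continuous_G (i : Fin 6) : Continuous (G i) := by
  unfold G; fun_prop

theorem F_eq_iff {i : Fin 6} {x z : ℝ × ℝ} : F i z = x ↔ z = G i x :=
  ⟨fun h => by rw [← h, G_F], fun h => by rw [h, F_G]⟩

theorem sum_bary (z : ℝ × ℝ) : ∑ k, bary z k = 1 := by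
  simp [bary, Fin.sum_univ_three]; ring

theorem continuous_bary (k : Fin 3) : Continuous fun z => bary z k := by
  fin_cases k <;> simp [bary] <;> fun_prop

theorem bary_corner (j k : Fin 3) : bary (corner j) k = if j = k then 1 else 0 := by
  have h : Real.sqrt 3 ≠ 0 := by positivity
  fin_cases j <;> fin_cases k <;> simp [bary, corner] <;> field_simp <;> norm_num

theorem bary_F (i : Fin 6) (z : ℝ × ℝ) (k : Fin 3) :
    bary (F i z) k = (bary z k + baryShift i k) / 3 := by
  have h : Real.sqrt 3 ≠ 0 := by positivity
  fin_cases i <;> fin_cases k <;> simp [bary, F, shift, corner, baryShift] <;> field_simp <;> ring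

theorem bary_injective : Function.Injective bary := by
  intro x y h
  have h0 := congrFun h 0
  have h2 := congrFun h 2
  simp only [bary, Matrix.cons_val] at h0 h2
  have h3 : Real.sqrt 3 ≠ 0 := by positivity
  have : Real.sqrt 3 * x.1 = Real.sqrt 3 * y.1 := by linarith
  exact Prod.ext (mul_left_cancel₀ h3 this) h0

theorem V_subset_SG (m : ℕ) : V m ⊆ SG :=
  (subset_iUnion V m).trans subset_closure

theorem corner_mem_V (k : Fin 3) : corner k ∈ V 0 := mem_range_self k

theorem corner_mem_SG (k : Fin 3) : corner k ∈ SG := V_subset_SG 0 (corner_mem_V k)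

theorem F_mem_V {m : ℕ} {z : ℝ × ℝ} (i : Fin 6) (h : z ∈ V m) : F i z ∈ V (m + 1) :=
  mem_iUnion.2 ⟨i, z, h, rfl⟩

theorem F_mem_SG {z : ℝ × ℝ} (i : Fin 6) (h : z ∈ SG) : F i z ∈ SG := by
  rw [SG_invariant]; exact mem_iUnion.2 ⟨i, z, h, rfl⟩

theorem exists_F_of_mem_SG {x : ℝ × ℝ} (h : x ∈ SG) : ∃ i, ∃ z ∈ SG, F i z = x := by
  rw [SG_invariant] at h
  exact mem_iUnion.1 h

theorem bary_nonneg {z : ℝ × ℝ} (hz : z ∈ SG) (k : Fin 3) : 0 ≤ bary z k := by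
  have hV : ∀ m, ∀ x ∈ V m, ∀ k, 0 ≤ bary x k := by
    intro m
    induction m with
    | zero =>
      rintro _ ⟨j, rfl⟩ k
      rw [bary_corner]; split_ifs <;> norm_num
    | succ m ih =>
      intro x hx k
      obtain ⟨i, y, hy, rfl⟩ := mem_iUnion.1 hx
      have := ih y hy k
      rw [bary_F]; positivity
  have hc : IsClosed {x | 0 ≤ bary x k} := isClosed_le continuous_const (continuous_bary k)
  refine closure_minimal ?_ hc hz
  intro x hx
  obtain ⟨m, hm⟩ := mem_iUnion.1 hx
  exact hV m x hm k

theorem bary_le_one {z : ℝ × ℝ} (hz : z ∈ SG) (k : Fin 3) : bary z k ≤ 1 := by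
  rw [← sum_bary z]
  exact Finset.single_le_sum (fun i _ => bary_nonneg hz i) (Finset.mem_univ k)

theorem eq_corner_of_one_le_bary {z : ℝ × ℝ} (hz : z ∈ SG) {k : Fin 3} (h : 1 ≤ bary z k) :
    z = corner k := by
  apply bary_injective
  have h1 := sum_bary z
  have h2 := fun j => bary_nonneg hz j
  funext j
  rw [bary_corner]
  rw [Fin.sum_univ_three] at h1
  have a := h2 0
  have b := h2 1
  have c := h2 2
  fin_cases k <;> fin_cases j <;> simp at h ⊢ <;> linarith

/-- Two different first-level cells are separated by a line parallel to a side of the triangle. -/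
theorem exists_baryShift_lt : ∀ i j : Fin 6, i ≠ j → ∃ k, baryShift j k + 1 ≤ baryShift i k := by
  decide

/-- Two different first-level cells meet in at most a common corner. -/
theorem exists_corner_of_F_eq {i j : Fin 6} (hij : i ≠ j) {z z' : ℝ × ℝ} (hz : z ∈ SG)
    (hz' : z' ∈ SG) (h : F i z = F j z') : ∃ k, z = corner k := by
  obtain ⟨k, hk⟩ := exists_baryShift_lt j i hij.symm
  refine ⟨k, eq_corner_of_one_le_bary hz ?_⟩
  have h1 := congrArg (fun x => bary x k) h
  simp only [bary_F] at h1
  have h2 := bary_nonneg hz' k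
  have h3 : (baryShift i k : ℝ) + 1 ≤ baryShift j k := by exact_mod_cast hk
  linarith

/-- Two corners of first-level cells have the same number exactly if they have the same barycentric
coordinates. -/
theorem label_eq_iff : ∀ (i : Fin 6) (k : Fin 3) (j : Fin 6) (l : Fin 3), label i k = label j l ↔
    ∀ n, baryShift i n + (if k = n then 1 else 0) = baryShift j n + (if l = n then 1 else 0) := by
  decide +kernel

theorem F_corner_eq_iff {i j : Fin 6} {k l : Fin 3} :
    F i (corner k) = F j (corner l) ↔ label i k = label j l := by
  rw [label_eq_iff, ← bary_injective.eq_iff, funext_iff]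
  refine forall_congr' fun n => ?_
  rw [bary_F, bary_F, bary_corner, bary_corner, div_left_inj' (by norm_num), ← Nat.cast_inj (R := ℝ)]
  push_cast
  rw [add_comm, add_comm (ite (l = n) _ _)]

theorem label_injective : ∀ (i : Fin 6) (k l : Fin 3), label i k = label i l → k = l := by
  decide

/-- A corner lies in no other first-level cell than its own. -/
theorem label_eq_diag : ∀ (j : Fin 6) (l k : Fin 3),
    label j l = label (k.castLE (by norm_num)) k ↔ j = k.castLE (by norm_num) ∧ l = k := by
  decide

theorem corner_injective : Function.Injective corner := by
  intro i j h
  have := congrArg (fun x => bary x j) h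
  simp only [bary_corner, if_true] at this
  by_contra hne
  rw [if_neg hne] at this
  norm_num at this

theorem F_mem_V_zero {i : Fin 6} {x : ℝ × ℝ} (hx : x ∈ SG) (h : F i x ∈ V 0) : x ∈ V 0 := by
  obtain ⟨k, hk⟩ := h
  rw [← corner_fixed k] at hk
  by_cases hik : i = k.castLE (by norm_num)
  · subst hik
    rw [← F_injective _ hk]; exact corner_mem_V k
  · obtain ⟨l, rfl⟩ := exists_corner_of_F_eq hik hx (corner_mem_SG k) hk.symm
    exact corner_mem_V l

theorem F_corner_mem_V_zero_iff {i : Fin 6} {k : Fin 3} :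
    F i (corner k) ∈ V 0 ↔ ∃ l : Fin 3, label i k = label (l.castLE (by norm_num)) l := by
  constructor
  · rintro ⟨l, hl⟩
    rw [← corner_fixed l] at hl
    exact ⟨l, F_corner_eq_iff.1 hl.symm⟩
  · rintro ⟨l, hl⟩
    rw [F_corner_eq_iff.2 hl, corner_fixed]
    exact corner_mem_V l

/-! ### Depth below the apex, and cells above a given depth -/

theorem depth_F (i : Fin 6) (z : ℝ × ℝ) : 1 - (F i z).2 = (1 - z.2 + row i) / 3 := by
  have h := bary_F i z 0
  simp only [bary, Matrix.cons_val] at h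
  rw [h]
  fin_cases i <;> simp [row, baryShift] <;> ring

theorem depth_nonneg {z : ℝ × ℝ} (hz : z ∈ SG) : 0 ≤ 1 - z.2 := by
  have := bary_le_one hz 0
  simp only [bary, Matrix.cons_val] at this
  linarith

theorem depth_le_one {z : ℝ × ℝ} (hz : z ∈ SG) : 1 - z.2 ≤ 1 := by
  have := bary_nonneg hz 0
  simp only [bary, Matrix.cons_val] at this
  linarith

theorem depth_corner (k : Fin 3) : 1 - (corner k).2 = if k = 0 then 0 else 1 := by
  fin_cases k <;> simp [corner]

theorem row_le_two (i : Fin 6) : row i ≤ 2 := by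
  fin_cases i <;> norm_num [row]

theorem cellMap_cons {m : ℕ} (i : Fin 6) (w : Fin m → Fin 6) (z : ℝ × ℝ) :
    cellMap (Fin.cons i w : Fin (m + 1) → Fin 6) z = F i (cellMap w z) := by
  simp [cellMap, List.ofFn_succ]

theorem cellMap_zero (w : Fin 0 → Fin 6) (z : ℝ × ℝ) : cellMap w z = z := by
  simp [cellMap]

theorem cell_zero (w : Fin 0 → Fin 6) : cell w = SG := by
  simp [cell, cellMap_zero]

theorem mem_cell_cons {m : ℕ} {i : Fin 6} {w : Fin m → Fin 6} {x : ℝ × ℝ} :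
    x ∈ cell (Fin.cons i w : Fin (m + 1) → Fin 6) ↔ ∃ z ∈ cell w, F i z = x := by
  simp only [cell, mem_image, cellMap_cons]
  constructor
  · rintro ⟨z, hz, rfl⟩; exact ⟨_, ⟨z, hz, rfl⟩, rfl⟩
  · rintro ⟨_, ⟨z, hz, rfl⟩, rfl⟩; exact ⟨z, hz, rfl⟩

theorem forall_cons {m : ℕ} {P : (Fin (m + 1) → Fin 6) → Prop}
    (h : ∀ i (w : Fin m → Fin 6), P (Fin.cons i w)) (w : Fin (m + 1) → Fin 6) : P w := by
  rw [← Fin.cons_self_tail w]; exact h _ _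

theorem sum_cons {m : ℕ} (g : (Fin (m + 1) → Fin 6) → ℝ) :
    ∑ w, g w = ∑ i, ∑ w : Fin m → Fin 6, g (Fin.cons i w) := by
  rw [← Fintype.sum_prod_type']
  exact (Fintype.sum_equiv (Fin.consEquiv fun _ => Fin 6) _ _ fun x => rfl).symm

theorem cellMap_mem_V {m : ℕ} (w : Fin m → Fin 6) (k : Fin 3) : cellMap w (corner k) ∈ V m := by
  induction m with
  | zero => rw [cellMap_zero]; exact corner_mem_V k
  | succ m ih =>
    refine forall_cons (P := fun w => cellMap w (corner k) ∈ V (m + 1)) (fun i w => ?_) w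
    rw [cellMap_cons]; exact F_mem_V i (ih w)

theorem cell_subset_SG {m : ℕ} (w : Fin m → Fin 6) : cell w ⊆ SG := by
  induction m with
  | zero => rw [cell_zero]
  | succ m ih =>
    refine forall_cons (P := fun w => cell w ⊆ SG) (fun i w => ?_) w
    intro x hx
    obtain ⟨z, hz, rfl⟩ := mem_cell_cons.1 hx
    exact F_mem_SG i (ih w hz)

/-- The cell `F_w SG` consists of points of depth less than `lam`. For `0 < lam ≤ 1` this is
`CellInside`; admitting every real `lam` makes the notion stable under passing to subcells. -/
def Above (lam : ℝ) {m : ℕ} (w : Fin m → Fin 6) : Prop := ∀ z ∈ cell w, 1 - z.2 < lam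

theorem above_cons {lam : ℝ} {m : ℕ} {i : Fin 6} {w : Fin m → Fin 6} :
    Above lam (Fin.cons i w : Fin (m + 1) → Fin 6) ↔ Above (3 * lam - row i) w := by
  constructor
  · intro h z hz
    have := h (F i z) (mem_cell_cons.2 ⟨z, hz, rfl⟩)
    rw [depth_F] at this; linarith
  · intro h x hx
    obtain ⟨z, hz, rfl⟩ := mem_cell_cons.1 hx
    have := h z hz
    rw [depth_F]; linarith

theorem above_zero {lam : ℝ} {w : Fin 0 → Fin 6} : Above lam w ↔ 1 < lam := by
  constructor
  · intro h
    have := h (corner 1) (by rw [cell_zero]; exact corner_mem_SG 1)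
    rw [depth_corner] at this
    simpa using this
  · intro h z hz
    rw [cell_zero] at hz
    exact (depth_le_one hz).trans_lt h

theorem above_of_one_lt {lam : ℝ} (h : 1 < lam) {m : ℕ} (w : Fin m → Fin 6) : Above lam w :=
  fun _ hz => (depth_le_one (cell_subset_SG w hz)).trans_lt h

theorem not_above_of_nonpos {lam : ℝ} (h : lam ≤ 0) {m : ℕ} (w : Fin m → Fin 6) :
    ¬ Above lam w := by
  intro hw
  have h1 : cellMap w (corner 0) ∈ cell w := ⟨_, corner_mem_SG 0, rfl⟩
  have h2 := hw _ h1
  have h3 := depth_nonneg (cell_subset_SG w h1)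
  linarith

theorem cellInside_iff_above {lam : ℝ} (h0 : 0 < lam) (h1 : lam ≤ 1) {m : ℕ}
    {w : Fin m → Fin 6} : CellInside lam w ↔ Above lam w := by
  constructor
  · intro h z hz
    rcases h hz with h | h
    · linarith [h.2.2]
    · rw [mem_singleton_iff.1 h, depth_corner]; simpa using h0
  · intro h z hz
    have hd := h z hz
    by_cases hV : z ∈ V 0
    · right
      obtain ⟨k, rfl⟩ := hV
      rw [depth_corner] at hd
      split_ifs at hd with hk
      · rw [hk]; rfl
      · linarith
    · exact Or.inl ⟨cell_subset_SG w hz, hV, by linarith⟩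

theorem depth_le_of_mem_cell {m : ℕ} {w : Fin m → Fin 6} {x z : ℝ × ℝ} (hx : x ∈ cell w)
    (hz : z ∈ cell w) : 1 - z.2 ≤ 1 - x.2 + (1 / 3) ^ m := by
  induction m generalizing x z with
  | zero =>
    rw [cell_zero] at hx hz
    have := depth_nonneg hx
    have := depth_le_one hz
    simp only [pow_zero]; linarith
  | succ m ih =>
    revert hx hz
    refine forall_cons (P := fun w => x ∈ cell w → z ∈ cell w → _) (fun i w => ?_) w
    intro hx hz
    obtain ⟨x', hx', rfl⟩ := mem_cell_cons.1 hx
    obtain ⟨z', hz', rfl⟩ := mem_cell_cons.1 hz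
    have := ih hx' hz'
    rw [depth_F, depth_F, pow_succ]; linarith

end UpperDomain

namespace UpperDomain

/-! ### The graph Laplacian and its self-similarity -/

theorem graphLaplacian_congr {m : ℕ} {u v : ℝ × ℝ → ℝ} {x : ℝ × ℝ} (h : EqOn u v SG) :
    graphLaplacian m u x = graphLaplacian m v x := by
  unfold graphLaplacian
  refine Finset.sum_congr rfl fun w _ => Finset.sum_congr rfl fun i _ => ?_
  have hV := fun j => h (V_subset_SG m (cellMap_mem_V w j))
  split_ifs with hx
  · refine Finset.sum_congr rfl fun j _ => ?_
    rw [← hx, hV, hV]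
  · rfl

theorem graphLaplacian_eq_zero {m : ℕ} {u : ℝ × ℝ → ℝ} {x : ℝ × ℝ} (h : x ∉ V m) :
    graphLaplacian m u x = 0 := by
  unfold graphLaplacian
  refine Finset.sum_eq_zero fun w _ => Finset.sum_eq_zero fun i _ => if_neg ?_
  rintro rfl
  exact h (cellMap_mem_V w i)

theorem graphLaplacian_succ (m : ℕ) (u : ℝ × ℝ → ℝ) (x : ℝ × ℝ) :
    graphLaplacian (m + 1) u x = ∑ i, graphLaplacian m (u ∘ F i) (G i x) := by
  unfold graphLaplacian
  rw [sum_cons]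
  refine Finset.sum_congr rfl fun i _ => Finset.sum_congr rfl fun w _ =>
    Finset.sum_congr rfl fun k _ => ?_
  simp only [cellMap_cons, F_eq_iff, Function.comp_apply, F_G]

theorem graphLaplacian_zero_corner (u : ℝ × ℝ → ℝ) (k : Fin 3) :
    graphLaplacian 0 u (corner k) = ∑ j, (u (corner k) - u (corner j)) := by
  simp only [graphLaplacian, Finset.univ_unique, Finset.sum_singleton, cellMap_zero,
    corner_injective.eq_iff]
  rw [Finset.sum_ite_eq' Finset.univ k]
  simp

/-- At a point off the corners, only the cell containing it contributes to the Laplacian. -/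
theorem graphLaplacian_F {m : ℕ} {u : ℝ × ℝ → ℝ} {i : Fin 6} {x : ℝ × ℝ} (hx : x ∈ SG)
    (hx0 : x ∉ V 0) :
    graphLaplacian (m + 1) u (F i x) = graphLaplacian m (u ∘ F i) x := by
  rw [graphLaplacian_succ, Finset.sum_eq_single i, G_F]
  · intro j _ hji
    refine graphLaplacian_eq_zero fun h => ?_
    obtain ⟨k, rfl⟩ := exists_corner_of_F_eq hji.symm hx (V_subset_SG m h) (F_G j _).symm
    exact hx0 (corner_mem_V k)
  · simp

/-- At a point of `V 1`, the Laplacian is the sum of the contributions of the first-level cells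
that meet there. -/
theorem graphLaplacian_F_corner (m : ℕ) (u : ℝ × ℝ → ℝ) (i : Fin 6) (k : Fin 3) :
    graphLaplacian (m + 1) u (F i (corner k)) = ∑ j, ∑ l,
      if label j l = label i k then graphLaplacian m (u ∘ F j) (corner l) else 0 := by
  rw [graphLaplacian_succ]
  refine Finset.sum_congr rfl fun j _ => ?_
  by_cases h : ∃ l, label j l = label i k
  · obtain ⟨l, hl⟩ := h
    rw [← F_corner_eq_iff.2 hl, G_F, Finset.sum_eq_single l]
    · rw [if_pos hl]
    · intro l' _ hl'
      rw [if_neg]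
      rw [← hl]
      exact fun h => hl' (label_injective _ _ _ h)
    · simp
  · push Not at h
    rw [Finset.sum_eq_zero fun l _ => if_neg (h l)]
    refine graphLaplacian_eq_zero fun hV => ?_
    by_cases hij : j = i
    · subst hij; exact h k rfl
    · obtain ⟨l, hl⟩ := exists_corner_of_F_eq hij (V_subset_SG m hV) (corner_mem_SG k) (F_G j _)
      refine h l (F_corner_eq_iff.1 ?_)
      rw [← hl, F_G]

theorem graphLaplacian_succ_corner (m : ℕ) (u : ℝ × ℝ → ℝ) (k : Fin 3) :
    graphLaplacian (m + 1) u (corner k) =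
      graphLaplacian m (u ∘ F (k.castLE (by norm_num))) (corner k) := by
  conv_lhs => rw [← corner_fixed k]
  rw [graphLaplacian_F_corner, Finset.sum_eq_single (k.castLE (by norm_num)),
    Finset.sum_eq_single k, if_pos rfl]
  · intro l _ hl
    rw [if_neg fun h => hl ((label_eq_diag _ _ _).1 h).2]
  · simp
  · intro j _ hj
    exact Finset.sum_eq_zero fun l _ => if_neg fun h => hj ((label_eq_diag _ _ _).1 h).1
  · simp

/-! ### Harmonic functions above an arbitrary depth -/

/-- `u` is harmonic on the part of the gasket of depth less than `lam`, where `lam` is any real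
number: for `lam > 1` this part is the whole gasket, for `lam ≤ 0` it is empty, and for
`0 < lam ≤ 1` the notion agrees with `IsHarmonic`. -/
def Harm (lam : ℝ) (u : ℝ × ℝ → ℝ) : Prop :=
  ∀ (m : ℕ) (x : ℝ × ℝ), x ∈ V m → x ∉ V 0 →
    (∀ w : Fin m → Fin 6, x ∈ cell w → Above lam w) → graphLaplacian m u x = 0

theorem exists_mem_cell {m : ℕ} {x : ℝ × ℝ} (hx : x ∈ V m) : ∃ w : Fin m → Fin 6, x ∈ cell w := by
  induction m generalizing x with
  | zero => exact ⟨Fin.elim0, by rw [cell_zero]; exact V_subset_SG 0 hx⟩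
  | succ m ih =>
    obtain ⟨i, y, hy, rfl⟩ := mem_iUnion.1 hx
    obtain ⟨w, hw⟩ := ih hy
    exact ⟨Fin.cons i w, mem_cell_cons.2 ⟨y, hw, rfl⟩⟩

theorem isHarmonic_iff_harm {lam : ℝ} (h0 : 0 < lam) (h1 : lam ≤ 1) {u : ℝ × ℝ → ℝ} :
    IsHarmonic lam u ↔ Harm lam u := by
  constructor
  · intro h m x hx hx0 hw
    obtain ⟨w, hxw⟩ := exists_mem_cell hx
    refine h m x hx ⟨V_subset_SG m hx, hx0, ?_⟩ fun w' hw' =>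
      (cellInside_iff_above h0 h1).2 (hw w' hw')
    have := hw w hxw x hxw
    linarith
  · intro h m x hx hx0 hw
    exact h m x hx hx0.2.1 fun w' hw' => (cellInside_iff_above h0 h1).1 (hw w' hw')

theorem Harm.comp_F {lam : ℝ} {u : ℝ × ℝ → ℝ} (h : Harm lam u) (i : Fin 6) :
    Harm (3 * lam - row i) (u ∘ F i) := by
  intro m x hx hx0 hw
  have hxS := V_subset_SG m hx
  rw [← graphLaplacian_F hxS hx0]
  refine h (m + 1) (F i x) (F_mem_V i hx) (fun h => hx0 (F_mem_V_zero hxS h)) ?_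
  refine forall_cons fun j w hxw => ?_
  obtain ⟨z, hz, hzx⟩ := mem_cell_cons.1 hxw
  by_cases hij : i = j
  · subst hij
    rw [F_injective i hzx] at hz
    exact above_cons.2 (hw w hz)
  · obtain ⟨k, rfl⟩ := exists_corner_of_F_eq hij hxS (cell_subset_SG w hz) hzx.symm
    exact absurd (corner_mem_V k) hx0

/-- The equation at a point of `V 1`, on a level so fine that the cells around it are above
depth `lam`. -/
theorem Harm.junction {lam : ℝ} {u : ℝ × ℝ → ℝ} (h : Harm lam u) (m : ℕ) (i : Fin 6) (k : Fin 3)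
    (hik : ∀ l : Fin 3, label i k ≠ label (l.castLE (by norm_num)) l)
    (hm : ∀ j l, label j l = label i k →
      1 < 3 * lam - row j ∨ (l = 0 ∧ (1 / 3) ^ m < 3 * lam - row j)) :
    ∑ j, ∑ l, (if label j l = label i k then graphLaplacian m (u ∘ F j) (corner l) else 0) = 0 := by
  rw [← graphLaplacian_F_corner]
  have hV : ∀ n, corner k ∈ V n := by
    intro n
    induction n with
    | zero => exact corner_mem_V k
    | succ n ih => rw [← corner_fixed k]; exact F_mem_V _ ih
  refine h (m + 1) _ (F_mem_V i (hV m)) ?_ ?_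
  · rw [F_corner_mem_V_zero_iff]
    push Not
    exact hik
  refine forall_cons fun j w hxw => above_cons.2 ?_
  obtain ⟨z, hz, hzx⟩ := mem_cell_cons.1 hxw
  obtain ⟨l, hl⟩ : ∃ l, z = corner l := by
    by_cases hji : j = i
    · subst hji; exact ⟨k, F_injective _ hzx⟩
    · exact exists_corner_of_F_eq hji (cell_subset_SG w hz) (corner_mem_SG k) hzx
  subst hl
  rcases hm j l (F_corner_eq_iff.1 hzx) with hj | ⟨rfl, hj⟩
  · exact above_of_one_lt hj w
  · intro z' hz'
    have := depth_le_of_mem_cell hz hz'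
    rw [depth_corner, if_pos rfl] at this
    linarith

/-! ### Full cells -/

/-- The values at the points of `V 1` of the harmonic function with corner values `v`. -/
noncomputable def fullVal (v : Fin 3 → ℝ) : Fin 10 → ℝ :=
  ![v 0, v 1, v 2, (8 * v 0 + 4 * v 1 + 3 * v 2) / 15, (8 * v 0 + 3 * v 1 + 4 * v 2) / 15,
    (4 * v 0 + 8 * v 1 + 3 * v 2) / 15, (v 0 + v 1 + v 2) / 3, (4 * v 0 + 3 * v 1 + 8 * v 2) / 15,
    (3 * v 0 + 8 * v 1 + 4 * v 2) / 15, (3 * v 0 + 4 * v 1 + 8 * v 2) / 15]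

theorem one_lt_child {lam : ℝ} (h : 1 < lam) (i : Fin 6) : 1 < 3 * lam - row i := by
  linarith [row_le_two i]

/-- One value for each point of `V 1`, independent of the cell through which it is reached. -/
theorem exists_values (u : ℝ × ℝ → ℝ) : ∃ y : Fin 10 → ℝ, ∀ i k, u (F i (corner k)) = y (label i k) := by
  classical
  refine ⟨fun n => if h : ∃ p : Fin 6 × Fin 3, label p.1 p.2 = n then
    u (F h.choose.1 (corner h.choose.2)) else 0, fun i k => ?_⟩
  have h : ∃ p : Fin 6 × Fin 3, label p.1 p.2 = label i k := ⟨(i, k), rfl⟩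
  simp only [dif_pos h]
  rw [F_corner_eq_iff.2 h.choose_spec]

theorem Harm.fullVal {lam : ℝ} (hl : 1 < lam) {u : ℝ × ℝ → ℝ} (h : Harm lam u) (i : Fin 6)
    (k : Fin 3) : u (F i (corner k)) = fullVal (u ∘ corner) (label i k) := by
  obtain ⟨y, hy⟩ := exists_values u
  have hj := fun i k hik => h.junction 0 i k hik fun j _ _ => Or.inl (one_lt_child hl j)
  simp only [graphLaplacian_zero_corner, Function.comp_apply, hy] at hj
  have e3 := hj 0 1 (by decide)
  have e4 := hj 0 2 (by decide)
  have e5 := hj 5 1 (by decide)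
  have e6 := hj 5 2 (by decide)
  have e7 := hj 4 2 (by decide)
  have e8 := hj 1 2 (by decide)
  have e9 := hj 2 1 (by decide)
  have c0 : u (corner 0) = y 0 := (congrArg u (corner_fixed 0)).symm.trans (hy _ 0)
  have c1 : u (corner 1) = y 1 := (congrArg u (corner_fixed 1)).symm.trans (hy _ 1)
  have c2 : u (corner 2) = y 2 := (congrArg u (corner_fixed 2)).symm.trans (hy _ 2)
  simp [Fin.sum_univ_succ, label] at e3 e4 e5 e6 e7 e8 e9
  rw [hy]
  generalize label i k = n
  fin_cases n <;> simp [UpperDomain.fullVal, c0, c1, c2] <;> linarith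

/-- Fluxes at the corners of a full cell are renormalized by `7 / 15`. -/
theorem sum_fullVal_diag (v : Fin 3 → ℝ) (k : Fin 3) :
    ∑ j, (fullVal v (label (k.castLE (by norm_num)) k) -
      fullVal v (label (k.castLE (by norm_num)) j)) = 7 / 15 * ∑ j, (v k - v j) := by
  fin_cases k <;> simp [Fin.sum_univ_three, fullVal, label] <;> ring

theorem Harm.graphLaplacian_corner {lam : ℝ} (hl : 1 < lam) {u : ℝ × ℝ → ℝ} (h : Harm lam u)
    (m : ℕ) (k : Fin 3) :
    graphLaplacian m u (corner k) = (7 / 15) ^ m * ∑ j, (u (corner k) - u (corner j)) := by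
  induction m generalizing lam u with
  | zero => rw [graphLaplacian_zero_corner]; simp
  | succ m ih =>
    have hs := sum_fullVal_diag (u ∘ corner) k
    simp only [Function.comp_apply] at hs
    rw [graphLaplacian_succ_corner, ih (one_lt_child hl _) (h.comp_F _), pow_succ, mul_assoc, ← hs]
    simp only [Function.comp_apply, h.fullVal hl]

/-! ### The normal derivative at the apex -/

theorem normalQuot_succ (u : ℝ × ℝ → ℝ) (m : ℕ) :
    normalQuot u (m + 1) = 15 / 7 * normalQuot (u ∘ F 0) m := by
  have h : F 0 (corner 0) = corner 0 := corner_fixed 0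
  simp only [normalQuot, Function.comp_apply, Function.iterate_succ_apply', h, pow_succ]
  ring

theorem normalQuot_eq (u : ℝ × ℝ → ℝ) (m : ℕ) :
    normalQuot u m = (15 / 7) ^ m * graphLaplacian m u (corner 0) := by
  induction m generalizing u with
  | zero =>
    rw [graphLaplacian_zero_corner]
    simp [normalQuot, Fin.sum_univ_three]; ring
  | succ m ih =>
    rw [normalQuot_succ, ih, graphLaplacian_succ_corner, pow_succ]
    simp only [Fin.castLE_zero]
    ring

/-- The normal derivative at the apex. -/
noncomputable def nd (u : ℝ × ℝ → ℝ) : ℝ := limUnder atTop (normalQuot u)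

theorem normalQuot_of_one_lt {lam : ℝ} (hl : 1 < lam) {u : ℝ × ℝ → ℝ} (h : Harm lam u) (m : ℕ) :
    normalQuot u m = 2 * u (corner 0) - u (corner 1) - u (corner 2) := by
  rw [normalQuot_eq, h.graphLaplacian_corner hl, ← mul_assoc, ← mul_pow]
  simp [Fin.sum_univ_three]; ring

theorem tendsto_normalQuot_iff {u : ℝ × ℝ → ℝ} {d : ℝ} :
    HasNormalDeriv u (15 / 7 * d) ↔ HasNormalDeriv (u ∘ F 0) d := by
  unfold HasNormalDeriv
  rw [← tendsto_add_atTop_iff_nat 1]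
  simp only [normalQuot_succ]
  constructor
  · intro h
    have := h.const_mul (7 / 15)
    simpa [← mul_assoc] using this
  · exact fun h => h.const_mul _

/-- Induction along the first digit: reduce `0 < lam ≤ 1` to `1 / 3 < lam ≤ 1`. -/
theorem ternary_induction {P : ℝ → Prop} (base : ∀ lam, 1 / 3 < lam → lam ≤ 1 → P lam)
    (step : ∀ lam, 0 < lam → lam ≤ 1 / 3 → P (3 * lam) → P lam) {lam : ℝ} (h0 : 0 < lam)
    (h1 : lam ≤ 1) : P lam := by
  obtain ⟨n, hn⟩ := pow_unbounded_of_one_lt (1 / lam) (by norm_num : (1 : ℝ) < 3)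
  rw [div_lt_iff₀ h0] at hn
  induction n generalizing lam with
  | zero => simp at hn; linarith
  | succ n ih =>
    by_cases h : lam ≤ 1 / 3
    · refine step lam h0 h (ih (by linarith) (by linarith) ?_)
      rw [pow_succ] at hn; linarith
    · exact base lam (not_le.1 h) h1

theorem Harm.comp_F_zero {lam : ℝ} {u : ℝ × ℝ → ℝ} (h : Harm lam u) : Harm (3 * lam) (u ∘ F 0) := by
  simpa [row] using h.comp_F 0

theorem Harm.hasNormalDeriv {lam : ℝ} (h0 : 0 < lam) {u : ℝ × ℝ → ℝ} (h : Harm lam u) :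
    HasNormalDeriv u (nd u) := by
  suffices hs : ∃ d, HasNormalDeriv u d from tendsto_nhds_limUnder hs
  have hfull : ∀ {lam : ℝ} {u : ℝ × ℝ → ℝ}, 1 < lam → Harm lam u → ∃ d, HasNormalDeriv u d :=
    fun hl h => ⟨_, tendsto_const_nhds.congr fun m => (normalQuot_of_one_lt hl h m).symm⟩
  by_cases h1 : 1 < lam
  · exact hfull h1 h
  refine ternary_induction (P := fun lam => ∀ u, Harm lam u → ∃ d, HasNormalDeriv u d)
    ?_ ?_ h0 (not_lt.1 h1) u h
  · intro lam hl _ u hu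
    obtain ⟨d, hd⟩ := hfull (by linarith) hu.comp_F_zero
    exact ⟨_, tendsto_normalQuot_iff.2 hd⟩
  · intro lam _ _ ih u hu
    obtain ⟨d, hd⟩ := ih _ hu.comp_F_zero
    exact ⟨_, tendsto_normalQuot_iff.2 hd⟩

theorem HasNormalDeriv.nd_eq {u : ℝ × ℝ → ℝ} {d : ℝ} (h : HasNormalDeriv u d) : nd u = d :=
  h.limUnder_eq

theorem Harm.nd_eq {lam : ℝ} (h0 : 0 < lam) {u : ℝ × ℝ → ℝ} (h : Harm lam u) :
    nd u = 15 / 7 * nd (u ∘ F 0) :=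
  (tendsto_normalQuot_iff.2 (h.comp_F_zero.hasNormalDeriv (by linarith))).nd_eq

theorem Harm.nd_of_one_lt {lam : ℝ} (hl : 1 < lam) {u : ℝ × ℝ → ℝ} (h : Harm lam u) :
    nd u = 2 * u (corner 0) - u (corner 1) - u (corner 2) :=
  HasNormalDeriv.nd_eq (tendsto_const_nhds.congr fun m => (normalQuot_of_one_lt hl h m).symm)

/-- The normal derivative is attained at a finite level. -/
theorem Harm.eventually_graphLaplacian {lam : ℝ} (h0 : 0 < lam) {u : ℝ × ℝ → ℝ} (h : Harm lam u) :
    ∀ᶠ m in atTop, (15 / 7) ^ m * graphLaplacian m u (corner 0) = nd u := by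
  simp only [← normalQuot_eq]
  by_cases h1 : 1 < lam
  · exact Eventually.of_forall fun m => by rw [normalQuot_of_one_lt h1 h, h.nd_of_one_lt h1]
  refine ternary_induction (P := fun lam => ∀ u, Harm lam u → ∀ᶠ m in atTop, normalQuot u m = nd u)
    ?_ ?_ h0 (not_lt.1 h1) u h
  · intro lam hl _ u hu
    rw [← map_add_atTop_eq_nat 1, eventually_map]
    have h3 : 1 < 3 * lam := by linarith
    refine Eventually.of_forall fun m => ?_
    rw [normalQuot_succ, hu.nd_eq (by linarith), normalQuot_of_one_lt h3 hu.comp_F_zero,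
      hu.comp_F_zero.nd_of_one_lt h3]
  · intro lam hl _ ih u hu
    rw [← map_add_atTop_eq_nat 1, eventually_map]
    filter_upwards [ih _ hu.comp_F_zero] with m hm
    rw [normalQuot_succ, hu.nd_eq hl, hm]

end UpperDomain

namespace UpperDomain

/-! ### The conductance between the apex and the cut -/

/-- Conductance between the apex and the cut through the middle row, if the two cut cells have
conductance `x` (up to the factor `15 / 7`). -/
noncomputable def phiOne (x : ℝ) : ℝ := 2 * x / (1 + x)

/-- Conductance between the apex and the cut through the bottom row, if the three cut cells have
conductance `x` (up to the factor `15 / 7`). -/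
noncomputable def phiTwo (x : ℝ) : ℝ := x * (4 * x + 18) / (3 * x ^ 2 + 15 * x + 6)

/-- The recursion for the conductance, by the row of first-level cells that the cut meets. -/
noncomputable def condStep (g : ℝ → ℝ) (lam : ℝ) : ℝ :=
  15 / 7 * if lam ≤ 1 / 3 then g (3 * lam) else
    if lam ≤ 2 / 3 then phiOne (g (3 * lam - 1)) else phiTwo (g (3 * lam - 2))

/-- The iterates of `condStep` increase from the constant `2` to its fixed point. -/
noncomputable def conductance (lam : ℝ) : ℝ := ⨆ n : ℕ, condStep^[n] (fun _ => 2) lam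

theorem phiOne_mono {a b : ℝ} (ha : 2 ≤ a) (hab : a ≤ b) : phiOne a ≤ phiOne b := by
  unfold phiOne
  rw [div_le_div_iff₀ (by linarith) (by linarith)]
  nlinarith

theorem phiTwo_mono {a b : ℝ} (ha : 2 ≤ a) (hab : a ≤ b) : phiTwo a ≤ phiTwo b := by
  have ha0 : 0 < a := by linarith
  have hb0 : 0 < b := by linarith
  unfold phiTwo
  rw [div_le_div_iff₀ (by positivity) (by positivity)]
  have h : b * (4 * b + 18) * (3 * a ^ 2 + 15 * a + 6) - a * (4 * a + 18) * (3 * b ^ 2 + 15 * b + 6)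
      = (b - a) * (6 * (a * b) + 24 * (a + b) + 108) := by ring
  have : 0 ≤ (b - a) * (6 * (a * b) + 24 * (a + b) + 108) :=
    mul_nonneg (by linarith) (by positivity)
  linarith

theorem condStep_mono {f g : ℝ → ℝ} (hf : ∀ x, 0 < x → x ≤ 1 → 2 ≤ f x)
    (hfg : ∀ x, 0 < x → x ≤ 1 → f x ≤ g x) {lam : ℝ} (h0 : 0 < lam) (h1 : lam ≤ 1) :
    condStep f lam ≤ condStep g lam := by
  unfold condStep
  refine mul_le_mul_of_nonneg_left ?_ (by norm_num)
  split_ifs with h h'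
  · exact hfg _ (by linarith) (by linarith)
  · exact phiOne_mono (hf _ (by linarith) (by linarith)) (hfg _ (by linarith) (by linarith))
  · exact phiTwo_mono (hf _ (by linarith) (by linarith)) (hfg _ (by linarith) (by linarith))

theorem two_le_condStep (lam : ℝ) : 2 ≤ condStep (fun _ => 2) lam := by
  unfold condStep phiOne phiTwo
  split_ifs <;> norm_num

/-- The function `5 / x` is a supersolution of the recursion. -/
theorem condStep_le {f : ℝ → ℝ} (hf : ∀ x, 0 < x → x ≤ 1 → 2 ≤ f x ∧ f x ≤ 5 / x) {lam : ℝ}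
    (h0 : 0 < lam) (h1 : lam ≤ 1) : condStep f lam ≤ 5 / lam := by
  have h5 : 5 ≤ 5 / lam := by rw [le_div_iff₀ h0]; linarith
  unfold condStep
  split_ifs with h h'
  · have := (hf (3 * lam) (by linarith) (by linarith)).2
    have e : 5 / (3 * lam) = 5 / lam / 3 := by field_simp
    rw [e] at this; linarith
  · have := (hf (3 * lam - 1) (by linarith) (by linarith)).1
    have : phiOne (f (3 * lam - 1)) ≤ 2 := by
      unfold phiOne
      rw [div_le_iff₀ (by linarith)]; linarith
    linarith
  · have := (hf (3 * lam - 2) (by linarith) (by linarith)).1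
    have : phiTwo (f (3 * lam - 2)) ≤ 2 := by
      unfold phiTwo
      rw [div_le_iff₀ (by positivity)]; nlinarith
    linarith

theorem iterate_condStep_bounds (n : ℕ) : ∀ x : ℝ, 0 < x → x ≤ 1 →
    2 ≤ condStep^[n] (fun _ => 2) x ∧ condStep^[n] (fun _ => 2) x ≤ 5 / x := by
  induction n with
  | zero =>
    intro x h0 h1
    simp only [Function.iterate_zero, id]
    rw [le_div_iff₀ h0]
    exact ⟨le_rfl, by linarith⟩
  | succ n ih =>
    intro x h0 h1
    rw [Function.iterate_succ_apply']
    refine ⟨(two_le_condStep x).trans ?_, condStep_le ih h0 h1⟩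
    exact condStep_mono (fun _ _ _ => le_rfl) (fun y hy hy1 => (ih y hy hy1).1) h0 h1

theorem iterate_condStep_le_succ (n : ℕ) : ∀ x : ℝ, 0 < x → x ≤ 1 →
    condStep^[n] (fun _ => 2) x ≤ condStep^[n + 1] (fun _ => 2) x := by
  induction n with
  | zero => exact fun x _ _ => two_le_condStep x
  | succ n ih =>
    intro x h0 h1
    rw [Function.iterate_succ_apply', Function.iterate_succ_apply']
    exact condStep_mono (fun y hy hy1 => (iterate_condStep_bounds n y hy hy1).1) ih h0 h1

theorem tendsto_conductance {lam : ℝ} (h0 : 0 < lam) (h1 : lam ≤ 1) :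
    Tendsto (fun n => condStep^[n] (fun _ => 2) lam) atTop (𝓝 (conductance lam)) := by
  refine tendsto_atTop_ciSup (monotone_nat_of_le_succ fun n => iterate_condStep_le_succ n _ h0 h1) ?_
  refine ⟨5 / lam, ?_⟩
  rintro _ ⟨n, rfl⟩
  exact (iterate_condStep_bounds n _ h0 h1).2

theorem two_le_conductance {lam : ℝ} (h0 : 0 < lam) (h1 : lam ≤ 1) : 2 ≤ conductance lam :=
  ge_of_tendsto' (tendsto_conductance h0 h1) fun n => (iterate_condStep_bounds n _ h0 h1).1

theorem conductance_eq {lam : ℝ} (h0 : 0 < lam) (h1 : lam ≤ 1) :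
    conductance lam = condStep conductance lam := by
  refine tendsto_nhds_unique ((tendsto_add_atTop_iff_nat 1).2 (tendsto_conductance h0 h1)) ?_
  simp only [Function.iterate_succ_apply', condStep]
  refine Tendsto.const_mul _ ?_
  split_ifs with h h'
  · exact tendsto_conductance (by linarith) (by linarith)
  · have ht := tendsto_conductance (lam := 3 * lam - 1) (by linarith) (by linarith)
    have := two_le_conductance (lam := 3 * lam - 1) (by linarith) (by linarith)
    exact (ht.const_mul 2).div (ht.const_add 1) (by linarith)
  · have ht := tendsto_conductance (lam := 3 * lam - 2) (by linarith) (by linarith)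
    have := two_le_conductance (lam := 3 * lam - 2) (by linarith) (by linarith)
    exact (ht.mul ((ht.const_mul 4).add_const 18)).div
      ((((ht.pow 2).const_mul 3).add (ht.const_mul 15)).add_const 6) (by positivity)

theorem conductance_top {lam : ℝ} (h0 : 0 < lam) (h1 : lam ≤ 1 / 3) :
    conductance lam = 15 / 7 * conductance (3 * lam) := by
  rw [conductance_eq h0 (by linarith), condStep, if_pos h1]

theorem conductance_middle {lam : ℝ} (h0 : 1 / 3 < lam) (h1 : lam ≤ 2 / 3) :
    conductance lam = 15 / 7 * phiOne (conductance (3 * lam - 1)) := by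
  rw [conductance_eq (by linarith) (by linarith), condStep, if_neg (by linarith), if_pos h1]

theorem conductance_bottom {lam : ℝ} (h0 : 2 / 3 < lam) (h1 : lam ≤ 1) :
    conductance lam = 15 / 7 * phiTwo (conductance (3 * lam - 2)) := by
  rw [conductance_eq (by linarith) (by linarith), condStep, if_neg (by linarith),
    if_neg (by linarith)]

/-! ### Fluxes at the points of `V 1` -/

/-- The outward flux of `u` at a corner: the normal derivative of a full cell, or, for a cut cell,
the normal derivative at its apex. -/
noncomputable def flux (lam : ℝ) (u : ℝ × ℝ → ℝ) (l : Fin 3) : ℝ :=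
  if 1 < lam then ∑ j, (u (corner l) - u (corner j)) else nd u

/-- The fluxes out of the first-level cells that meet at a point of `V 1` add up to `0`, provided that
the point lies above the cut: it is a corner of full cells or the apex of cut cells. -/
theorem Harm.sum_flux {lam : ℝ} {u : ℝ × ℝ → ℝ} (h : Harm lam u) (i : Fin 6) (k : Fin 3)
    (hik : ∀ l : Fin 3, label i k ≠ label (l.castLE (by norm_num)) l)
    (hm : ∀ j l, label j l = label i k → 1 < 3 * lam - row j ∨ (l = 0 ∧ 0 < 3 * lam - row j)) :
    ∑ j, ∑ l, (if label j l = label i k then flux (3 * lam - row j) (u ∘ F j) l else 0) = 0 := by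
  have hev : ∀ j, ∀ᶠ m : ℕ in atTop, 0 < 3 * lam - row j → (1 / 3) ^ m < 3 * lam - row j ∧
      (15 / 7) ^ m * graphLaplacian m (u ∘ F j) (corner 0) = nd (u ∘ F j) := by
    intro j
    by_cases hj : 0 < 3 * lam - row j
    · have h1 := (tendsto_pow_atTop_nhds_zero_of_lt_one (by norm_num : (0 : ℝ) ≤ 1 / 3)
        (by norm_num)).eventually_lt_const hj
      filter_upwards [h1, (h.comp_F j).eventually_graphLaplacian hj] with m h1 h2 _
      exact ⟨h1, h2⟩
    · exact Eventually.of_forall fun m h => absurd h hj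
  obtain ⟨m, hev⟩ := (eventually_all.2 hev).exists
  have hj := h.junction m i k hik fun j l hjl =>
    (hm j l hjl).imp_right fun h => ⟨h.1, (hev j h.2).1⟩
  rw [← mul_eq_zero_iff_left (by positivity : (15 / 7 : ℝ) ^ m ≠ 0), Finset.mul_sum] at hj
  refine (Finset.sum_congr rfl fun j _ => ?_).trans hj
  rw [Finset.mul_sum]
  refine Finset.sum_congr rfl fun l _ => ?_
  split_ifs with hjl
  · unfold flux
    split_ifs with h1
    · rw [(h.comp_F j).graphLaplacian_corner h1, ← mul_assoc, ← mul_pow]; norm_num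
    · rcases hm j l hjl with h2 | ⟨rfl, h2⟩
      · exact absurd h2 h1
      · exact (hev j h2).2.symm
  · simp

/-! ### The mean value over the cut -/

/-- The value at the apex minus the normal derivative divided by the conductance. It turns out to be
the integral of the boundary values over the cut. -/
noncomputable def cutMean (lam : ℝ) (u : ℝ × ℝ → ℝ) : ℝ := u (corner 0) - nd u / conductance lam

theorem F_zero_corner_zero : F 0 (corner 0) = corner 0 := corner_fixed 0

theorem F_corner_of_label {i j : Fin 6} {k l : Fin 3} (h : label i k = label j l) :
    F i (corner k) = F j (corner l) := F_corner_eq_iff.2 h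

theorem Harm.cutMean_top {lam : ℝ} (h0 : 0 < lam) (h1 : lam ≤ 1 / 3) {u : ℝ × ℝ → ℝ}
    (h : Harm lam u) : cutMean lam u = cutMean (3 * lam) (u ∘ F 0) := by
  have := two_le_conductance (lam := 3 * lam) (by linarith) (by linarith)
  rw [cutMean, cutMean, conductance_top h0 h1, h.nd_eq h0, Function.comp_apply, F_zero_corner_zero]
  field_simp

/-- The equations at the two points below the top cell, for a cut through the middle row. -/
theorem Harm.flux_middle {lam : ℝ} (h0 : 1 / 3 < lam) (h1 : lam ≤ 2 / 3) {u : ℝ × ℝ → ℝ}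
    (h : Harm lam u) :
    nd u = 15 / 7 * (2 * u (corner 0) - u (F 5 (corner 0)) - u (F 4 (corner 0))) ∧
    2 * u (F 5 (corner 0)) - u (corner 0) - u (F 4 (corner 0)) + nd (u ∘ F 5) = 0 ∧
    2 * u (F 4 (corner 0)) - u (corner 0) - u (F 5 (corner 0)) + nd (u ∘ F 4) = 0 := by
  have r0 : row 0 = 0 := rfl
  have r4 : row 4 = 1 := rfl
  have r5 : row 5 = 1 := rfl
  have p0 : 1 < 3 * lam := by linarith
  have p1 : ¬ 1 < 3 * lam - 1 := by linarith
  have e3 := h.sum_flux 5 0 (by decide) (by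
    simp [Fin.forall_fin_succ, label, r0, r5, p0])
  have e4 := h.sum_flux 4 0 (by decide) (by
    simp [Fin.forall_fin_succ, label, r0, r4, p0])
  simp [Fin.sum_univ_succ, label, flux, r0, r4, r5, p0, p1, F_zero_corner_zero] at e3 e4
  have n3 : F 0 (corner 1) = F 5 (corner 0) := F_corner_of_label rfl
  have n4 : F 0 (corner 2) = F 4 (corner 0) := F_corner_of_label rfl
  rw [n3, n4] at e3 e4
  refine ⟨?_, by linarith, by linarith⟩
  rw [h.nd_eq (by linarith), h.comp_F_zero.nd_of_one_lt p0]
  simp only [Function.comp_apply, F_zero_corner_zero, n3, n4]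

/-- The equations at the five points above the bottom row, for a cut through the bottom row. -/
theorem Harm.flux_bottom {lam : ℝ} (h0 : 2 / 3 < lam) (h1 : lam ≤ 1) {u : ℝ × ℝ → ℝ}
    (h : Harm lam u) :
    nd u = 15 / 7 * (2 * u (corner 0) - u (F 0 (corner 1)) - u (F 0 (corner 2))) ∧
    4 * u (F 0 (corner 1)) = u (corner 0) + u (F 0 (corner 2)) + u (F 1 (corner 0)) +
      u (F 3 (corner 0)) ∧
    4 * u (F 0 (corner 2)) = u (corner 0) + u (F 0 (corner 1)) + u (F 2 (corner 0)) +
      u (F 3 (corner 0)) ∧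
    2 * u (F 1 (corner 0)) - u (F 0 (corner 1)) - u (F 3 (corner 0)) + nd (u ∘ F 1) = 0 ∧
    2 * u (F 2 (corner 0)) - u (F 0 (corner 2)) - u (F 3 (corner 0)) + nd (u ∘ F 2) = 0 ∧
    4 * u (F 3 (corner 0)) - u (F 0 (corner 1)) - u (F 0 (corner 2)) - u (F 1 (corner 0)) -
      u (F 2 (corner 0)) + nd (u ∘ F 3) = 0 := by
  have r0 : row 0 = 0 := rfl
  have r1 : row 1 = 2 := rfl
  have r2 : row 2 = 2 := rfl
  have r3 : row 3 = 2 := rfl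
  have r4 : row 4 = 1 := rfl
  have r5 : row 5 = 1 := rfl
  have p0 : 1 < 3 * lam := by linarith
  have p1 : 1 < 3 * lam - 1 := by linarith
  have p2 : ¬ 1 < 3 * lam - 2 := by linarith
  have p3 : 2 < 3 * lam := by linarith
  have e3 := h.sum_flux 0 1 (by decide) (by
    simp [Fin.forall_fin_succ, label, r0, r5, p0, p1])
  have e4 := h.sum_flux 0 2 (by decide) (by
    simp [Fin.forall_fin_succ, label, r0, r4, p0, p1])
  have e5 := h.sum_flux 1 0 (by decide) (by
    simp [Fin.forall_fin_succ, label, r1, r5, p1, p3])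
  have e6 := h.sum_flux 3 0 (by decide) (by
    simp [Fin.forall_fin_succ, label, r3, r4, r5, p1, p3])
  have e7 := h.sum_flux 2 0 (by decide) (by
    simp [Fin.forall_fin_succ, label, r2, r4, p1, p3])
  simp [Fin.sum_univ_succ, label, flux, r0, r1, r2, r3, r4, r5, p0, p1, p2, F_zero_corner_zero]
    at e3 e4 e5 e6 e7
  have n3 : F 5 (corner 0) = F 0 (corner 1) := F_corner_of_label rfl
  have n4 : F 4 (corner 0) = F 0 (corner 2) := F_corner_of_label rfl
  have n5 : F 5 (corner 1) = F 1 (corner 0) := F_corner_of_label rfl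
  have n6 : F 5 (corner 2) = F 3 (corner 0) := F_corner_of_label rfl
  have n6' : F 4 (corner 1) = F 3 (corner 0) := F_corner_of_label rfl
  have n7 : F 4 (corner 2) = F 2 (corner 0) := F_corner_of_label rfl
  rw [n3, n5, n6] at e3
  rw [n4, n6', n7] at e4
  rw [n3, n5, n6] at e5
  rw [n3, n4, n5, n6, n6', n7] at e6
  rw [n4, n6', n7] at e7
  refine ⟨?_, by linarith, by linarith, by linarith, by linarith, by linarith⟩
  rw [h.nd_eq (by linarith), h.comp_F_zero.nd_of_one_lt p0]
  simp only [Function.comp_apply, F_zero_corner_zero]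

theorem Harm.cutMean_middle {lam : ℝ} (h0 : 1 / 3 < lam) (h1 : lam ≤ 2 / 3) {u : ℝ × ℝ → ℝ}
    (h : Harm lam u) :
    cutMean lam u = 1 / 2 * cutMean (3 * lam - 1) (u ∘ F 4) +
      1 / 2 * cutMean (3 * lam - 1) (u ∘ F 5) := by
  obtain ⟨e, e5, e4⟩ := h.flux_middle h0 h1
  have hc := two_le_conductance (lam := 3 * lam - 1) (by linarith) (by linarith)
  have e5' := eq_neg_of_add_eq_zero_right e5
  have e4' := eq_neg_of_add_eq_zero_right e4
  simp only [cutMean, conductance_middle h0 h1, e, e4', e5', Function.comp_apply, phiOne]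
  have : conductance (3 * lam - 1) ≠ 0 := by linarith
  have : 1 + conductance (3 * lam - 1) ≠ 0 := by linarith
  field_simp
  ring

theorem Harm.cutMean_bottom {lam : ℝ} (h0 : 2 / 3 < lam) (h1 : lam ≤ 1) {u : ℝ × ℝ → ℝ}
    (h : Harm lam u) (x : ℝ) (hx : x = conductance (3 * lam - 2)) :
    cutMean lam u = (6 + x) / (18 + 4 * x) * cutMean (3 * lam - 2) (u ∘ F 1) +
      (6 + x) / (18 + 4 * x) * cutMean (3 * lam - 2) (u ∘ F 2) +
      (3 + x) / (9 + 2 * x) * cutMean (3 * lam - 2) (u ∘ F 3) := by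
  obtain ⟨e, e3, e4, e5, e7, e6⟩ := h.flux_bottom h0 h1
  have hc := two_le_conductance (lam := 3 * lam - 2) (by linarith) (by linarith)
  have e5' := eq_neg_of_add_eq_zero_right e5
  have e6' := eq_neg_of_add_eq_zero_right e6
  have e7' := eq_neg_of_add_eq_zero_right e7
  simp only [cutMean, conductance_bottom h0 h1, e, e5', e6', e7', Function.comp_apply, phiTwo,
    ← hx] at *
  clear e5' e6' e7' e5 e6 e7 e
  generalize u (corner 0) = q at *
  generalize u (F 0 (corner 1)) = a at *
  generalize u (F 0 (corner 2)) = b at *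
  generalize u (F 1 (corner 0)) = c at *
  generalize u (F 3 (corner 0)) = d at *
  generalize u (F 2 (corner 0)) = r at *
  have e3' : c = 4 * a - q - b - d := by linarith
  have e4' : r = 4 * b - q - a - d := by linarith
  subst e3' e4'
  have : x ≠ 0 := by linarith
  have : 18 + 4 * x ≠ 0 := by linarith
  have : 9 + 2 * x ≠ 0 := by linarith
  have : 4 * x + 18 ≠ 0 := by linarith
  have : 3 * x ^ 2 + 15 * x + 6 ≠ 0 := by positivity
  rw [show (18 : ℝ) + 4 * x = 2 * (9 + 2 * x) by ring, show (4 : ℝ) * x + 18 = 2 * (9 + 2 * x) by ring]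
  field_simp
  ring

/-- The normal derivative is controlled by the oscillation around the apex value. -/
theorem Harm.abs_nd_le {lam : ℝ} (h0 : 0 < lam) (h1 : lam ≤ 1) {u : ℝ × ℝ → ℝ} (h : Harm lam u)
    {M : ℝ} (hM : ∀ z ∈ SG, 1 - z.2 < lam → |u (corner 0) - u z| ≤ M) :
    |nd u| ≤ 15 / 7 * M * conductance lam := by
  refine ternary_induction (P := fun lam => ∀ u, Harm lam u →
    (∀ z ∈ SG, 1 - z.2 < lam → |u (corner 0) - u z| ≤ M) →
    |nd u| ≤ 15 / 7 * M * conductance lam) ?_ ?_ h0 h1 u h hM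
  · intro lam h0 h1 u h hM
    have hd : ∀ k, |u (corner 0) - u (F 0 (corner k))| ≤ M := by
      intro k
      refine hM _ (F_mem_SG 0 (corner_mem_SG k)) ?_
      rw [depth_F, depth_corner]
      have r0 : row 0 = 0 := rfl
      rw [r0]
      split_ifs <;> linarith
    have hM0 : 0 ≤ M := (abs_nonneg _).trans (hd 0)
    have hc := two_le_conductance (lam := lam) (by linarith) h1
    rw [h.nd_eq (by linarith), h.comp_F_zero.nd_of_one_lt (by linarith), abs_mul,
      abs_of_pos (by norm_num : (0 : ℝ) < 15 / 7), mul_assoc]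
    refine mul_le_mul_of_nonneg_left ?_ (by norm_num)
    have : |2 * (u ∘ F 0) (corner 0) - (u ∘ F 0) (corner 1) - (u ∘ F 0) (corner 2)| ≤ 2 * M := by
      have h1 := abs_le.1 (hd 1)
      have h2 := abs_le.1 (hd 2)
      simp only [Function.comp_apply, F_zero_corner_zero]
      rw [abs_le]; constructor <;> linarith
    nlinarith
  · intro lam h0 h1 ih u h hM
    have := ih _ h.comp_F_zero (fun z hz hd => by
      simp only [Function.comp_apply, F_zero_corner_zero]
      refine hM _ (F_mem_SG 0 hz) ?_
      rw [depth_F]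
      have r0 : row 0 = 0 := rfl
      rw [r0]; linarith)
    rw [h.nd_eq h0, conductance_top h0 h1, abs_mul, abs_of_pos (by norm_num : (0 : ℝ) < 15 / 7)]
    linarith

theorem Harm.abs_cutMean_sub_le {lam : ℝ} (h0 : 0 < lam) (h1 : lam ≤ 1) {u : ℝ × ℝ → ℝ}
    (h : Harm lam u) {M : ℝ} (hM : ∀ z ∈ SG, 1 - z.2 < lam → |u (corner 0) - u z| ≤ M) :
    |cutMean lam u - u (corner 0)| ≤ 15 / 7 * M := by
  have hc := two_le_conductance h0 h1
  have := h.abs_nd_le h0 h1 hM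
  rw [cutMean, sub_sub_cancel_left, abs_neg, abs_div, abs_of_pos (by linarith : 0 < conductance lam),
    div_le_iff₀ (by linarith)]
  exact this

/-- Only the values near the cut matter for `cutMean`, as it is a convex combination of
the corresponding quantities of the cut cells of any level. -/
theorem Harm.abs_cutMean_le_of_strip {M : ℝ} (n : ℕ) {lam : ℝ} (h0 : 0 < lam) (h1 : lam ≤ 1)
    {u : ℝ × ℝ → ℝ} (h : Harm lam u)
    (hM : ∀ z ∈ SG, lam - (1 / 3) ^ n ≤ 1 - z.2 → 1 - z.2 ≤ lam → |u z| ≤ M) :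
    |cutMean lam u| ≤ 6 * M := by
  induction n generalizing lam u with
  | zero =>
    have hM' : ∀ z ∈ SG, 1 - z.2 ≤ lam → |u z| ≤ M := fun z hz hd =>
      hM z hz (by have := depth_nonneg hz; simp; linarith) hd
    have hq := hM' (corner 0) (corner_mem_SG 0) (by rw [depth_corner, if_pos rfl]; exact h0.le)
    have := h.abs_cutMean_sub_le h0 h1 (M := 2 * M) fun z hz hd => by
      have h1 := abs_le.1 (hM' z hz hd.le)
      have h2 := abs_le.1 hq
      rw [abs_le]; constructor <;> linarith
    have hM0 : 0 ≤ M := (abs_nonneg _).trans hq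
    -- the constant `6` exceeds `1 + 2 * (15 / 7)`
    have h1 := abs_le.1 hq
    have h2 := abs_le.1 this
    rw [abs_le]; constructor <;> linarith
  | succ n ih =>
    have hchild : ∀ i, 0 < 3 * lam - row i → 3 * lam - row i ≤ 1 →
        |cutMean (3 * lam - row i) (u ∘ F i)| ≤ 6 * M := by
      intro i hi0 hi1
      refine ih hi0 hi1 (h.comp_F i) fun z hz hz1 hz2 => hM _ (F_mem_SG i hz) ?_ ?_
      · rw [depth_F, pow_succ]; linarith
      · rw [depth_F]; linarith
    by_cases c1 : lam ≤ 1 / 3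
    · have := hchild 0 (by simp only [row, Matrix.cons_val]; linarith)
        (by simp only [row, Matrix.cons_val]; linarith)
      rw [h.cutMean_top h0 c1]
      simpa [row] using this
    by_cases c2 : lam ≤ 2 / 3
    · have hr : ∀ i : Fin 6, row i = 1 → |cutMean (3 * lam - 1) (u ∘ F i)| ≤ 6 * M := by
        intro i hi
        rw [← hi]
        exact hchild i (by rw [hi]; linarith) (by rw [hi]; linarith)
      rw [h.cutMean_middle (not_le.1 c1) c2]
      have a4 := abs_le.1 (hr 4 rfl)
      have a5 := abs_le.1 (hr 5 rfl)
      rw [abs_le]; constructor <;> linarith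
    · have hr : ∀ i : Fin 6, row i = 2 → |cutMean (3 * lam - 2) (u ∘ F i)| ≤ 6 * M := by
        intro i hi
        rw [← hi]
        exact hchild i (by rw [hi]; linarith) (by rw [hi]; linarith)
      rw [h.cutMean_bottom (not_le.1 c2) h1 _ rfl]
      have hc := two_le_conductance (lam := 3 * lam - 2) (by linarith) (by linarith)
      generalize conductance (3 * lam - 2) = x at *
      set s := (6 + x) / (18 + 4 * x) with hs
      set t := (3 + x) / (9 + 2 * x) with ht
      have hst : 2 * s + t = 1 := by
        rw [hs, ht, show (18 : ℝ) + 4 * x = 2 * (9 + 2 * x) by ring]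
        have : 9 + 2 * x ≠ 0 := by linarith
        field_simp; ring
      have hs0 : 0 ≤ s := by positivity
      have ht0 : 0 ≤ t := by positivity
      have a1 := hr 1 rfl
      have a2 := hr 2 rfl
      have a3 := hr 3 rfl
      refine (abs_add_three _ _ _).trans ?_
      rw [abs_mul, abs_mul, abs_mul, abs_of_nonneg hs0, abs_of_nonneg ht0]
      have hsum : s * (6 * M) + s * (6 * M) + t * (6 * M) = 6 * M := by
        linear_combination 6 * M * hst
      linarith [mul_le_mul_of_nonneg_left a1 hs0, mul_le_mul_of_nonneg_left a2 hs0,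
        mul_le_mul_of_nonneg_left a3 ht0]

/-! ### Functions vanishing on the cut -/

theorem isCompact_depth_le (lam : ℝ) : IsCompact {z | z ∈ SG ∧ 1 - z.2 ≤ lam} :=
  SG_isCompact.inter_right (isClosed_le (continuous_const.sub continuous_snd) continuous_const)

/-- A continuous function vanishing on the cut is small on a strip above it. -/
theorem exists_strip {lam : ℝ} {u : ℝ × ℝ → ℝ} (hu : ContinuousOn u {z | z ∈ SG ∧ 1 - z.2 ≤ lam})
    (hX : ∀ z ∈ SG, 1 - z.2 = lam → u z = 0) {ε : ℝ} (hε : 0 < ε) :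
    ∃ n : ℕ, ∀ z ∈ SG, lam - (1 / 3) ^ n ≤ 1 - z.2 → 1 - z.2 ≤ lam → |u z| ≤ ε := by
  by_contra! hcon
  choose z hzS hz1 hz2 hz3 using hcon
  obtain ⟨x, hx, φ, hφ, hlim⟩ := (isCompact_depth_le lam).tendsto_subseq
    (x := z) fun n => ⟨hzS n, hz2 n⟩
  have hdepth : Tendsto (fun n => 1 - (z (φ n)).2) atTop (𝓝 (1 - x.2)) :=
    ((continuous_const.sub continuous_snd).tendsto x).comp hlim
  have hp : Tendsto (fun n => lam - (1 / 3 : ℝ) ^ φ n) atTop (𝓝 lam) := by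
    simpa using tendsto_const_nhds.sub ((tendsto_pow_atTop_nhds_zero_of_lt_one
      (by norm_num : (0 : ℝ) ≤ 1 / 3) (by norm_num)).comp hφ.tendsto_atTop)
  have hle : lam ≤ 1 - x.2 := le_of_tendsto_of_tendsto' hp hdepth fun n => hz1 _
  have h0 := hX x hx.1 (le_antisymm hx.2 hle)
  have hc : Tendsto (fun n => |u (z (φ n))|) atTop (𝓝 |u x|) :=
    ((hu x hx).tendsto.comp (tendsto_nhdsWithin_iff.2
      ⟨hlim, Eventually.of_forall fun n => ⟨hzS _, hz2 _⟩⟩)).abs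
  have := ge_of_tendsto' hc fun n => (hz3 (φ n)).le
  rw [h0, abs_zero] at this
  linarith

/-- The conductance is the normal derivative of the function with value `1` at the apex and `0` on
the cut. -/
theorem Harm.nd_eq_conductance_mul {lam : ℝ} (h0 : 0 < lam) (h1 : lam ≤ 1) {u : ℝ × ℝ → ℝ}
    (h : Harm lam u) (hu : ContinuousOn u {z | z ∈ SG ∧ 1 - z.2 ≤ lam})
    (hX : ∀ z ∈ SG, 1 - z.2 = lam → u z = 0) : nd u = conductance lam * u (corner 0) := by
  have hz : cutMean lam u = 0 := by
    rw [← abs_nonpos_iff]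
    refine le_of_forall_pos_le_add fun ε hε => ?_
    obtain ⟨n, hn⟩ := exists_strip hu hX (by linarith : 0 < ε / 6)
    have := h.abs_cutMean_le_of_strip n h0 h1 hn
    linarith
  have := two_le_conductance h0 h1
  rw [cutMean, sub_eq_zero, eq_div_iff (by linarith)] at hz
  linarith

end UpperDomain

namespace UpperDomain

/-! ### Construction of the harmonic function vanishing on the cut -/

/-- The values at the points of `V 1` of the harmonic function with corner values `v`. If
`0 < lam ≤ 1` the function vanishes on the cut, and `v` is supposed to vanish except at the apex. -/
noncomputable def cellVal (lam : ℝ) (v : Fin 3 → ℝ) : Fin 10 → ℝ :=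
  if 1 < lam then fullVal v else
  if lam ≤ 1 / 3 then ![v 0, 0, 0, 0, 0, 0, 0, 0, 0, 0] else
  if lam ≤ 2 / 3 then
    let s := v 0 / (1 + conductance (3 * lam - 1))
    ![v 0, 0, 0, s, s, 0, 0, 0, 0, 0]
  else
    let x := conductance (3 * lam - 2)
    let e := v 0 / (3 * x ^ 2 + 15 * x + 6)
    let s := e * (x ^ 2 + 6 * x + 6)
    let t := e * (x + 6)
    ![v 0, 0, 0, s, s, t, e * (6 + 2 * x), t, 0, 0]

/-- The corner values that the harmonic function induces on the cell `i`. -/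
noncomputable def childVec (lam : ℝ) (v : Fin 3 → ℝ) (i : Fin 6) : Fin 3 → ℝ :=
  fun k => cellVal lam v (label i k)

/-- The corner values `v` vanish at the corners that are not above depth `lam`. -/
def Valid (lam : ℝ) (v : Fin 3 → ℝ) : Prop :=
  (lam ≤ 1 → v 1 = 0 ∧ v 2 = 0) ∧ (lam ≤ 0 → v 0 = 0)

theorem cellVal_diag {lam : ℝ} {v : Fin 3 → ℝ} (h : Valid lam v) (k : Fin 3) :
    cellVal lam v (label (k.castLE (by norm_num)) k) = v k := by
  unfold cellVal
  split_ifs with h1 h2 h3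
  · fin_cases k <;> simp [label, fullVal]
  all_goals
    obtain ⟨e1, e2⟩ := h.1 (not_lt.1 h1)
    fin_cases k <;> simp [label, e1, e2]

theorem cellVal_eq_zero_of_nonpos {lam : ℝ} {v : Fin 3 → ℝ} (h : Valid lam v) (h0 : lam ≤ 0)
    (n : Fin 10) : cellVal lam v n = 0 := by
  rw [cellVal, if_neg (by linarith), if_pos (by linarith), h.2 h0]
  fin_cases n <;> rfl

theorem valid_childVec {lam : ℝ} {v : Fin 3 → ℝ} (h : Valid lam v) (i : Fin 6) :
    Valid (3 * lam - row i) (childVec lam v i) := by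
  rcases le_or_gt lam 0 with h0 | h0
  · have := cellVal_eq_zero_of_nonpos h h0
    exact ⟨fun _ => ⟨this _, this _⟩, fun _ => this _⟩
  unfold childVec cellVal
  split_ifs with h1 h2 h3
  · have := one_lt_child h1 i
    exact ⟨fun h => by linarith, fun h => by linarith⟩
  · fin_cases i <;> simp [Valid, label, row]
    all_goals intro _; linarith
  · fin_cases i <;> simp [Valid, label, row]
    all_goals first | (constructor <;> intro _ <;> exfalso <;> linarith) | skip
    all_goals (intro _; exfalso; linarith)
  · fin_cases i <;> simp [Valid, label, row]
    all_goals first | (constructor <;> intro _ <;> exfalso <;> linarith) | skip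
    all_goals (intro _; exfalso; linarith)

/-- A bound for the oscillation of the corner values. For a cut cell it also bounds the total flux
into the cut: the apex value alone need not decrease when passing to the top cell, but the
renormalized flux does. -/
def Spread (lam : ℝ) (v : Fin 3 → ℝ) (M : ℝ) : Prop :=
  (∀ j k, |v j - v k| ≤ M) ∧ (0 < lam → lam ≤ 1 → conductance lam * |v 0| ≤ M)

theorem Spread.nonneg {lam : ℝ} {v : Fin 3 → ℝ} {M : ℝ} (h : Spread lam v M) : 0 ≤ M := by
  simpa using h.1 0 0

theorem exists_spread (lam : ℝ) (v : Fin 3 → ℝ) : ∃ M, Spread lam v M := by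
  refine ⟨2 * ∑ j, |v j| + |conductance lam| * |v 0|, fun j k => ?_, fun _ _ => ?_⟩
  · have hs : ∀ j, |v j| ≤ ∑ j, |v j| := fun j =>
      Finset.single_le_sum (f := fun j => |v j|) (fun i _ => abs_nonneg _) (Finset.mem_univ j)
    have := hs j
    have := hs k
    have := abs_sub (v j) (v k)
    have : 0 ≤ |conductance lam| * |v 0| := by positivity
    linarith
  · have : 0 ≤ ∑ j, |v j| := Finset.sum_nonneg fun _ _ => abs_nonneg _
    have := mul_le_mul_of_nonneg_right (le_abs_self (conductance lam)) (abs_nonneg (v 0))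
    linarith

theorem Spread.abs_apex_le {lam : ℝ} {v : Fin 3 → ℝ} {M : ℝ} (hv : Valid lam v)
    (h : Spread lam v M) (h1 : lam ≤ 1) : |v 0| ≤ M / 2 := by
  rcases le_or_gt lam 0 with h0 | h0
  · rw [hv.2 h0, abs_zero]; linarith [h.nonneg]
  · have := h.2 h0 h1
    have := two_le_conductance h0 h1
    nlinarith [abs_nonneg (v 0)]

/-- The values in a cut cell are fractions of the value at its apex. -/
theorem exists_cellVal_eq {lam : ℝ} (h1 : lam ≤ 1) (v : Fin 3 → ℝ) :
    ∃ c : Fin 10 → ℝ, (∀ n, 0 ≤ c n ∧ c n ≤ 1) ∧ ∀ n, cellVal lam v n = c n * v 0 := by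
  unfold cellVal
  rw [if_neg (not_lt.2 h1)]
  split_ifs with h2 h3
  · refine ⟨![1, 0, 0, 0, 0, 0, 0, 0, 0, 0], fun n => ?_, fun n => ?_⟩ <;> fin_cases n <;> simp
  · have := two_le_conductance (lam := 3 * lam - 1) (by linarith) (by linarith)
    generalize conductance (3 * lam - 1) = x at *
    have hs : 0 ≤ 1 / (1 + x) ∧ 1 / (1 + x) ≤ 1 :=
      ⟨by positivity, by rw [div_le_one (by linarith)]; linarith⟩
    refine ⟨![1, 0, 0, 1 / (1 + x), 1 / (1 + x), 0, 0, 0, 0, 0], fun n => ?_, fun n => ?_⟩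
    · fin_cases n <;> simp only [] <;> first | exact hs | norm_num
    · fin_cases n <;> simp <;> ring
  · have := two_le_conductance (lam := 3 * lam - 2) (by linarith) (by linarith)
    generalize conductance (3 * lam - 2) = x at *
    set D := 3 * x ^ 2 + 15 * x + 6 with hD
    have hD0 : 0 < D := by positivity
    have hs : ∀ y, 0 ≤ y → y ≤ D → 0 ≤ y / D ∧ y / D ≤ 1 := fun y h0 h1 =>
      ⟨by positivity, by rwa [div_le_one hD0]⟩
    have hs1 := hs (x ^ 2 + 6 * x + 6) (by positivity) (by nlinarith)
    have hs2 := hs (x + 6) (by positivity) (by nlinarith)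
    have hs3 := hs (6 + 2 * x) (by positivity) (by nlinarith)
    refine ⟨![1, 0, 0, (x ^ 2 + 6 * x + 6) / D, (x ^ 2 + 6 * x + 6) / D, (x + 6) / D,
      (6 + 2 * x) / D, (x + 6) / D, 0, 0], fun n => ?_, fun n => ?_⟩
    · fin_cases n <;> simp only [] <;> first | exact hs1 | exact hs2 | exact hs3 | norm_num
    · fin_cases n <;> simp <;> ring

theorem abs_cellVal_sub_le {lam : ℝ} {v : Fin 3 → ℝ} {M : ℝ} (hv : Valid lam v)
    (h : Spread lam v M) (n : Fin 10) : |cellVal lam v n - v 0| ≤ M := by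
  rcases le_or_gt lam 1 with h1 | h1
  · obtain ⟨c, hc, e⟩ := exists_cellVal_eq h1 v
    have h2 := h.abs_apex_le hv h1
    have h3 : |c n - 1| ≤ 1 := by rw [abs_le]; constructor <;> linarith [hc n]
    rw [e, show c n * v 0 - v 0 = (c n - 1) * v 0 by ring, abs_mul]
    nlinarith [abs_nonneg (v 0), h.nonneg]
  · rw [cellVal, if_pos h1]
    have a1 := abs_le.1 (h.1 1 0)
    have a2 := abs_le.1 (h.1 2 0)
    have := h.nonneg
    rw [abs_le]
    fin_cases n <;> simp [fullVal] <;> (try constructor) <;> linarith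

theorem Spread.childVec {lam : ℝ} {v : Fin 3 → ℝ} {M : ℝ} (hv : Valid lam v)
    (h : Spread lam v M) (i : Fin 6) :
    Spread (3 * lam - row i) (childVec lam v i) (M / 2) := by
  have hM := h.nonneg
  rcases le_or_gt lam 1 with h1 | h1
  · have ha := h.abs_apex_le hv h1
    refine ⟨fun j k => ?_, fun hc0 hc1 => ?_⟩
    · obtain ⟨c, hc, e⟩ := exists_cellVal_eq h1 v
      have h3 : |c (label i j) - c (label i k)| ≤ 1 := by
        rw [abs_le]; constructor <;> linarith [hc (label i j), hc (label i k)]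
      rw [UpperDomain.childVec, UpperDomain.childVec, e, e, ← sub_mul, abs_mul]
      nlinarith [abs_nonneg (v 0)]
    · rcases le_or_gt lam 0 with h0 | h0
      · have : UpperDomain.childVec lam v i 0 = 0 := cellVal_eq_zero_of_nonpos hv h0 _
        rw [this]; simp; linarith
      have hs := h.2 h0 h1
      have hv0 := abs_nonneg (v 0)
      unfold UpperDomain.childVec cellVal
      rw [if_neg (not_lt.2 h1)]
      split_ifs with h2 h3
      · rw [conductance_top h0 h2] at hs
        revert hc0 hc1
        fin_cases i <;> simp [row, label] <;> intros <;> linarith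
      · rw [conductance_middle (not_le.1 h2) h3, phiOne] at hs
        have hx := two_le_conductance (lam := 3 * lam - 1) (by linarith) (by linarith)
        have key : conductance (3 * lam - 1) * |v 0 / (1 + conductance (3 * lam - 1))| ≤ M / 2 := by
          generalize conductance (3 * lam - 1) = x at *
          rw [abs_div, abs_of_pos (by linarith : 0 < 1 + x)]
          have e : 15 / 7 * (2 * x / (1 + x)) * |v 0| = 30 / 7 * (x * (|v 0| / (1 + x))) := by ring
          rw [e] at hs
          linarith
        revert hc0 hc1
        fin_cases i <;> simp [row, label] <;> intros <;> linarith
      · rw [conductance_bottom (not_le.1 h3) h1, phiTwo] at hs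
        have hx := two_le_conductance (lam := 3 * lam - 2) (by linarith) (by linarith)
        generalize hxe : conductance (3 * lam - 2) = x at *
        set D := 3 * x ^ 2 + 15 * x + 6 with hD
        have hD0 : 0 < D := by positivity
        have e0 : 15 / 7 * (x * (4 * x + 18) / D) * |v 0| =
          15 / 7 * (x * (|v 0| / D)) * (4 * x + 18) := by ring
        have hp : 0 ≤ x * (|v 0| / D) := by positivity
        have key : ∀ y, 0 ≤ y → y ≤ 6 + 2 * x → x * |v 0 / D * y| ≤ M / 2 := by
          intro y hy hy2
          rw [abs_mul, abs_div, abs_of_pos hD0, abs_of_nonneg hy, ← mul_assoc]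
          nlinarith
        have k1 := key (x + 6) (by linarith) (by linarith)
        have k2 := key (6 + 2 * x) (by linarith) (by linarith)
        rw [abs_mul, hD] at k1 k2
        revert hc0 hc1
        fin_cases i <;> simp [row, label, hxe] <;> intros <;> linarith
  · refine ⟨fun j k => ?_, fun _ hc1 => absurd (one_lt_child h1 i) (not_lt.2 hc1)⟩
    have a1 := abs_le.1 (h.1 1 0)
    have a2 := abs_le.1 (h.1 2 0)
    have a3 := abs_le.1 (h.1 2 1)
    simp only [UpperDomain.childVec, cellVal, if_pos h1]
    rw [abs_le]
    fin_cases i <;> fin_cases j <;> fin_cases k <;> simp [label, fullVal] <;>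
      (try constructor) <;> linarith

/-! ### Piecewise affine approximations -/

open Classical in
/-- The function that has the harmonic values at the corners of the `n`-cells and is affine on each
`n`-cell. -/
noncomputable def approx : ℕ → ℝ → (Fin 3 → ℝ) → ℝ × ℝ → ℝ
  | 0, _, v, x => ∑ j, v j * bary x j
  | n + 1, lam, v, x =>
    if h : ∃ i, G i x ∈ SG then
      approx n (3 * lam - row h.choose) (childVec lam v h.choose) (G h.choose x)
    else 0

theorem approx_succ_of_corner {n : ℕ}
    (hn : ∀ (lam : ℝ) (v : Fin 3 → ℝ), Valid lam v → ∀ j, approx n lam v (corner j) = v j)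
    {lam : ℝ} {v : Fin 3 → ℝ} (hv : Valid lam v) (i : Fin 6) {x : ℝ × ℝ} (hx : x ∈ SG) :
    approx (n + 1) lam v (F i x) = approx n (3 * lam - row i) (childVec lam v i) x := by
  have h : ∃ j, G j (F i x) ∈ SG := ⟨i, by rwa [G_F]⟩
  rw [approx, dif_pos h]
  have hj := h.choose_spec
  generalize h.choose = j at *
  by_cases hji : j = i
  · subst hji; rw [G_F]
  · obtain ⟨k, hk⟩ := exists_corner_of_F_eq hji hj hx (F_G j _)
    obtain ⟨l, rfl⟩ := exists_corner_of_F_eq (Ne.symm hji) hx hj (F_G j _).symm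
    rw [hk, hn _ _ (valid_childVec hv j), hn _ _ (valid_childVec hv i)]
    have : F j (corner k) = F i (corner l) := by rw [← hk, F_G]
    rw [childVec, childVec, F_corner_eq_iff.1 this]

theorem approx_corner (n : ℕ) : ∀ (lam : ℝ) (v : Fin 3 → ℝ), Valid lam v →
    ∀ j, approx n lam v (corner j) = v j := by
  induction n with
  | zero =>
    intro lam v _ j
    simp [approx, bary_corner]
  | succ n ih =>
    intro lam v hv j
    rw [← corner_fixed j, approx_succ_of_corner ih hv _ (corner_mem_SG j),
      ih _ _ (valid_childVec hv _), childVec, cellVal_diag hv]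

theorem approx_F (n : ℕ) {lam : ℝ} {v : Fin 3 → ℝ} (hv : Valid lam v) (i : Fin 6) {x : ℝ × ℝ}
    (hx : x ∈ SG) :
    approx (n + 1) lam v (F i x) = approx n (3 * lam - row i) (childVec lam v i) x :=
  approx_succ_of_corner (approx_corner n) hv i hx

theorem continuousOn_approx (n : ℕ) {lam : ℝ} {v : Fin 3 → ℝ} (hv : Valid lam v) :
    ContinuousOn (approx n lam v) SG := by
  induction n generalizing lam v with
  | zero =>
    refine Continuous.continuousOn ?_
    show Continuous fun x => ∑ j, v j * bary x j
    exact continuous_finsetSum _ fun j _ => continuous_const.mul (continuous_bary j)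
  | succ n ih =>
    rw [SG_invariant]
    refine LocallyFinite.continuousOn_iUnion (locallyFinite_of_finite _)
      (fun i => ((SG_isCompact.image (continuous_F i)).isClosed)) fun i => ?_
    have h1 : ContinuousOn (fun x => approx n (3 * lam - row i) (childVec lam v i) (G i x))
        (F i '' SG) := by
      refine (ih (valid_childVec hv i)).comp (continuous_G i).continuousOn ?_
      rintro _ ⟨x, hx, rfl⟩
      rwa [G_F]
    refine h1.congr ?_
    rintro _ ⟨x, hx, rfl⟩
    simp only [G_F]
    exact approx_F n hv i hx

theorem abs_approx_zero_sub_le {lam : ℝ} {v : Fin 3 → ℝ} {M : ℝ} (h : Spread lam v M)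
    {x : ℝ × ℝ} (hx : x ∈ SG) : |approx 0 lam v x - v 0| ≤ M := by
  have e : approx 0 lam v x - v 0 = ∑ j, (v j - v 0) * bary x j := by
    simp only [approx, sub_mul, Finset.sum_sub_distrib, ← Finset.mul_sum, sum_bary, mul_one]
  rw [e]
  calc _ ≤ ∑ j, |(v j - v 0) * bary x j| := Finset.abs_sum_le_sum_abs _ _
    _ ≤ ∑ j, M * bary x j := Finset.sum_le_sum fun j _ => by
        rw [abs_mul, abs_of_nonneg (bary_nonneg hx j)]
        exact mul_le_mul_of_nonneg_right (h.1 j 0) (bary_nonneg hx j)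
    _ = M := by rw [← Finset.mul_sum, sum_bary, mul_one]

theorem abs_approx_succ_sub_le (n : ℕ) {lam : ℝ} {v : Fin 3 → ℝ} {M : ℝ} (hv : Valid lam v)
    (h : Spread lam v M) {x : ℝ × ℝ} (hx : x ∈ SG) :
    |approx n lam v x - approx (n + 1) lam v x| ≤ 3 * M / 2 ^ n := by
  obtain ⟨i, z, hz, rfl⟩ := exists_F_of_mem_SG hx
  induction n generalizing lam v M i z with
  | zero =>
    rw [approx_F 0 hv i hz]
    have h1 := abs_le.1 (abs_approx_zero_sub_le h hx)
    have h2 := abs_le.1 (abs_approx_zero_sub_le (h.childVec hv i) hz)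
    have h3 := abs_le.1 (abs_cellVal_sub_le hv h (label i 0))
    have := h.nonneg
    simp only [childVec] at h2
    rw [abs_le]
    constructor <;> norm_num <;> linarith
  | succ n ih =>
    rw [approx_F _ hv i hz, approx_F _ hv i hz]
    obtain ⟨j, y, hy, rfl⟩ := exists_F_of_mem_SG hz
    refine (ih (valid_childVec hv i) (h.childVec hv i) j y hy hz).trans (le_of_eq ?_)
    rw [pow_succ]; ring

/-- The harmonic function with corner values `v`, vanishing at depth at least `lam` if
`lam ≤ 1`. -/
noncomputable def extend (lam : ℝ) (v : Fin 3 → ℝ) (x : ℝ × ℝ) : ℝ :=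
  limUnder atTop fun n => approx n lam v x

theorem tendsto_approx {lam : ℝ} {v : Fin 3 → ℝ} (hv : Valid lam v) {x : ℝ × ℝ} (hx : x ∈ SG) :
    Tendsto (fun n => approx n lam v x) atTop (𝓝 (extend lam v x)) := by
  obtain ⟨M, hM⟩ := exists_spread lam v
  refine CauchySeq.tendsto_limUnder ?_
  refine cauchySeq_of_le_geometric_two (C := 6 * M) fun n => ?_
  rw [Real.dist_eq]
  refine (abs_approx_succ_sub_le n hv hM hx).trans (le_of_eq ?_)
  ring

theorem abs_approx_sub_extend_le (n : ℕ) {lam : ℝ} {v : Fin 3 → ℝ} {M : ℝ} (hv : Valid lam v)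
    (h : Spread lam v M) {x : ℝ × ℝ} (hx : x ∈ SG) :
    |approx n lam v x - extend lam v x| ≤ 6 * M / 2 ^ n := by
  refine dist_le_of_le_geometric_two_of_tendsto (C := 6 * M) (fun n => ?_) (tendsto_approx hv hx) n
  rw [Real.dist_eq]
  refine (abs_approx_succ_sub_le n hv h hx).trans (le_of_eq ?_)
  ring

theorem extend_corner {lam : ℝ} {v : Fin 3 → ℝ} (hv : Valid lam v) (j : Fin 3) :
    extend lam v (corner j) = v j :=
  tendsto_nhds_unique (tendsto_approx hv (corner_mem_SG j))
    (tendsto_const_nhds.congr fun n => (approx_corner n lam v hv j).symm)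

theorem extend_F {lam : ℝ} {v : Fin 3 → ℝ} (hv : Valid lam v) (i : Fin 6) {x : ℝ × ℝ}
    (hx : x ∈ SG) : extend lam v (F i x) = extend (3 * lam - row i) (childVec lam v i) x :=
  tendsto_nhds_unique ((tendsto_add_atTop_iff_nat 1).2 (tendsto_approx hv (F_mem_SG i hx)))
    ((tendsto_approx (valid_childVec hv i) hx).congr fun n => (approx_F n hv i hx).symm)

theorem eqOn_extend_comp_F {lam : ℝ} {v : Fin 3 → ℝ} (hv : Valid lam v) (i : Fin 6) :
    EqOn (extend lam v ∘ F i) (extend (3 * lam - row i) (childVec lam v i)) SG :=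
  fun _ hx => extend_F hv i hx

theorem continuousOn_extend {lam : ℝ} {v : Fin 3 → ℝ} (hv : Valid lam v) :
    ContinuousOn (extend lam v) SG := by
  obtain ⟨M, hM⟩ := exists_spread lam v
  have hu : TendstoUniformlyOn (fun n => approx n lam v) (extend lam v) atTop SG := by
    rw [Metric.tendstoUniformlyOn_iff]
    intro ε hε
    have ht : Tendsto (fun n : ℕ => 6 * M / 2 ^ n) atTop (𝓝 0) :=
      tendsto_const_nhds.div_atTop (tendsto_pow_atTop_atTop_of_one_lt (by norm_num))
    filter_upwards [ht.eventually_lt_const hε] with n hn x hx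
    rw [dist_comm, Real.dist_eq]
    exact (abs_approx_sub_extend_le n hv hM hx).trans_lt hn
  exact hu.continuousOn (Frequently.of_forall fun n => continuousOn_approx n hv)

/-- A point on or below the cut stays there in every level of cells, whereas `Spread` is halved. -/
theorem abs_extend_le (n : ℕ) {lam : ℝ} {v : Fin 3 → ℝ} {M : ℝ} (hv : Valid lam v)
    (h : Spread lam v M) (h1 : lam ≤ 1) {x : ℝ × ℝ} (hx : x ∈ SG) (hd : lam ≤ 1 - x.2) :
    |extend lam v x| ≤ 8 * M / 2 ^ n := by
  induction n generalizing lam v M x with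
  | zero =>
    have a1 := abs_le.1 (h.abs_apex_le hv h1)
    have a2 := abs_le.1 (abs_approx_zero_sub_le h hx)
    have a3 := abs_le.1 (abs_approx_sub_extend_le 0 hv h hx)
    rw [pow_zero, div_one] at a3 ⊢
    rw [abs_le]
    have := h.nonneg
    constructor <;> linarith
  | succ n ih =>
    obtain ⟨i, z, hz, rfl⟩ := exists_F_of_mem_SG hx
    rw [depth_F] at hd
    have hz1 := depth_le_one hz
    rw [extend_F hv i hz]
    refine (ih (valid_childVec hv i) (h.childVec hv i) (by linarith) hz (by linarith)).trans
      (le_of_eq ?_)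
    rw [pow_succ]; ring

theorem extend_eq_zero {lam : ℝ} {v : Fin 3 → ℝ} (hv : Valid lam v) (h1 : lam ≤ 1) {x : ℝ × ℝ}
    (hx : x ∈ SG) (hd : lam ≤ 1 - x.2) : extend lam v x = 0 := by
  obtain ⟨M, hM⟩ := exists_spread lam v
  have ht : Tendsto (fun n : ℕ => 8 * M / 2 ^ n) atTop (𝓝 0) :=
    tendsto_const_nhds.div_atTop (tendsto_pow_atTop_atTop_of_one_lt (by norm_num))
  exact abs_nonpos_iff.1 (ge_of_tendsto' ht fun n => abs_extend_le n hv hM h1 hx hd)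

/-! ### Harmonicity of the construction -/

/-- The outward flux at a corner, in terms of the corner values. -/
noncomputable def vecFlux (lam : ℝ) (v : Fin 3 → ℝ) (l : Fin 3) : ℝ :=
  if 1 < lam then ∑ j, (v l - v j) else conductance lam * v 0

/-- The flux at a corner is renormalized by `7 / 15` when passing to the cell at that corner. -/
theorem vecFlux_childVec {lam : ℝ} {v : Fin 3 → ℝ} {l : Fin 3} (h : 1 < lam ∨ (l = 0 ∧ 0 < lam)) :
    vecFlux (3 * lam - row (l.castLE (by norm_num))) (childVec lam v (l.castLE (by norm_num))) l =
      7 / 15 * vecFlux lam v l := by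
  by_cases h1 : 1 < lam
  · rw [vecFlux, if_pos (one_lt_child h1 _), vecFlux, if_pos h1, ← sum_fullVal_diag v l]
    simp only [childVec, cellVal, if_pos h1]
  obtain ⟨rfl, h0⟩ := h.resolve_left h1
  have h1' := not_lt.1 h1
  have hr : row ((0 : Fin 3).castLE (by norm_num : 3 ≤ 6)) = 0 := rfl
  rw [hr, sub_zero]
  simp only [vecFlux, if_neg h1, childVec, cellVal]
  by_cases h2 : lam ≤ 1 / 3
  · rw [if_neg (by linarith), if_pos h2, conductance_top h0 h2]
    simp [label]; ring
  have h2' := not_le.1 h2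
  rw [if_pos (by linarith), if_neg h2]
  by_cases h3 : lam ≤ 2 / 3
  · rw [if_pos h3, conductance_middle h2' h3, phiOne]
    have hx := two_le_conductance (lam := 3 * lam - 1) (by linarith) (by linarith)
    have : 1 + conductance (3 * lam - 1) ≠ 0 := by linarith
    simp [label, Fin.sum_univ_three]
    field_simp
    ring
  · rw [if_neg h3, conductance_bottom (not_le.1 h3) h1', phiTwo]
    have hx := two_le_conductance (lam := 3 * lam - 2) (by linarith) (by linarith)
    generalize conductance (3 * lam - 2) = x at *
    have : 3 * x ^ 2 + 15 * x + 6 ≠ 0 := by positivity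
    simp [label, Fin.sum_univ_three]
    field_simp
    ring

theorem graphLaplacian_extend_corner (m : ℕ) {lam : ℝ} {v : Fin 3 → ℝ} (hv : Valid lam v)
    {l : Fin 3} (h : 1 < lam ∨ (l = 0 ∧ (1 / 3) ^ m < lam)) :
    graphLaplacian m (extend lam v) (corner l) = (7 / 15) ^ m * vecFlux lam v l := by
  induction m generalizing lam v with
  | zero =>
    have h1 : 1 < lam := h.elim id fun h => by simpa using h.2
    rw [graphLaplacian_zero_corner, vecFlux, if_pos h1]
    simp [extend_corner hv]
  | succ m ih =>
    rw [graphLaplacian_succ_corner, graphLaplacian_congr (eqOn_extend_comp_F hv _),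
      ih (valid_childVec hv _), vecFlux_childVec, pow_succ, mul_assoc]
    · exact h.imp_right fun h => ⟨h.1, lt_trans (by positivity) h.2⟩
    · refine h.imp (fun h => one_lt_child h _) fun h' => ⟨h'.1, ?_⟩
      obtain ⟨rfl, h'⟩ := h'
      have hr : row ((0 : Fin 3).castLE (by norm_num : 3 ≤ 6)) = 0 := rfl
      rw [pow_succ] at h'
      rw [hr]; linarith

theorem exists_label_not_apex : ∀ n : Fin 10, 3 ≤ n → ∃ j l, l ≠ 0 ∧ label j l = n := by
  decide

/-- The values `cellVal` solve the linear equations at the points of `V 1` that lie above the cut. -/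
theorem sum_vecFlux_eq_zero {lam : ℝ} (v : Fin 3 → ℝ) {n : Fin 10} (hn : 3 ≤ n)
    (hm : ∀ j l, label j l = n → 1 < 3 * lam - row j ∨ (l = 0 ∧ 0 < 3 * lam - row j)) :
    ∑ j, ∑ l, (if label j l = n then vecFlux (3 * lam - row j) (childVec lam v j) l else 0) = 0 := by
  have hm' : ∀ j l, l ≠ 0 → label j l = n → 1 < 3 * lam - row j := fun j l hl h =>
    (hm j l h).resolve_right fun h => hl h.1
  have r0 : row 0 = 0 := rfl
  have r1 : row 1 = 2 := rfl
  have r2 : row 2 = 2 := rfl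
  have r3 : row 3 = 2 := rfl
  have r4 : row 4 = 1 := rfl
  have r5 : row 5 = 1 := rfl
  by_cases h1 : 1 < lam
  · simp only [vecFlux, if_pos (one_lt_child h1 _), childVec, cellVal, if_pos h1]
    clear hm hm'
    revert hn
    fin_cases n <;> simp [Fin.sum_univ_succ, label, fullVal] <;> ring
  rcases le_or_gt lam (1 / 3) with h2 | h2
  · obtain ⟨j, l, hl, h⟩ := exists_label_not_apex n hn
    have := hm' j l hl h
    have hr : 0 ≤ row j := by fin_cases j <;> norm_num [row]
    linarith
  have p0 : 1 < 3 * lam := by linarith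
  rcases le_or_gt lam (2 / 3) with h3 | h3
  · have p1 : ¬ 1 < 3 * lam - 1 := by linarith
    have p2 : ¬ 1 < 3 * lam - 2 := by linarith
    have hx := two_le_conductance (lam := 3 * lam - 1) (by linarith) (by linarith)
    simp only [vecFlux, childVec, cellVal, if_neg h1, if_neg (not_le.2 h2), if_pos h3]
    clear hm
    have : 1 + conductance (3 * lam - 1) ≠ 0 := by linarith
    fin_cases n
    · exact absurd hn (by decide)
    · exact absurd hn (by decide)
    · exact absurd hn (by decide)
    · simp [Fin.sum_univ_succ, label, r0, r5, p0, p1]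
      field_simp; ring
    · simp [Fin.sum_univ_succ, label, r0, r4, p0, p1]
      field_simp; ring
    · exact absurd (hm' 5 1 (by decide) rfl) (by rw [r5]; exact p1)
    · exact absurd (hm' 5 2 (by decide) rfl) (by rw [r5]; exact p1)
    · exact absurd (hm' 4 2 (by decide) rfl) (by rw [r4]; exact p1)
    · exact absurd (hm' 1 2 (by decide) rfl) (by rw [r1]; exact p2)
    · exact absurd (hm' 3 2 (by decide) rfl) (by rw [r3]; exact p2)
  · have p1 : 1 < 3 * lam - 1 := by linarith
    have p2 : ¬ 1 < 3 * lam - 2 := by linarith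
    have hx := two_le_conductance (lam := 3 * lam - 2) (by linarith) (by linarith)
    simp only [vecFlux, childVec, cellVal, if_neg h1, if_neg (not_le.2 h2), if_neg (not_le.2 h3)]
    clear hm
    have : 3 * conductance (3 * lam - 2) ^ 2 + 15 * conductance (3 * lam - 2) + 6 ≠ 0 := by
      positivity
    fin_cases n
    · exact absurd hn (by decide)
    · exact absurd hn (by decide)
    · exact absurd hn (by decide)
    · simp [Fin.sum_univ_succ, label, r0, r5, p0, p1]
      field_simp; ring
    · simp [Fin.sum_univ_succ, label, r0, r4, p0, p1]
      field_simp; ring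
    · simp [Fin.sum_univ_succ, label, r1, r5, p1, p2]
      field_simp; ring
    · simp [Fin.sum_univ_succ, label, r3, r4, r5, p1, p2]
      field_simp; ring
    · simp [Fin.sum_univ_succ, label, r2, r4, p1, p2]
      field_simp; ring
    · exact absurd (hm' 1 2 (by decide) rfl) (by rw [r1]; exact p2)
    · exact absurd (hm' 3 2 (by decide) rfl) (by rw [r3]; exact p2)

theorem corner_mem_cell_const (m : ℕ) (l : Fin 3) :
    corner l ∈ cell (fun _ : Fin m => l.castLE (by norm_num : 3 ≤ 6)) := by
  induction m with
  | zero => rw [cell_zero]; exact corner_mem_SG l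
  | succ m ih =>
    rw [← Fin.cons_self_tail (fun _ : Fin (m + 1) => l.castLE (by norm_num : 3 ≤ 6)), mem_cell_cons]
    exact ⟨_, ih, corner_fixed l⟩

theorem exists_depth_eq_of_const_zero (m : ℕ) :
    ∃ z ∈ cell (fun _ : Fin m => (0 : Fin 6)), 1 - z.2 = (1 / 3) ^ m := by
  induction m with
  | zero => exact ⟨corner 1, by rw [cell_zero]; exact corner_mem_SG 1, by rw [depth_corner]; simp⟩
  | succ m ih =>
    obtain ⟨z, hz, hd⟩ := ih
    refine ⟨F 0 z, ?_, ?_⟩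
    · rw [← Fin.cons_self_tail (fun _ : Fin (m + 1) => (0 : Fin 6)), mem_cell_cons]
      exact ⟨z, hz, rfl⟩
    · rw [depth_F, hd, show row 0 = 0 from rfl, pow_succ]; ring

theorem three_le_label : ∀ (i : Fin 6) (k : Fin 3),
    (¬ ∃ l : Fin 3, label i k = label (l.castLE (by norm_num)) l) → 3 ≤ label i k := by
  decide

theorem harm_extend {lam : ℝ} {v : Fin 3 → ℝ} (hv : Valid lam v) : Harm lam (extend lam v) := by
  intro m
  induction m generalizing lam v with
  | zero => exact fun x hx hx0 => absurd hx hx0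
  | succ m ih =>
    intro x hx hx0 hw
    obtain ⟨i, z, hz, rfl⟩ := mem_iUnion.1 hx
    have hzS := V_subset_SG m hz
    by_cases hz0 : z ∈ V 0
    · obtain ⟨k, rfl⟩ := hz0
      rw [graphLaplacian_F_corner]
      rw [F_corner_mem_V_zero_iff] at hx0
      have hcell : ∀ j l, label j l = label i k →
          1 < 3 * lam - row j ∨ (l = 0 ∧ (1 / 3) ^ m < 3 * lam - row j) := by
        intro j l hjl
        have ha : Above (3 * lam - row j) (fun _ : Fin m => l.castLE (by norm_num : 3 ≤ 6)) := by
          rw [← above_cons]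
          refine hw _ (mem_cell_cons.2 ⟨_, corner_mem_cell_const m l, F_corner_of_label hjl⟩)
        by_cases hl : l = 0
        · subst hl
          obtain ⟨y, hy, hd⟩ := exists_depth_eq_of_const_zero m
          exact Or.inr ⟨rfl, hd ▸ ha y hy⟩
        · left
          have := ha _ (corner_mem_cell_const m l)
          rwa [depth_corner, if_neg hl] at this
      have hsum := sum_vecFlux_eq_zero (lam := lam) v (three_le_label i k hx0) fun j l hjl =>
        (hcell j l hjl).imp_right fun h => ⟨h.1, lt_trans (by positivity) h.2⟩
      rw [← mul_eq_zero_iff_left (by positivity : (7 / 15 : ℝ) ^ m ≠ 0), Finset.mul_sum] at hsum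
      refine (Finset.sum_congr rfl fun j _ => ?_).trans hsum
      rw [Finset.mul_sum]
      refine Finset.sum_congr rfl fun l _ => ?_
      rw [mul_ite, mul_zero]
      refine if_ctx_congr Iff.rfl (fun hjl => ?_) fun _ => rfl
      rw [graphLaplacian_congr (eqOn_extend_comp_F hv j),
        graphLaplacian_extend_corner m (valid_childVec hv j) (hcell j l hjl)]
    · rw [graphLaplacian_F hzS hz0, graphLaplacian_congr (eqOn_extend_comp_F hv i)]
      refine ih (valid_childVec hv i) z hz hz0 fun w hzw => ?_
      rw [← above_cons]
      exact hw _ (mem_cell_cons.2 ⟨z, hzw, rfl⟩)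

/-! ### The solution with boundary data `1` and `0` -/

theorem mem_X_iff {lam : ℝ} {z : ℝ × ℝ} : z ∈ X lam ↔ z ∈ SG ∧ 1 - z.2 = lam :=
  and_congr_right fun _ => ⟨fun h => by linarith, fun h => by linarith⟩

theorem corner_zero_notMem_X {lam : ℝ} (h0 : 0 < lam) : corner 0 ∉ X lam := by
  rw [mem_X_iff, depth_corner]
  rintro ⟨-, h⟩
  simp at h
  linarith

theorem omegaBar_eq {lam : ℝ} (h0 : 0 < lam) (h1 : lam ≤ 1) :
    OmegaBar lam = {z | z ∈ SG ∧ 1 - z.2 ≤ lam} := by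
  ext z
  constructor
  · rintro (h | h | h)
    · exact ⟨h.1, by linarith [h.2.2]⟩
    · rw [mem_singleton_iff.1 h]
      exact ⟨corner_mem_SG 0, by rw [depth_corner]; simpa using h0.le⟩
    · exact ⟨h.1, by linarith [h.2]⟩
  · rintro ⟨hz, hd⟩
    rcases hd.lt_or_eq with hd | hd
    · by_cases hV : z ∈ V 0
      · obtain ⟨k, rfl⟩ := hV
        rw [depth_corner] at hd
        split_ifs at hd with hk
        · rw [hk]; exact Or.inr (Or.inl rfl)
        · linarith
      · exact Or.inl ⟨hz, hV, by linarith⟩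
    · exact Or.inr (Or.inr (mem_X_iff.2 ⟨hz, hd⟩))

theorem isSolution_iff {lam : ℝ} (h0 : 0 < lam) (h1 : lam ≤ 1) {f u : ℝ × ℝ → ℝ} :
    IsSolution lam f u ↔ ContinuousOn u {z | z ∈ SG ∧ 1 - z.2 ≤ lam} ∧ Harm lam u ∧
      EqOn u f (bdry lam) := by
  rw [IsSolution, omegaBar_eq h0 h1, isHarmonic_iff_harm h0 h1]

theorem isSolution_h0 {lam : ℝ} (h0 : 0 < lam) (h1 : lam ≤ 1) :
    IsSolution lam unitData (UpperDomain.h0 lam) := by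
  have hv : Valid lam ![1, 0, 0] := ⟨fun _ => by simp, fun h => absurd h (not_le.2 h0)⟩
  refine Classical.epsilon_spec (p := fun h => IsSolution lam unitData h)
    ⟨extend lam ![1, 0, 0], (isSolution_iff h0 h1).2 ⟨?_, harm_extend hv, ?_⟩⟩
  · exact (continuousOn_extend hv).mono fun z hz => hz.1
  · rintro z (hz | hz)
    · rw [mem_singleton_iff.1 hz, extend_corner hv]
      simp [unitData]
    · have hne : z ∉ ({corner 0} : Set (ℝ × ℝ)) := fun h =>
        corner_zero_notMem_X h0 (mem_singleton_iff.1 h ▸ hz)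
      rw [unitData, indicator_of_notMem hne]
      exact extend_eq_zero hv h1 (mem_X_iff.1 hz).1 (mem_X_iff.1 hz).2.ge

theorem harm_h0 {lam : ℝ} (h0 : 0 < lam) (h1 : lam ≤ 1) : Harm lam (UpperDomain.h0 lam) :=
  ((isSolution_iff h0 h1).1 (isSolution_h0 h0 h1)).2.1

theorem h0_apex {lam : ℝ} (h0 : 0 < lam) (h1 : lam ≤ 1) : UpperDomain.h0 lam (corner 0) = 1 := by
  rw [(isSolution_h0 h0 h1).2.2 (Or.inl rfl)]
  simp [unitData]

theorem h0_eq_zero {lam : ℝ} (h0 : 0 < lam) (h1 : lam ≤ 1) {z : ℝ × ℝ} (hz : z ∈ SG)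
    (hd : 1 - z.2 = lam) : UpperDomain.h0 lam z = 0 := by
  have hX : z ∈ X lam := mem_X_iff.2 ⟨hz, hd⟩
  rw [(isSolution_h0 h0 h1).2.2 (Or.inr hX), unitData, indicator_of_notMem]
  exact fun h => corner_zero_notMem_X h0 (mem_singleton_iff.1 h ▸ hX)

theorem eta_eq_conductance {lam : ℝ} (h0 : 0 < lam) (h1 : lam ≤ 1) :
    eta lam = conductance lam := by
  have h := (harm_h0 h0 h1).nd_eq_conductance_mul h0 h1
    ((isSolution_iff h0 h1).1 (isSolution_h0 h0 h1)).1 fun z hz hd => h0_eq_zero h0 h1 hz hd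
  rwa [h0_apex h0 h1, mul_one] at h

theorem hasNormalDeriv_h0 {lam : ℝ} (h0 : 0 < lam) (h1 : lam ≤ 1) :
    HasNormalDeriv (UpperDomain.h0 lam) (eta lam) :=
  (harm_h0 h0 h1).hasNormalDeriv h0

end UpperDomain

namespace UpperDomain

/-! ### Blocks between consecutive digits -/

theorem exp1_eq_one {lam : ℝ} (h0 : 1 / 3 < lam) (h1 : lam ≤ 1) : exp1 lam = 1 := by
  refine le_antisymm (Nat.sInf_le ?_) (one_le_exp1 (by linarith) h1).1
  show 1 < 3 ^ 1 * lam
  linarith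

theorem exp1_top {lam : ℝ} (h0 : 0 < lam) (h1 : lam ≤ 1 / 3) :
    exp1 lam = exp1 (3 * lam) + 1 := by
  obtain ⟨a1, a2, -⟩ := one_le_exp1 h0 (by linarith)
  obtain ⟨b1, b2, -⟩ := one_le_exp1 (lam := 3 * lam) (by linarith) (by linarith)
  refine le_antisymm (Nat.sInf_le ?_) ?_
  · show 1 < 3 ^ (exp1 (3 * lam) + 1) * lam
    rw [pow_succ]; linarith
  · obtain ⟨k, hk⟩ := Nat.exists_eq_add_of_le' a1
    rw [hk, Nat.add_le_add_iff_right]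
    refine Nat.sInf_le ?_
    show 1 < 3 ^ k * (3 * lam)
    rw [hk, pow_succ] at a2; linarith

theorem digit1_top {lam : ℝ} (h0 : 0 < lam) (h1 : lam ≤ 1 / 3) :
    digit1 lam = digit1 (3 * lam) := by
  rw [digit1, digit1, exp1_top h0 h1, pow_succ, mul_assoc]

theorem R_top {lam : ℝ} (h0 : 0 < lam) (h1 : lam ≤ 1 / 3) : R lam = R (3 * lam) := by
  rw [R, R, digit1_top h0 h1, exp1_top h0 h1, pow_succ, mul_assoc]

theorem digit1_middle {lam : ℝ} (h0 : 1 / 3 < lam) (h1 : lam ≤ 2 / 3) : digit1 lam = 1 := by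
  rw [digit1, exp1_eq_one h0 (by linarith), if_pos (by linarith)]

theorem digit1_bottom {lam : ℝ} (h0 : 2 / 3 < lam) (h1 : lam ≤ 1) : digit1 lam = 2 := by
  rw [digit1, exp1_eq_one (by linarith) h1, if_neg (by linarith)]

theorem R_middle {lam : ℝ} (h0 : 1 / 3 < lam) (h1 : lam ≤ 2 / 3) : R lam = 3 * lam - 1 := by
  rw [R, digit1_middle h0 h1, exp1_eq_one h0 (by linarith)]; norm_num

theorem R_bottom {lam : ℝ} (h0 : 2 / 3 < lam) (h1 : lam ≤ 1) : R lam = 3 * lam - 2 := by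
  rw [R, digit1_bottom h0 h1, exp1_eq_one (by linarith) h1]; norm_num

/-- The alphabet of the first digit of `lam`. -/
noncomputable def alphabet (lam : ℝ) : Finset (Fin 6) := if digit1 lam = 1 then {4, 5} else {1, 2, 3}

theorem mem_alphabet {lam : ℝ} {i : Fin 6} : i ∈ alphabet lam ↔ i ∈ letters (digit1 lam) := by
  unfold alphabet letters
  split_ifs <;> simp

theorem alphabet_top {lam : ℝ} (h0 : 0 < lam) (h1 : lam ≤ 1 / 3) :
    alphabet lam = alphabet (3 * lam) := by
  rw [alphabet, alphabet, digit1_top h0 h1]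

theorem alphabet_middle {lam : ℝ} (h0 : 1 / 3 < lam) (h1 : lam ≤ 2 / 3) :
    alphabet lam = {4, 5} := if_pos (digit1_middle h0 h1)

theorem alphabet_bottom {lam : ℝ} (h0 : 2 / 3 < lam) (h1 : lam ≤ 1) :
    alphabet lam = {1, 2, 3} := if_neg (by rw [digit1_bottom h0 h1]; norm_num)

/-- The map `F_0^(m₁-1) F_i` onto the cell that a first letter `i` stands for. -/
noncomputable def block (lam : ℝ) (i : Fin 6) (z : ℝ × ℝ) : ℝ × ℝ := (F 0)^[exp1 lam - 1] (F i z)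

theorem cutMap_cons (lam : ℝ) (i : Fin 6) (w : List (Fin 6)) (z : ℝ × ℝ) :
    cutMap lam (i :: w) z = block lam i (cutMap (R lam) w z) := rfl

theorem block_top {lam : ℝ} (h0 : 0 < lam) (h1 : lam ≤ 1 / 3) (i : Fin 6) (z : ℝ × ℝ) :
    block lam i z = F 0 (block (3 * lam) i z) := by
  have := (one_le_exp1 (lam := 3 * lam) (by linarith) (by linarith)).1
  rw [block, block, ← Function.iterate_succ_apply' (F 0), exp1_top h0 h1,
    show exp1 (3 * lam) + 1 - 1 = (exp1 (3 * lam) - 1).succ by omega]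

theorem block_of_third_lt {lam : ℝ} (h0 : 1 / 3 < lam) (h1 : lam ≤ 1) (i : Fin 6) (z : ℝ × ℝ) :
    block lam i z = F i z := by
  rw [block, exp1_eq_one h0 h1]; rfl

theorem block_mem_SG {lam : ℝ} {i : Fin 6} {z : ℝ × ℝ} (hz : z ∈ SG) : block lam i z ∈ SG := by
  unfold block
  induction exp1 lam - 1 with
  | zero => exact F_mem_SG i hz
  | succ n ih => rw [Function.iterate_succ_apply']; exact F_mem_SG 0 ih

theorem continuous_block (lam : ℝ) (i : Fin 6) : Continuous (block lam i) :=
  ((continuous_F 0).iterate _).comp (continuous_F i)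

theorem block_sub {lam : ℝ} (h0 : 0 < lam) (h1 : lam ≤ 1) (i j : Fin 6) (z z' : ℝ × ℝ) :
    block lam i z - block lam j z' =
      (1 / 3 : ℝ) ^ exp1 lam • ((z + shift i) - (z' + shift j)) := by
  refine ternary_induction (P := fun lam => block lam i z - block lam j z' =
    (1 / 3 : ℝ) ^ exp1 lam • ((z + shift i) - (z' + shift j))) ?_ ?_ h0 h1
  · intro lam h0 h1
    rw [block_of_third_lt h0 h1, block_of_third_lt h0 h1, exp1_eq_one h0 h1, F, F, ← smul_sub,
      pow_one]
  · intro lam h0 h1 ih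
    rw [block_top h0 h1, block_top h0 h1, exp1_top h0 h1, F, F, ← smul_sub, add_sub_add_right_eq_sub,
      ih, smul_smul, pow_succ, mul_comm]

theorem depth_block {lam : ℝ} (h0 : 0 < lam) (h1 : lam ≤ 1) {i : Fin 6} (hi : i ∈ alphabet lam)
    (z : ℝ × ℝ) :
    1 - (block lam i z).2 = lam + (1 / 3) ^ exp1 lam * (1 - z.2 - R lam) := by
  refine ternary_induction (P := fun lam => i ∈ alphabet lam →
    1 - (block lam i z).2 = lam + (1 / 3) ^ exp1 lam * (1 - z.2 - R lam)) ?_ ?_ h0 h1 hi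
  · intro lam h0 h1 hi
    rw [block_of_third_lt h0 h1, exp1_eq_one h0 h1, depth_F]
    rcases le_or_gt lam (2 / 3) with h | h
    · rw [R_middle h0 h]
      rw [alphabet_middle h0 h] at hi
      have : row i = 1 := by fin_cases i <;> first | rfl | simp at hi
      rw [this]; ring
    · rw [R_bottom h h1]
      rw [alphabet_bottom h h1] at hi
      have : row i = 2 := by fin_cases i <;> first | rfl | simp at hi
      rw [this]; ring
  · intro lam h0 h1 ih hi
    rw [alphabet_top h0 h1] at hi
    rw [block_top h0 h1, depth_F, ih hi, exp1_top h0 h1, R_top h0 h1, show row 0 = 0 from rfl,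
      pow_succ]
    ring

theorem Harm.comp_block {lam : ℝ} (h0 : 0 < lam) (h1 : lam ≤ 1) {i : Fin 6} (hi : i ∈ alphabet lam)
    {u : ℝ × ℝ → ℝ} (h : Harm lam u) : Harm (R lam) (u ∘ block lam i) := by
  refine ternary_induction (P := fun lam => i ∈ alphabet lam → ∀ u, Harm lam u →
    Harm (R lam) (u ∘ block lam i)) ?_ ?_ h0 h1 hi u h
  · intro lam h0 h1 hi u h
    have e : u ∘ block lam i = u ∘ F i := funext fun z => congrArg u (block_of_third_lt h0 h1 i z)
    rw [e]
    convert h.comp_F i using 1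
    rcases le_or_gt lam (2 / 3) with h | h
    · rw [R_middle h0 h]
      rw [alphabet_middle h0 h] at hi
      fin_cases i <;> first | rfl | simp at hi
    · rw [R_bottom h h1]
      rw [alphabet_bottom h h1] at hi
      fin_cases i <;> first | rfl | simp at hi
  · intro lam h0 h1 ih hi u h
    rw [alphabet_top h0 h1] at hi
    have e : u ∘ block lam i = (u ∘ F 0) ∘ block (3 * lam) i :=
      funext fun z => congrArg u (block_top h0 h1 i z)
    rw [e, R_top h0 h1]
    exact ih hi _ h.comp_F_zero

theorem weight_top {lam : ℝ} (h0 : 0 < lam) (h1 : lam ≤ 1 / 3) (i : Fin 6) :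
    weight lam i = weight (3 * lam) i := by
  rw [weight, weight, digit1_top h0 h1, R_top h0 h1]

/-- Decomposition of the mean over the cut according to the first letter. -/
theorem Harm.cutMean_block {lam : ℝ} (h0 : 0 < lam) (h1 : lam ≤ 1) {u : ℝ × ℝ → ℝ}
    (h : Harm lam u) :
    cutMean lam u = ∑ i ∈ alphabet lam, weight lam i * cutMean (R lam) (u ∘ block lam i) := by
  refine ternary_induction (P := fun lam => ∀ u, Harm lam u →
    cutMean lam u = ∑ i ∈ alphabet lam, weight lam i * cutMean (R lam) (u ∘ block lam i))
    ?_ ?_ h0 h1 u h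
  · intro lam h0 h1 u h
    have e : ∀ i, u ∘ block lam i = u ∘ F i := fun i =>
      funext fun z => congrArg u (block_of_third_lt h0 h1 i z)
    simp only [e]
    rcases le_or_gt lam (2 / 3) with h2 | h2
    · rw [h.cutMean_middle h0 h2, alphabet_middle h0 h2, Finset.sum_pair (by decide),
        R_middle h0 h2, weight, weight, if_pos (digit1_middle h0 h2), if_pos (digit1_middle h0 h2)]
    · have hd : digit1 lam ≠ 1 := by rw [digit1_bottom h2 h1]; norm_num
      rw [h.cutMean_bottom h2 h1 _ rfl, alphabet_bottom h2 h1, Finset.sum_insert (by decide),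
        Finset.sum_pair (by decide), R_bottom h2 h1]
      have n1 : (1 : Fin 6) ≠ 3 := by decide
      have n2 : (2 : Fin 6) ≠ 3 := by decide
      simp only [weight, if_neg hd, if_neg n1, if_neg n2, if_true, R_bottom h2 h1,
        eta_eq_conductance (lam := 3 * lam - 2) (by linarith) (by linarith)]
      ring
  · intro lam h0 h1 ih u h
    rw [h.cutMean_top h0 h1, ih _ h.comp_F_zero, alphabet_top h0 h1]
    refine Finset.sum_congr rfl fun i _ => ?_
    rw [weight_top h0 h1, R_top h0 h1]
    congr 2
    exact funext fun z => (congrArg u (block_top h0 h1 i z)).symm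

theorem two_le_eta {lam : ℝ} (h0 : 0 < lam) (h1 : lam ≤ 1) : 2 ≤ eta lam := by
  rw [eta_eq_conductance h0 h1]; exact two_le_conductance h0 h1

theorem weight_mem {lam : ℝ} (h0 : 0 < lam) (h1 : lam ≤ 1) (i : Fin 6) :
    0 ≤ weight lam i ∧ weight lam i ≤ 1 / 2 := by
  have hx := two_le_eta (R_mem h0 h1).1 (R_mem h0 h1).2
  unfold weight
  split_ifs
  · norm_num
  · exact ⟨by positivity, by rw [div_le_div_iff₀ (by positivity) (by norm_num)]; linarith⟩
  · exact ⟨by positivity, by rw [div_le_div_iff₀ (by positivity) (by norm_num)]; linarith⟩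

theorem sum_weight {lam : ℝ} (h0 : 0 < lam) (h1 : lam ≤ 1) :
    ∑ i ∈ alphabet lam, weight lam i = 1 := by
  have hx := two_le_eta (R_mem h0 h1).1 (R_mem h0 h1).2
  unfold alphabet
  split_ifs with hd
  · rw [Finset.sum_pair (by decide), weight, weight, if_pos hd, if_pos hd]; norm_num
  · rw [Finset.sum_insert (by decide), Finset.sum_pair (by decide)]
    have n1 : (1 : Fin 6) ≠ 3 := by decide
    have n2 : (2 : Fin 6) ≠ 3 := by decide
    simp only [weight, if_neg hd, if_neg n1, if_neg n2, if_true]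
    generalize eta (R lam) = x at *
    rw [show (18 : ℝ) + 4 * x = 2 * (9 + 2 * x) by ring]
    have : 9 + 2 * x ≠ 0 := by linarith
    field_simp
    ring

theorem R_iterate_mem {lam : ℝ} (h0 : 0 < lam) (h1 : lam ≤ 1) (n : ℕ) :
    0 < R^[n] lam ∧ R^[n] lam ≤ 1 := by
  induction n with
  | zero => exact ⟨h0, h1⟩
  | succ n ih => rw [Function.iterate_succ_apply']; exact R_mem ih.1 ih.2

/-- If a point at depth `lam` lies in several first-level cells, then at least one of them is cut. -/
theorem exists_cut_child {lam : ℝ} (h0 : 0 < lam) {x : ℝ × ℝ} (hx : x ∈ SG) (hd : 1 - x.2 = lam) :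
    ∃ i, ∃ z ∈ SG, F i z = x ∧ 0 < 3 * lam - row i ∧ 1 - z.2 = 3 * lam - row i := by
  obtain ⟨i, z, hz, rfl⟩ := exists_F_of_mem_SG hx
  rw [depth_F] at hd
  have hz0 := depth_nonneg hz
  rcases hz0.lt_or_eq with hp | hp
  · exact ⟨i, z, hz, rfl, by linarith, by linarith⟩
  have hz1 : z = corner 0 := eq_corner_of_one_le_bary hz (k := 0) (by
    simp only [bary, Matrix.cons_val]; linarith)
  subst hz1
  have key : ∀ j l, label i 0 = label j l → l ≠ 0 → row j = row i - 1 →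
      ∃ i', ∃ z ∈ SG, F i' z = F i (corner 0) ∧ 0 < 3 * lam - row i' ∧
        1 - z.2 = 3 * lam - row i' := by
    intro j l hl hl0 hr
    refine ⟨j, corner l, corner_mem_SG l, (F_corner_of_label hl).symm, by linarith, ?_⟩
    rw [depth_corner, if_neg hl0]; linarith
  fin_cases i
  · simp [row] at hd hp; linarith
  · exact key 5 1 rfl (by decide) (by show (1 : ℝ) = 2 - 1; norm_num)
  · exact key 4 2 rfl (by decide) (by show (1 : ℝ) = 2 - 1; norm_num)
  · exact key 5 2 rfl (by decide) (by show (1 : ℝ) = 2 - 1; norm_num)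
  · exact key 0 2 rfl (by decide) (by norm_num [row])
  · exact key 0 1 rfl (by decide) (by norm_num [row])

theorem exists_block_eq {lam : ℝ} (h0 : 0 < lam) (h1 : lam ≤ 1) {x : ℝ × ℝ} (hx : x ∈ X lam) :
    ∃ i ∈ alphabet lam, ∃ z ∈ X (R lam), block lam i z = x := by
  refine ternary_induction (P := fun lam => ∀ x ∈ X lam,
    ∃ i ∈ alphabet lam, ∃ z ∈ X (R lam), block lam i z = x) ?_ ?_ h0 h1 x hx
  · intro lam h0 h1 x hx
    rw [mem_X_iff] at hx
    obtain ⟨i, z, hz, rfl, hp, hd⟩ := exists_cut_child (by linarith) hx.1 hx.2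
    have hd1 := depth_le_one hz
    refine ⟨i, ?_, z, mem_X_iff.2 ⟨hz, ?_⟩, block_of_third_lt h0 h1 i z⟩ <;>
    rcases le_or_gt lam (2 / 3) with h | h
    · rw [alphabet_middle h0 h]
      fin_cases i <;> simp [row] at * <;> linarith
    · rw [alphabet_bottom h h1]
      fin_cases i <;> simp [row] at * <;> linarith
    · rw [R_middle h0 h, hd]
      fin_cases i <;> simp [row] at * <;> linarith
    · rw [R_bottom h h1, hd]
      fin_cases i <;> simp [row] at * <;> linarith
  · intro lam h0 h1 ih x hx
    rw [mem_X_iff] at hx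
    obtain ⟨i, z, hz, rfl, hp, hd⟩ := exists_cut_child h0 hx.1 hx.2
    have hi : i = 0 := by
      fin_cases i <;> simp [row] at * <;> linarith
    subst hi
    obtain ⟨j, hj, y, hy, rfl⟩ := ih z (mem_X_iff.2 ⟨hz, by simpa [row] using hd⟩)
    rw [alphabet_top h0 h1, R_top h0 h1]
    exact ⟨j, hj, y, hy, block_top h0 h1 j y⟩

/-! ### Words -/

/-- The words of length `n` that describe the cut cells. -/
noncomputable def words : ℝ → ℕ → Finset (List (Fin 6))
  | _, 0 => {[]}
  | lam, n + 1 => (alphabet lam).biUnion fun i => (words (R lam) n).image (List.cons i)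

theorem mem_words {lam : ℝ} {n : ℕ} {w : List (Fin 6)} :
    w ∈ words lam n ↔ w.length = n ∧ IsCutWord lam w := by
  induction n generalizing lam w with
  | zero =>
    simp only [words, Finset.mem_singleton, List.length_eq_zero_iff]
    exact ⟨fun h => ⟨h, h ▸ trivial⟩, fun h => h.1⟩
  | succ n ih =>
    simp only [words, Finset.mem_biUnion, Finset.mem_image, ih]
    constructor
    · rintro ⟨i, hi, v, ⟨hv, hc⟩, rfl⟩
      exact ⟨by simp [hv], mem_alphabet.1 hi, hc⟩
    · rintro ⟨hl, hc⟩
      cases w with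
      | nil => simp at hl
      | cons i v => exact ⟨i, mem_alphabet.2 hc.1, v, ⟨by simpa using hl, hc.2⟩, rfl⟩

theorem sum_words_succ {lam : ℝ} {n : ℕ} (g : List (Fin 6) → ℝ) :
    ∑ w ∈ words lam (n + 1), g w = ∑ i ∈ alphabet lam, ∑ w ∈ words (R lam) n, g (i :: w) := by
  rw [words, Finset.sum_biUnion]
  · refine Finset.sum_congr rfl fun i _ => ?_
    rw [Finset.sum_image fun a _ b _ h => (List.cons.inj h).2]
  · intro i _ j _ hij
    rw [Function.onFun, Finset.disjoint_left]
    intro w hw hw'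
    obtain ⟨a, -, rfl⟩ := Finset.mem_image.1 hw
    obtain ⟨b, -, hb⟩ := Finset.mem_image.1 hw'
    exact hij (List.cons.inj hb).1.symm

theorem mass_mem {lam : ℝ} (h0 : 0 < lam) (h1 : lam ≤ 1) (w : List (Fin 6)) :
    0 ≤ mass lam w ∧ mass lam w ≤ (1 / 2) ^ w.length := by
  induction w generalizing lam with
  | nil => simp [mass]
  | cons i w ih =>
    have hw := weight_mem h0 h1 i
    have hm := ih (R_mem h0 h1).1 (R_mem h0 h1).2
    refine ⟨mul_nonneg hw.1 hm.1, ?_⟩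
    rw [List.length_cons, pow_succ, mul_comm _ (1 / 2 : ℝ)]
    exact mul_le_mul hw.2 hm.2 hm.1 (by norm_num)

theorem sum_mass {lam : ℝ} (h0 : 0 < lam) (h1 : lam ≤ 1) (n : ℕ) :
    ∑ w ∈ words lam n, mass lam w = 1 := by
  induction n generalizing lam with
  | zero => simp [words, mass]
  | succ n ih =>
    rw [sum_words_succ]
    simp only [mass, ← Finset.mul_sum, ih (R_mem h0 h1).1 (R_mem h0 h1).2, mul_one]
    exact sum_weight h0 h1

theorem Harm.comp_cutMap {lam : ℝ} (h0 : 0 < lam) (h1 : lam ≤ 1) {w : List (Fin 6)}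
    (hw : IsCutWord lam w) {u : ℝ × ℝ → ℝ} (h : Harm lam u) :
    Harm (R^[w.length] lam) (u ∘ cutMap lam w) := by
  induction w generalizing lam u with
  | nil => exact h
  | cons i w ih =>
    have hb := h.comp_block h0 h1 (mem_alphabet.2 hw.1)
    have hi := ih (R_mem h0 h1).1 (R_mem h0 h1).2 hw.2 hb
    rw [List.length_cons, Function.iterate_succ_apply]
    exact hi

theorem Harm.cutMean_words {lam : ℝ} (h0 : 0 < lam) (h1 : lam ≤ 1) (n : ℕ) {u : ℝ × ℝ → ℝ}
    (h : Harm lam u) :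
    cutMean lam u = ∑ w ∈ words lam n, mass lam w * cutMean (R^[n] lam) (u ∘ cutMap lam w) := by
  induction n generalizing lam u with
  | zero =>
    simp only [words, Finset.sum_singleton, mass, one_mul]
    rfl
  | succ n ih =>
    rw [h.cutMean_block h0 h1, sum_words_succ]
    refine Finset.sum_congr rfl fun i hi => ?_
    rw [ih (R_mem h0 h1).1 (R_mem h0 h1).2 (h.comp_block h0 h1 hi), Finset.mul_sum]
    refine Finset.sum_congr rfl fun w _ => ?_
    rw [mass, mul_assoc]
    rfl

/-- The contraction ratio of `cutMap lam w` for words of length `n`. -/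
noncomputable def scale : ℝ → ℕ → ℝ
  | _, 0 => 1
  | lam, n + 1 => (1 / 3) ^ exp1 lam * scale (R lam) n

theorem scale_pos (lam : ℝ) (n : ℕ) : 0 < scale lam n := by
  induction n generalizing lam with
  | zero => exact one_pos
  | succ n ih => exact mul_pos (by positivity) (ih _)

theorem scale_le {lam : ℝ} (h0 : 0 < lam) (h1 : lam ≤ 1) (n : ℕ) : scale lam n ≤ (1 / 3) ^ n := by
  induction n generalizing lam with
  | zero => exact le_rfl
  | succ n ih =>
    rw [pow_succ, mul_comm, scale]
    refine mul_le_mul ?_ (ih (R_mem h0 h1).1 (R_mem h0 h1).2) (scale_pos _ _).le (by norm_num)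
    exact pow_le_of_le_one (by norm_num) (by norm_num)
      (Nat.one_le_iff_ne_zero.1 (one_le_exp1 h0 h1).1)

theorem cutMap_sub {lam : ℝ} (h0 : 0 < lam) (h1 : lam ≤ 1) (w : List (Fin 6)) (z z' : ℝ × ℝ) :
    cutMap lam w z - cutMap lam w z' = scale lam w.length • (z - z') := by
  induction w generalizing lam with
  | nil => simp [cutMap, scale]
  | cons i w ih =>
    rw [cutMap_cons, cutMap_cons, block_sub h0 h1, add_sub_add_right_eq_sub,
      ih (R_mem h0 h1).1 (R_mem h0 h1).2, smul_smul]
    rfl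

theorem cutMap_mem_SG {lam : ℝ} (w : List (Fin 6)) {z : ℝ × ℝ} (hz : z ∈ SG) :
    cutMap lam w z ∈ SG := by
  induction w generalizing lam with
  | nil => exact hz
  | cons i w ih => exact block_mem_SG ih

theorem continuous_cutMap (lam : ℝ) (w : List (Fin 6)) : Continuous (cutMap lam w) := by
  induction w generalizing lam with
  | nil => exact continuous_id
  | cons i w ih => exact (continuous_block lam i).comp (ih _)

theorem depth_cutMap {lam : ℝ} (h0 : 0 < lam) (h1 : lam ≤ 1) {w : List (Fin 6)}
    (hw : IsCutWord lam w) (z : ℝ × ℝ) :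
    1 - (cutMap lam w z).2 = lam + scale lam w.length * (1 - z.2 - R^[w.length] lam) := by
  induction w generalizing lam with
  | nil => simp [cutMap, scale]
  | cons i w ih =>
    rw [cutMap_cons, depth_block h0 h1 (mem_alphabet.2 hw.1),
      ih (R_mem h0 h1).1 (R_mem h0 h1).2 hw.2, List.length_cons, scale, Function.iterate_succ_apply]
    ring

theorem exists_diam : ∃ C : ℝ, 0 < C ∧ ∀ z ∈ SG, ∀ z' ∈ SG, ‖z - z'‖ ≤ C := by
  refine ⟨Metric.diam SG + 1, by positivity, fun z hz z' hz' => ?_⟩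
  rw [← dist_eq_norm]
  linarith [Metric.dist_le_diam_of_mem SG_isCompact.isBounded hz hz']

theorem exists_word_mem_XPart {lam : ℝ} (h0 : 0 < lam) (h1 : lam ≤ 1) (n : ℕ) {x : ℝ × ℝ}
    (hx : x ∈ X lam) : ∃ w ∈ words lam n, x ∈ XPart lam w := by
  suffices h : ∃ w ∈ words lam n, x ∈ cutMap lam w '' SG by
    obtain ⟨w, hw, h⟩ := h
    exact ⟨w, hw, h, hx⟩
  induction n generalizing lam x with
  | zero => exact ⟨[], by simp [words], x, hx.1, rfl⟩
  | succ n ih =>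
    obtain ⟨i, hi, z, hz, rfl⟩ := exists_block_eq h0 h1 hx
    obtain ⟨w, hw, y, hy, rfl⟩ := ih (R_mem h0 h1).1 (R_mem h0 h1).2 hz
    exact ⟨i :: w, Finset.mem_biUnion.2 ⟨i, hi, Finset.mem_image_of_mem _ hw⟩, y, hy, rfl⟩

/-! ### The mean over the cut as an integral -/

theorem isCompact_X (lam : ℝ) : IsCompact (X lam) :=
  SG_isCompact.inter_right (isClosed_eq continuous_snd continuous_const)

theorem isCompact_XPart (lam : ℝ) (w : List (Fin 6)) : IsCompact (XPart lam w) :=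
  (SG_isCompact.image (continuous_cutMap lam w)).inter_right (isCompact_X lam).isClosed

theorem XPart_nil (lam : ℝ) : XPart lam [] = X lam := by
  ext x
  constructor
  · exact fun h => h.2
  · exact fun h => ⟨⟨x, h.1, rfl⟩, h⟩

theorem IsCutMeasure.measure_X {lam : ℝ} {μ : Measure (ℝ × ℝ)} (hμ : IsCutMeasure lam μ) :
    μ (X lam) = 1 := by
  have := hμ.2 [] trivial
  rwa [XPart_nil, mass, ENNReal.ofReal_one] at this

theorem IsCutMeasure.ae_mem_X {lam : ℝ} {μ : Measure (ℝ × ℝ)} (hμ : IsCutMeasure lam μ) :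
    ∀ᵐ x ∂μ, x ∈ X lam := by
  have := hμ.1
  exact (mem_ae_iff_prob_eq_one (isCompact_X lam).measurableSet).2 hμ.measure_X

/-- The parts `X_w` of a fixed level cover the cut and their masses add up to `1`; hence almost
every point lies in exactly one of them. -/
theorem IsCutMeasure.ae_sum_indicator_eq_one {lam : ℝ} (h0 : 0 < lam) (h1 : lam ≤ 1)
    {μ : Measure (ℝ × ℝ)} (hμ : IsCutMeasure lam μ) (n : ℕ) :
    ∀ᵐ x ∂μ, ∑ w ∈ words lam n, (XPart lam w).indicator (1 : ℝ × ℝ → ℝ) x = 1 := by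
  have := hμ.1
  have hmeas := fun w => (isCompact_XPart lam w).measurableSet
  have hint : ∀ w ∈ words lam n,
      Integrable (fun x => (XPart lam w).indicator (1 : ℝ × ℝ → ℝ) x) μ := fun w _ =>
    (integrable_const (1 : ℝ)).indicator (hmeas w)
  have hI : ∫ x, (∑ w ∈ words lam n, (XPart lam w).indicator (1 : ℝ × ℝ → ℝ) x - 1) ∂μ = 0 := by
    rw [integral_sub (integrable_finsetSum _ hint) (integrable_const _),
      integral_finsetSum _ hint, integral_const, probReal_univ, one_smul, sub_eq_zero,
      ← sum_mass h0 h1 n]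
    refine Finset.sum_congr rfl fun w hw => ?_
    rw [integral_indicator_one (hmeas w), measureReal_def, hμ.2 w (mem_words.1 hw).2,
      ENNReal.toReal_ofReal (mass_mem h0 h1 w).1]
  have hnn : 0 ≤ᵐ[μ] fun x =>
      ∑ w ∈ words lam n, (XPart lam w).indicator (1 : ℝ × ℝ → ℝ) x - 1 := by
    filter_upwards [hμ.ae_mem_X] with x hx
    obtain ⟨w, hw, hxw⟩ := exists_word_mem_XPart h0 h1 n hx
    have := Finset.single_le_sum (f := fun w => (XPart lam w).indicator (1 : ℝ × ℝ → ℝ) x)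
      (fun v _ => indicator_nonneg (fun _ _ => zero_le_one) x) hw
    simp only [indicator_of_mem hxw, Pi.one_apply] at this
    simpa using this
  have := (integral_eq_zero_iff_of_nonneg_ae hnn
    ((integrable_finsetSum _ hint).sub (integrable_const _))).1 hI
  filter_upwards [this] with x hx
  simpa [sub_eq_zero] using hx

/-- Riemann sums for the integral over the cut. -/
theorem IsCutMeasure.abs_integral_sub_le {lam : ℝ} (h0 : 0 < lam) (h1 : lam ≤ 1)
    {μ : Measure (ℝ × ℝ)} (hμ : IsCutMeasure lam μ) (n : ℕ) {f : ℝ × ℝ → ℝ}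
    (hf : ContinuousOn f (X lam)) {c : List (Fin 6) → ℝ} {ε : ℝ}
    (hc : ∀ w ∈ words lam n, ∀ x ∈ XPart lam w, |f x - c w| ≤ ε) :
    |∫ x in X lam, f x ∂μ - ∑ w ∈ words lam n, mass lam w * c w| ≤ ε := by
  have := hμ.1
  have hmeas := fun w => (isCompact_XPart lam w).measurableSet
  have hres : μ.restrict (X lam) = μ := Measure.restrict_eq_self_of_ae_mem hμ.ae_mem_X
  have hfi : Integrable f μ := by
    have := hf.integrableOn_compact (μ := μ) (isCompact_X lam)
    rwa [IntegrableOn, hres] at this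
  have hint : ∀ w ∈ words lam n,
      Integrable (fun x => c w * (XPart lam w).indicator (1 : ℝ × ℝ → ℝ) x) μ := fun w _ =>
    ((integrable_const (1 : ℝ)).indicator (hmeas w)).const_mul _
  have hs : ∑ w ∈ words lam n, mass lam w * c w =
      ∫ x, ∑ w ∈ words lam n, c w * (XPart lam w).indicator (1 : ℝ × ℝ → ℝ) x ∂μ := by
    rw [integral_finsetSum _ hint]
    refine Finset.sum_congr rfl fun w hw => ?_
    rw [integral_const_mul, integral_indicator_one (hmeas w), measureReal_def,
      hμ.2 w (mem_words.1 hw).2, ENNReal.toReal_ofReal (mass_mem h0 h1 w).1, mul_comm]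
  rw [hres, hs, ← integral_sub hfi (integrable_finsetSum _ hint), ← Real.norm_eq_abs]
  have hb : ∀ᵐ x ∂μ, ‖f x - ∑ w ∈ words lam n, c w * (XPart lam w).indicator
      (1 : ℝ × ℝ → ℝ) x‖ ≤ ε := by
    filter_upwards [hμ.ae_sum_indicator_eq_one h0 h1 n] with x hx
    have e : f x - ∑ w ∈ words lam n, c w * (XPart lam w).indicator (1 : ℝ × ℝ → ℝ) x =
        ∑ w ∈ words lam n, (f x - c w) * (XPart lam w).indicator (1 : ℝ × ℝ → ℝ) x := by
      simp only [sub_mul, Finset.sum_sub_distrib, ← Finset.mul_sum, hx, mul_one]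
    rw [e]
    calc _ ≤ ∑ w ∈ words lam n, ‖(f x - c w) * (XPart lam w).indicator (1 : ℝ × ℝ → ℝ) x‖ :=
          norm_sum_le _ _
      _ ≤ ∑ w ∈ words lam n, ε * (XPart lam w).indicator (1 : ℝ × ℝ → ℝ) x := by
          refine Finset.sum_le_sum fun w hw => ?_
          by_cases hxw : x ∈ XPart lam w
          · simpa [indicator_of_mem hxw] using hc w hw x hxw
          · simp [indicator_of_notMem hxw]
      _ = ε := by rw [← Finset.mul_sum, hx, mul_one]
  simpa using norm_integral_le_of_norm_le_const hb

/-- Two points of the same cut cell of level `n` are close to each other. -/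
theorem exists_level {δ : ℝ} (hδ : 0 < δ) : ∃ n : ℕ, ∀ lam, 0 < lam → lam ≤ 1 →
    ∀ w : List (Fin 6), w.length = n → ∀ z ∈ SG, ∀ z' ∈ SG,
      dist (cutMap lam w z) (cutMap lam w z') < δ := by
  obtain ⟨C, hC, hd⟩ := exists_diam
  obtain ⟨n, hn⟩ := exists_pow_lt_of_lt_one (div_pos hδ hC) (by norm_num : (1 / 3 : ℝ) < 1)
  refine ⟨n, fun lam h0 h1 w hw z hz z' hz' => ?_⟩
  rw [dist_eq_norm, cutMap_sub h0 h1, norm_smul, Real.norm_eq_abs, abs_of_pos (scale_pos _ _), hw]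
  rw [lt_div_iff₀ hC] at hn
  refine lt_of_le_of_lt ?_ hn
  exact mul_le_mul (scale_le h0 h1 n) (hd z hz z' hz') (norm_nonneg _) (by positivity)

/-- The mean over the cut of a solution is the integral of its boundary values. -/
theorem IsCutMeasure.cutMean_eq {lam : ℝ} (h0 : 0 < lam) (h1 : lam ≤ 1)
    {μ : Measure (ℝ × ℝ)} (hμ : IsCutMeasure lam μ) {f u : ℝ × ℝ → ℝ} (hu : IsSolution lam f u) :
    cutMean lam u = ∫ x in X lam, f x ∂μ := by
  obtain ⟨hcont, hharm, hf⟩ := (isSolution_iff h0 h1).1 hu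
  have hXK : X lam ⊆ {z | z ∈ SG ∧ 1 - z.2 ≤ lam} := fun z hz =>
    ⟨hz.1, (mem_X_iff.1 hz).2.le⟩
  have hfX : ∀ x ∈ X lam, f x = u x := fun x hx => (hf (Or.inr hx)).symm
  have hfc : ContinuousOn f (X lam) := (hcont.mono hXK).congr hfX
  have huc := (isCompact_depth_le lam).uniformContinuousOn_of_continuous hcont
  rw [Metric.uniformContinuousOn_iff_le] at huc
  suffices h : ∀ ε > 0, |cutMean lam u - ∫ x in X lam, f x ∂μ| ≤ 4 * ε by
    rw [← sub_eq_zero, ← abs_nonpos_iff]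
    refine le_of_forall_pos_le_add fun ε hε => ?_
    linarith [h (ε / 4) (by linarith)]
  intro ε hε
  obtain ⟨δ, hδ, huδ⟩ := huc ε hε
  obtain ⟨n, hn⟩ := exists_level hδ
  have hRn := R_iterate_mem h0 h1 n
  have hK : ∀ w ∈ words lam n, ∀ z ∈ SG, 1 - z.2 ≤ R^[n] lam →
      cutMap lam w z ∈ {z | z ∈ SG ∧ 1 - z.2 ≤ lam} := by
    intro w hw z hz hd
    obtain ⟨hl, hc⟩ := mem_words.1 hw
    refine ⟨cutMap_mem_SG w hz, ?_⟩
    rw [depth_cutMap h0 h1 hc, hl]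
    have := mul_nonneg (scale_pos lam n).le (sub_nonneg.2 hd)
    linarith
  have hosc : ∀ w ∈ words lam n, ∀ z ∈ SG, 1 - z.2 ≤ R^[n] lam →
      |u (cutMap lam w (corner 0)) - u (cutMap lam w z)| ≤ ε := by
    intro w hw z hz hd
    rw [← Real.dist_eq]
    refine huδ _ (hK w hw _ (corner_mem_SG 0) ?_) _ (hK w hw z hz hd)
      (hn lam h0 h1 w (mem_words.1 hw).1 _ (corner_mem_SG 0) z hz).le
    rw [depth_corner, if_pos rfl]; exact hRn.1.le
  have hI := hμ.abs_integral_sub_le h0 h1 n hfc (c := fun w => u (cutMap lam w (corner 0)))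
    (ε := ε) fun w hw x hx => by
      obtain ⟨⟨z, hz, rfl⟩, hxX⟩ := hx
      rw [hfX _ hxX, abs_sub_comm]
      obtain ⟨hl, hc⟩ := mem_words.1 hw
      refine hosc w hw z hz ?_
      have hd := (mem_X_iff.1 hxX).2
      rw [depth_cutMap h0 h1 hc, hl] at hd
      have : 1 - z.2 - R^[n] lam = 0 :=
        (mul_eq_zero.1 (add_eq_left.1 hd)).resolve_left (scale_pos lam n).ne'
      linarith
  have hL : |cutMean lam u - ∑ w ∈ words lam n, mass lam w * u (cutMap lam w (corner 0))| ≤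
      15 / 7 * ε := by
    rw [hharm.cutMean_words h0 h1 n, ← Finset.sum_sub_distrib]
    calc _ ≤ ∑ w ∈ words lam n, |mass lam w * cutMean (R^[n] lam) (u ∘ cutMap lam w) -
          mass lam w * u (cutMap lam w (corner 0))| := Finset.abs_sum_le_sum_abs _ _
      _ ≤ ∑ w ∈ words lam n, mass lam w * (15 / 7 * ε) := by
          refine Finset.sum_le_sum fun w hw => ?_
          have hm := (mass_mem h0 h1 w).1
          obtain ⟨hl, hc⟩ := mem_words.1 hw
          have hh := hharm.comp_cutMap h0 h1 hc
          rw [hl] at hh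
          rw [← mul_sub, abs_mul, abs_of_nonneg hm]
          refine mul_le_mul_of_nonneg_left ?_ hm
          exact hh.abs_cutMean_sub_le hRn.1 hRn.2 fun z hz hd => hosc w hw z hz hd.le
      _ = 15 / 7 * ε := by rw [← Finset.sum_mul, sum_mass h0 h1, one_mul]
  have a1 := abs_le.1 hI
  have a2 := abs_le.1 hL
  rw [abs_le]
  constructor <;> linarith

theorem IsCutMeasure.hasNormalDeriv {lam : ℝ} (h0 : 0 < lam) (h1 : lam ≤ 1)
    {μ : Measure (ℝ × ℝ)} (hμ : IsCutMeasure lam μ) {f u : ℝ × ℝ → ℝ} (hu : IsSolution lam f u) :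
    HasNormalDeriv u (eta lam * (f (corner 0) - ∫ x in X lam, f x ∂μ)) := by
  have hh := ((isSolution_iff h0 h1).1 hu).2.1
  have hc := two_le_conductance h0 h1
  convert hh.hasNormalDeriv h0 using 1
  rw [← hμ.cutMean_eq h0 h1 hu, eta_eq_conductance h0 h1, ← hu.2.2 (Or.inl rfl), cutMean]
  field_simp
  ring

/-- A cut measure is determined by its Riemann sums. -/
theorem IsCutMeasure.unique {lam : ℝ} (h0 : 0 < lam) (h1 : lam ≤ 1) {μ ν : Measure (ℝ × ℝ)}
    (hμ : IsCutMeasure lam μ) (hν : IsCutMeasure lam ν) : μ = ν := by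
  have := hμ.1
  have := hν.1
  refine ext_of_forall_integral_eq_of_IsFiniteMeasure fun f => ?_
  have hres : ∀ {μ : Measure (ℝ × ℝ)}, IsCutMeasure lam μ →
      ∫ x, f x ∂μ = ∫ x in X lam, f x ∂μ := fun hμ => by
    rw [Measure.restrict_eq_self_of_ae_mem hμ.ae_mem_X]
  rw [hres hμ, hres hν, ← sub_eq_zero, ← abs_nonpos_iff]
  refine le_of_forall_pos_le_add fun ε hε => ?_
  have huc := SG_isCompact.uniformContinuousOn_of_continuous f.continuous.continuousOn
  rw [Metric.uniformContinuousOn_iff_le] at huc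
  obtain ⟨δ, hδ, huδ⟩ := huc (ε / 2) (by linarith)
  obtain ⟨n, hn⟩ := exists_level hδ
  have hc : ∀ w ∈ words lam n, ∀ x ∈ XPart lam w, |f x - f (cutMap lam w (corner 0))| ≤ ε / 2 := by
    rintro w hw x ⟨⟨z, hz, rfl⟩, -⟩
    rw [← Real.dist_eq]
    exact huδ _ (cutMap_mem_SG w hz) _ (cutMap_mem_SG w (corner_mem_SG 0))
      (hn lam h0 h1 w (mem_words.1 hw).1 z hz _ (corner_mem_SG 0)).le
  have a1 := abs_le.1 (hμ.abs_integral_sub_le h0 h1 n f.continuous.continuousOn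
    (c := fun w => f (cutMap lam w (corner 0))) hc)
  have a2 := abs_le.1 (hν.abs_integral_sub_le h0 h1 n f.continuous.continuousOn
    (c := fun w => f (cutMap lam w (corner 0))) hc)
  rw [abs_le]
  constructor <;> linarith

end UpperDomain

namespace UpperDomain

/-! ### Horizontal separation of the cut cells -/

/-- The horizontal coordinate, normalized so that the gasket has width `2`. -/
noncomputable def hor (z : ℝ × ℝ) : ℝ := Real.sqrt 3 * z.1

theorem hor_sub (z z' : ℝ × ℝ) : hor (z - z') = hor z - hor z' := by
  simp [hor, mul_sub]

theorem hor_add (z z' : ℝ × ℝ) : hor (z + z') = hor z + hor z' := by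
  simp [hor, mul_add]

theorem hor_smul (c : ℝ) (z : ℝ × ℝ) : hor (c • z) = c * hor z := by
  simp [hor]; ring

theorem hor_shift (i : Fin 6) : hor (shift i) = 2 * baryShift i 2 + baryShift i 0 := by
  have h : Real.sqrt 3 ≠ 0 := by positivity
  fin_cases i <;> simp [hor, shift, corner, baryShift] <;> field_simp
  all_goals norm_num

theorem hor_mem {z : ℝ × ℝ} (hz : z ∈ SG) : 0 ≤ hor z ∧ hor z ≤ 2 := by
  have h0 := bary_nonneg hz 0
  have h1 := bary_nonneg hz 1
  have h2 := bary_nonneg hz 2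
  simp only [bary, Matrix.cons_val] at h0 h1 h2
  unfold hor
  constructor <;> linarith

theorem hor_corner_one : hor (corner 1) = 0 := by simp [hor, corner]

theorem hor_corner_two : hor (corner 2) = 2 := by
  have h : Real.sqrt 3 ≠ 0 := by positivity
  simp only [hor, corner, Matrix.cons_val]; field_simp

theorem shift_separation :
    (∀ i ∈ ({4, 5} : Finset (Fin 6)), ∀ j ∈ ({4, 5} : Finset (Fin 6)), i ≠ j →
      2 * baryShift i 2 + baryShift i 0 + 2 ≤ 2 * baryShift j 2 + baryShift j 0 ∨
      2 * baryShift j 2 + baryShift j 0 + 2 ≤ 2 * baryShift i 2 + baryShift i 0) ∧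
    (∀ i ∈ ({1, 2, 3} : Finset (Fin 6)), ∀ j ∈ ({1, 2, 3} : Finset (Fin 6)), i ≠ j →
      2 * baryShift i 2 + baryShift i 0 + 2 ≤ 2 * baryShift j 2 + baryShift j 0 ∨
      2 * baryShift j 2 + baryShift j 0 + 2 ≤ 2 * baryShift i 2 + baryShift i 0) := by
  decide

theorem two_le_abs_hor_shift {lam : ℝ} {i j : Fin 6} (hi : i ∈ alphabet lam)
    (hj : j ∈ alphabet lam) (hij : i ≠ j) : 2 ≤ |hor (shift i) - hor (shift j)| := by
  have h : 2 * baryShift i 2 + baryShift i 0 + 2 ≤ 2 * baryShift j 2 + baryShift j 0 ∨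
      2 * baryShift j 2 + baryShift j 0 + 2 ≤ 2 * baryShift i 2 + baryShift i 0 := by
    unfold alphabet at hi hj
    split_ifs at hi hj
    · exact shift_separation.1 i hi j hj hij
    · exact shift_separation.2 i hi j hj hij
  rw [hor_shift, hor_shift, le_abs']
  rcases h with h | h <;> [left; right]
  all_goals
    have h' := (Nat.cast_le (α := ℝ)).2 h
    push_cast at h'
    linarith

/-- Different cut cells of the same level lie side by side. -/
theorem separation {lam : ℝ} (h0 : 0 < lam) (h1 : lam ≤ 1) {n : ℕ} {w w' : List (Fin 6)}
    (hw : w ∈ words lam n) (hw' : w' ∈ words lam n) (hne : w ≠ w') :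
    2 * scale lam n ≤ |hor (cutMap lam w (corner 1)) - hor (cutMap lam w' (corner 1))| := by
  induction n generalizing lam w w' with
  | zero =>
    simp only [words, Finset.mem_singleton] at hw hw'
    exact absurd (hw.trans hw'.symm) hne
  | succ n ih =>
    obtain ⟨hR0, hR1⟩ := R_mem h0 h1
    simp only [words, Finset.mem_biUnion, Finset.mem_image] at hw hw'
    obtain ⟨i, hi, v, hv, rfl⟩ := hw
    obtain ⟨j, hj, v', hv', rfl⟩ := hw'
    have hp : (0 : ℝ) < (1 / 3) ^ exp1 lam := by positivity
    rw [cutMap_cons, cutMap_cons, ← hor_sub, block_sub h0 h1, hor_smul, abs_mul, abs_of_pos hp,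
      scale, mul_left_comm]
    refine mul_le_mul_of_nonneg_left ?_ hp.le
    rw [hor_sub, hor_add, hor_add]
    by_cases hij : i = j
    · subst hij
      rw [add_sub_add_right_eq_sub]
      exact ih hR0 hR1 hv hv' fun h => hne (by rw [h])
    · have hs := two_le_abs_hor_shift hi hj hij
      have key : ∀ v ∈ words (R lam) n, 0 ≤ hor (cutMap (R lam) v (corner 1)) ∧
          hor (cutMap (R lam) v (corner 1)) ≤ 2 - 2 * scale (R lam) n := by
        intro v hv
        have a1 := hor_mem (cutMap_mem_SG (lam := R lam) v (corner_mem_SG 1))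
        have a2 := hor_mem (cutMap_mem_SG (lam := R lam) v (corner_mem_SG 2))
        have e := congrArg hor (cutMap_sub hR0 hR1 v (corner 2) (corner 1))
        rw [hor_sub, hor_smul, hor_sub, hor_corner_one, hor_corner_two, (mem_words.1 hv).1] at e
        exact ⟨a1.1, by linarith [a2.2]⟩
      obtain ⟨b1, b2⟩ := key v hv
      obtain ⟨c1, c2⟩ := key v' hv'
      rcases le_abs'.1 hs with hs | hs
      · rw [abs_sub_comm]
        exact le_trans (by linarith) (le_abs_self _)
      · exact le_trans (by linarith) (le_abs_self _)

theorem hor_of_mem_XPart {lam : ℝ} (h0 : 0 < lam) (h1 : lam ≤ 1) {n : ℕ} {w : List (Fin 6)}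
    (hw : w ∈ words lam n) {x : ℝ × ℝ} (hx : x ∈ XPart lam w) :
    hor (cutMap lam w (corner 1)) ≤ hor x ∧
      hor x ≤ hor (cutMap lam w (corner 1)) + 2 * scale lam n := by
  obtain ⟨⟨z, hz, rfl⟩, -⟩ := hx
  have e := congrArg hor (cutMap_sub h0 h1 w z (corner 1))
  rw [hor_sub, hor_smul, hor_sub, hor_corner_one, (mem_words.1 hw).1] at e
  have a := hor_mem hz
  have hs := scale_pos lam n
  constructor <;> nlinarith

/-- Different parts of the cut of the same level have at most one point in common. -/
theorem subsingleton_XPart_inter {lam : ℝ} (h0 : 0 < lam) (h1 : lam ≤ 1) {n : ℕ}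
    {w w' : List (Fin 6)} (hw : w ∈ words lam n) (hw' : w' ∈ words lam n) (hne : w ≠ w') :
    (XPart lam w ∩ XPart lam w').Subsingleton := by
  rintro x ⟨hx, hx'⟩ y ⟨hy, hy'⟩
  have a1 := hor_of_mem_XPart h0 h1 hw hx
  have a2 := hor_of_mem_XPart h0 h1 hw' hx'
  have b1 := hor_of_mem_XPart h0 h1 hw hy
  have b2 := hor_of_mem_XPart h0 h1 hw' hy'
  have hxy : hor x = hor y := by
    rcases le_abs'.1 (separation h0 h1 hw hw' hne) with h | h <;> linarith
  refine Prod.ext (mul_left_cancel₀ (by positivity : Real.sqrt 3 ≠ 0) hxy) ?_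
  rw [hx.2.2, hy.2.2]

open Classical in
/-- Cut cells of one level have the same width and lie side by side, so no three of them meet. -/
theorem card_words_le_two {lam : ℝ} (h0 : 0 < lam) (h1 : lam ≤ 1) (n : ℕ) (x : ℝ × ℝ) :
    ((words lam n).filter fun w => x ∈ XPart lam w).card ≤ 2 := by
  by_contra! hcon
  obtain ⟨a, ha, b, hb, c, hc, hab, hac, hbc⟩ := Finset.two_lt_card.1 hcon
  simp only [Finset.mem_filter] at ha hb hc
  have a1 := hor_of_mem_XPart h0 h1 ha.1 ha.2
  have b1 := hor_of_mem_XPart h0 h1 hb.1 hb.2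
  have c1 := hor_of_mem_XPart h0 h1 hc.1 hc.2
  have hs := scale_pos lam n
  rcases le_abs'.1 (separation h0 h1 ha.1 hb.1 hab) with h | h <;>
  rcases le_abs'.1 (separation h0 h1 ha.1 hc.1 hac) with h' | h' <;>
  rcases le_abs'.1 (separation h0 h1 hb.1 hc.1 hbc) with h'' | h'' <;> linarith

/-! ### Existence of the measure on the cut -/

/-- The distribution of the first letter. -/
noncomputable def letterMeasure (lam : ℝ) : Measure (Fin 6) :=
  ∑ i ∈ alphabet lam, ENNReal.ofReal (weight lam i) • Measure.dirac i

theorem letterMeasure_singleton {lam : ℝ} {i : Fin 6} (hi : i ∈ alphabet lam) :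
    letterMeasure lam {i} = ENNReal.ofReal (weight lam i) := by
  rw [letterMeasure, Measure.finsetSum_apply, Finset.sum_eq_single i]
  · simp
  · intro j _ hj
    simp [hj]
  · exact fun h => absurd hi h

theorem letterMeasure_compl_alphabet (lam : ℝ) :
    letterMeasure lam {i | i ∉ alphabet lam} = 0 := by
  rw [letterMeasure, Measure.finsetSum_apply]
  refine Finset.sum_eq_zero fun j hj => ?_
  simp [hj]

theorem isProbabilityMeasure_letterMeasure {lam : ℝ} (h0 : 0 < lam) (h1 : lam ≤ 1) :
    IsProbabilityMeasure (letterMeasure lam) := by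
  constructor
  rw [letterMeasure, Measure.finsetSum_apply]
  simp only [Measure.smul_apply, measure_univ, smul_eq_mul, mul_one]
  rw [← ENNReal.ofReal_sum_of_nonneg fun i _ => (weight_mem h0 h1 i).1, sum_weight h0 h1,
    ENNReal.ofReal_one]

/-- The distribution of the sequence of letters: the letters are independent. -/
noncomputable def codeMeasure (lam : ℝ) : Measure (ℕ → Fin 6) :=
  Measure.infinitePi fun k => letterMeasure (R^[k] lam)

/-- The first `n` letters of a sequence. -/
def pre (n : ℕ) (ω : ℕ → Fin 6) : List (Fin 6) := List.ofFn fun k : Fin n => ω k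

theorem pre_succ (n : ℕ) (ω : ℕ → Fin 6) : pre (n + 1) ω = ω 0 :: pre n fun k => ω (k + 1) := by
  simp [pre, List.ofFn_succ]

theorem length_pre (n : ℕ) (ω : ℕ → Fin 6) : (pre n ω).length = n := List.length_ofFn

theorem prod_letterMeasure {lam : ℝ} (h0 : 0 < lam) (h1 : lam ≤ 1) {w : List (Fin 6)}
    (hw : IsCutWord lam w) :
    ∏ k ∈ Finset.range w.length, letterMeasure (R^[k] lam) {w.getD k 0} =
      ENNReal.ofReal (mass lam w) := by
  induction w generalizing lam with
  | nil => simp [mass]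
  | cons i w ih =>
    obtain ⟨hR0, hR1⟩ := R_mem h0 h1
    rw [List.length_cons, Finset.prod_range_succ']
    simp only [Function.iterate_succ_apply, List.getD_cons_succ, Function.iterate_zero, id,
      List.getD_cons_zero]
    rw [ih hR0 hR1 hw.2, letterMeasure_singleton (mem_alphabet.2 hw.1), mass,
      ENNReal.ofReal_mul (weight_mem h0 h1 i).1, mul_comm]

theorem codeMeasure_pre_eq {lam : ℝ} (h0 : 0 < lam) (h1 : lam ≤ 1) {n : ℕ} {w : List (Fin 6)}
    (hw : w ∈ words lam n) : codeMeasure lam {ω | pre n ω = w} = ENNReal.ofReal (mass lam w) := by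
  obtain ⟨hl, hc⟩ := mem_words.1 hw
  have hset : {ω : ℕ → Fin 6 | pre n ω = w} =
      (Finset.range n : Set ℕ).pi fun k => {w.getD k 0} := by
    ext ω
    simp only [mem_ofPred_eq, Set.mem_pi, Finset.coe_range, mem_Iio, mem_singleton_iff]
    constructor
    · rintro rfl k hk
      simp [pre, hk]
    · intro h
      refine List.ext_getElem (by rw [length_pre, hl]) fun k hk hk' => ?_
      have := h k (by rwa [length_pre] at hk)
      simp only [pre, List.getElem_ofFn, this]
      rw [List.getD_eq_getElem _ _ hk']
  have hp : ∀ k, IsProbabilityMeasure (letterMeasure (R^[k] lam)) := fun k =>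
    isProbabilityMeasure_letterMeasure (R_iterate_mem h0 h1 k).1 (R_iterate_mem h0 h1 k).2
  rw [hset, codeMeasure, Measure.infinitePi_pi _ fun k _ => MeasurableSet.of_discrete, ← hl]
  exact prod_letterMeasure h0 h1 hc

theorem ae_mem_alphabet {lam : ℝ} (h0 : 0 < lam) (h1 : lam ≤ 1) :
    ∀ᵐ ω ∂codeMeasure lam, ∀ k, ω k ∈ alphabet (R^[k] lam) := by
  have hp : ∀ k, IsProbabilityMeasure (letterMeasure (R^[k] lam)) := fun k =>
    isProbabilityMeasure_letterMeasure (R_iterate_mem h0 h1 k).1 (R_iterate_mem h0 h1 k).2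
  rw [ae_all_iff]
  intro k
  exact (measurePreserving_eval_infinitePi (fun k => letterMeasure (R^[k] lam))
    k).quasiMeasurePreserving.ae (letterMeasure_compl_alphabet (R^[k] lam))

theorem pre_mem_words {lam : ℝ} (n : ℕ) {ω : ℕ → Fin 6} (hω : ∀ k, ω k ∈ alphabet (R^[k] lam)) :
    pre n ω ∈ words lam n := by
  induction n generalizing lam ω with
  | zero => simp [pre, words]
  | succ n ih =>
    rw [pre_succ, words]
    exact Finset.mem_biUnion.2 ⟨ω 0, hω 0, Finset.mem_image_of_mem _ (ih fun k => hω (k + 1))⟩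

/-- The point of the gasket with code `ω`. -/
noncomputable def point (lam : ℝ) (ω : ℕ → Fin 6) : ℝ × ℝ :=
  limUnder atTop fun n => cutMap lam (pre n ω) (corner 0)

theorem cutMap_pre_mem {lam : ℝ} {n m : ℕ} (hnm : n ≤ m) (ω : ℕ → Fin 6) :
    cutMap lam (pre m ω) (corner 0) ∈ cutMap lam (pre n ω) '' SG := by
  induction n generalizing lam m ω with
  | zero => exact ⟨_, cutMap_mem_SG _ (corner_mem_SG 0), by
      rw [show pre 0 ω = [] from List.ofFn_zero]; rfl⟩
  | succ n ih =>
    obtain ⟨m, rfl⟩ := Nat.exists_eq_add_of_le' (le_trans (Nat.le_add_left 1 n) hnm)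
    obtain ⟨z, hz, e⟩ := ih (lam := R lam) (Nat.le_of_succ_le_succ hnm) fun k => ω (k + 1)
    refine ⟨z, hz, ?_⟩
    rw [pre_succ, pre_succ, cutMap_cons, cutMap_cons, e]

theorem tendsto_point {lam : ℝ} (h0 : 0 < lam) (h1 : lam ≤ 1) (ω : ℕ → Fin 6) :
    Tendsto (fun n => cutMap lam (pre n ω) (corner 0)) atTop (𝓝 (point lam ω)) := by
  obtain ⟨C, hC, hd⟩ := exists_diam
  refine CauchySeq.tendsto_limUnder (cauchySeq_of_le_geometric (1 / 3) C (by norm_num) fun n => ?_)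
  obtain ⟨z, hz, e⟩ := cutMap_pre_mem (lam := lam) (Nat.le_succ n) ω
  rw [← e, dist_eq_norm, cutMap_sub h0 h1, norm_smul, Real.norm_eq_abs,
    abs_of_pos (scale_pos _ _), length_pre, mul_comm]
  exact mul_le_mul (hd _ (corner_mem_SG 0) z hz) (scale_le h0 h1 n) (scale_pos _ _).le hC.le

theorem point_mem_cell {lam : ℝ} (h0 : 0 < lam) (h1 : lam ≤ 1) (n : ℕ) (ω : ℕ → Fin 6) :
    point lam ω ∈ cutMap lam (pre n ω) '' SG :=
  (SG_isCompact.image (continuous_cutMap lam _)).isClosed.mem_of_tendsto (tendsto_point h0 h1 ω)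
    ((eventually_ge_atTop n).mono fun _ hm => cutMap_pre_mem hm ω)

theorem measurable_point {lam : ℝ} (h0 : 0 < lam) (h1 : lam ≤ 1) : Measurable (point lam) := by
  refine measurable_of_tendsto_metrizable (f := fun n ω => cutMap lam (pre n ω) (corner 0))
    (fun n => ?_) (tendsto_pi_nhds.2 fun ω => tendsto_point h0 h1 ω)
  have hg : Measurable fun v : Fin n → Fin 6 => cutMap lam (List.ofFn v) (corner 0) :=
    Measurable.of_discrete
  exact hg.comp (measurable_pi_lambda _ fun k => measurable_pi_apply (k : ℕ))

theorem point_mem_X {lam : ℝ} (h0 : 0 < lam) (h1 : lam ≤ 1) {ω : ℕ → Fin 6}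
    (hω : ∀ k, ω k ∈ alphabet (R^[k] lam)) : point lam ω ∈ X lam := by
  have hS : point lam ω ∈ SG := by
    obtain ⟨z, hz, e⟩ := point_mem_cell h0 h1 0 ω
    rw [← e]; exact cutMap_mem_SG _ hz
  refine mem_X_iff.2 ⟨hS, ?_⟩
  rw [← sub_eq_zero, ← abs_nonpos_iff]
  refine ge_of_tendsto' (tendsto_pow_atTop_nhds_zero_of_lt_one (by norm_num : (0 : ℝ) ≤ 1 / 3)
    (by norm_num)) fun n => ?_
  obtain ⟨z, hz, e⟩ := point_mem_cell h0 h1 n ω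
  have hR := R_iterate_mem h0 h1 n
  rw [← e, depth_cutMap h0 h1 (mem_words.1 (pre_mem_words n hω)).2, length_pre, add_sub_cancel_left,
    abs_mul, abs_of_pos (scale_pos _ _)]
  have hz0 := depth_nonneg hz
  have hz1 := depth_le_one hz
  have : |1 - z.2 - R^[n] lam| ≤ 1 := by rw [abs_le]; constructor <;> linarith
  calc _ ≤ (1 / 3 : ℝ) ^ n * 1 :=
        mul_le_mul (scale_le h0 h1 n) this (abs_nonneg _) (by positivity)
    _ = _ := mul_one _

theorem point_mem_XPart {lam : ℝ} (h0 : 0 < lam) (h1 : lam ≤ 1) (n : ℕ) {ω : ℕ → Fin 6}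
    (hω : ∀ k, ω k ∈ alphabet (R^[k] lam)) : point lam ω ∈ XPart lam (pre n ω) :=
  ⟨point_mem_cell h0 h1 n ω, point_mem_X h0 h1 hω⟩

/-- A point lies in at most two cut cells of level `n`, of mass at most `2⁻ⁿ`. -/
theorem codeMeasure_point_eq {lam : ℝ} (h0 : 0 < lam) (h1 : lam ≤ 1) (x : ℝ × ℝ) :
    codeMeasure lam {ω | point lam ω = x} = 0 := by
  classical
  have hb : ∀ n : ℕ, codeMeasure lam {ω | point lam ω = x} ≤
      ENNReal.ofReal (2 * (1 / 2) ^ n) := by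
    intro n
    set S := (words lam n).filter fun w => x ∈ XPart lam w with hS
    calc codeMeasure lam {ω | point lam ω = x}
        ≤ codeMeasure lam (⋃ w ∈ S, {ω | pre n ω = w}) := by
          refine measure_mono_ae ?_
          filter_upwards [ae_mem_alphabet h0 h1] with ω hω hx
          refine mem_iUnion₂.2 ⟨pre n ω, Finset.mem_filter.2 ⟨pre_mem_words n hω, ?_⟩, rfl⟩
          rw [← show point lam ω = x from hx]
          exact point_mem_XPart h0 h1 n hω
      _ ≤ ∑ w ∈ S, codeMeasure lam {ω | pre n ω = w} := measure_biUnion_finset_le _ _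
      _ ≤ ∑ w ∈ S, ENNReal.ofReal ((1 / 2) ^ n) := by
          refine Finset.sum_le_sum fun w hw => ?_
          have hw' := (Finset.mem_filter.1 hw).1
          rw [codeMeasure_pre_eq h0 h1 hw', ← (mem_words.1 hw').1]
          exact ENNReal.ofReal_le_ofReal (mass_mem h0 h1 w).2
      _ = S.card * ENNReal.ofReal ((1 / 2) ^ n) := by rw [Finset.sum_const, nsmul_eq_mul]
      _ ≤ 2 * ENNReal.ofReal ((1 / 2) ^ n) := by
          refine mul_le_mul_left ?_ _
          exact_mod_cast card_words_le_two h0 h1 n x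
      _ = ENNReal.ofReal (2 * (1 / 2) ^ n) := by
          rw [ENNReal.ofReal_mul (by norm_num)]; norm_num
  have ht : Tendsto (fun n : ℕ => ENNReal.ofReal (2 * (1 / 2) ^ n)) atTop (𝓝 0) := by
    have := (tendsto_pow_atTop_nhds_zero_of_lt_one (by norm_num : (0 : ℝ) ≤ 1 / 2)
      (by norm_num)).const_mul 2
    simpa using ENNReal.tendsto_ofReal this
  exact nonpos_iff_eq_zero.1 (ge_of_tendsto' ht hb)

theorem isCutMeasure_map_point {lam : ℝ} (h0 : 0 < lam) (h1 : lam ≤ 1) :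
    IsCutMeasure lam ((codeMeasure lam).map (point lam)) := by
  have hp : ∀ k, IsProbabilityMeasure (letterMeasure (R^[k] lam)) := fun k =>
    isProbabilityMeasure_letterMeasure (R_iterate_mem h0 h1 k).1 (R_iterate_mem h0 h1 k).2
  have hm := measurable_point h0 h1
  have hP : IsProbabilityMeasure (codeMeasure lam) := by unfold codeMeasure; infer_instance
  refine ⟨Measure.isProbabilityMeasure_map hm.aemeasurable, fun w hw => ?_⟩
  have hww : w ∈ words lam w.length := mem_words.2 ⟨rfl, hw⟩
  rw [Measure.map_apply hm (isCompact_XPart lam w).measurableSet,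
    ← codeMeasure_pre_eq h0 h1 hww]
  have hnull : ∀ᵐ ω ∂codeMeasure lam, ∀ v ∈ words lam w.length, v ≠ w →
      point lam ω ∉ XPart lam v ∩ XPart lam w := by
    refine (eventually_all_finset _).2 fun v hv => ?_
    by_cases hvw : v = w
    · exact Eventually.of_forall fun ω h => absurd hvw h
    rcases (subsingleton_XPart_inter h0 h1 hv hww hvw).eq_empty_or_singleton with h | ⟨x, h⟩
    · exact Eventually.of_forall fun ω _ => by rw [h]; exact notMem_empty _
    · have hx : ∀ᵐ ω ∂codeMeasure lam, point lam ω ≠ x := by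
        rw [ae_iff]; simpa using codeMeasure_point_eq h0 h1 x
      filter_upwards [hx] with ω hω _
      rw [h]; exact hω
  refine measure_congr ?_
  filter_upwards [ae_mem_alphabet h0 h1, hnull] with ω hω hn
  refine propext ⟨fun h => ?_, fun h => ?_⟩
  · by_contra hne
    exact hn _ (pre_mem_words _ hω) hne ⟨point_mem_XPart h0 h1 _ hω, h⟩
  · have h' : pre w.length ω = w := h
    have := point_mem_XPart h0 h1 w.length hω
    rw [h'] at this
    exact this

theorem existsUnique_isCutMeasure {lam : ℝ} (h0 : 0 < lam) (h1 : lam ≤ 1) :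
    ∃! μ : Measure (ℝ × ℝ), IsCutMeasure lam μ :=
  ⟨_, isCutMeasure_map_point h0 h1, fun _ hν => hν.unique h0 h1 (isCutMeasure_map_point h0 h1)⟩

end UpperDomain

namespace UpperDomain

/-! ### The energy form -/

/-- The energy of a single cell, in terms of its corner values. -/
noncomputable def cellEnergy (u v : ℝ × ℝ → ℝ) : ℝ :=
  ∑ i : Fin 3, (u (corner i) - u (corner (i + 1))) * (v (corner i) - v (corner (i + 1)))

open Classical in
/-- The graph energy over the `m`-cells above depth `lam`, for any real `lam`; it agrees with
`graphEnergy` for `0 < lam ≤ 1`. -/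
noncomputable def energy (lam : ℝ) (m : ℕ) (u v : ℝ × ℝ → ℝ) : ℝ :=
  (15 / 7 : ℝ) ^ m * ∑ w : Fin m → Fin 6,
    if Above lam w then cellEnergy (u ∘ cellMap w) (v ∘ cellMap w) else 0

theorem graphEnergy_eq_energy {lam : ℝ} (h0 : 0 < lam) (h1 : lam ≤ 1) (m : ℕ)
    (u v : ℝ × ℝ → ℝ) : graphEnergy lam m u v = energy lam m u v := by
  unfold graphEnergy energy
  refine congrArg _ (Finset.sum_congr rfl fun w _ => ?_)
  by_cases h : Above lam w
  · rw [if_pos ((cellInside_iff_above h0 h1).2 h), if_pos h]; rfl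
  · rw [if_neg (fun hc => h ((cellInside_iff_above h0 h1).1 hc)), if_neg h]

theorem energy_zero (lam : ℝ) (u v : ℝ × ℝ → ℝ) :
    energy lam 0 u v = if 1 < lam then cellEnergy u v else 0 := by
  simp only [energy, Finset.univ_unique, Finset.sum_singleton, above_zero, pow_zero, one_mul]
  simp only [cellEnergy, Function.comp_apply, cellMap_zero]

open Classical in
theorem energy_succ (lam : ℝ) (m : ℕ) (u v : ℝ × ℝ → ℝ) :
    energy lam (m + 1) u v =
      15 / 7 * ∑ i, energy (3 * lam - row i) m (u ∘ F i) (v ∘ F i) := by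
  have e : ∀ (g : ℝ × ℝ → ℝ) (i : Fin 6) (w : Fin m → Fin 6),
      g ∘ cellMap (Fin.cons i w : Fin (m + 1) → Fin 6) = (g ∘ F i) ∘ cellMap w := fun g i w =>
    funext fun z => congrArg g (cellMap_cons i w z)
  have t : ∀ (i : Fin 6) (w : Fin m → Fin 6) (c : ℝ),
      (if Above lam (Fin.cons i w : Fin (m + 1) → Fin 6) then c else 0) =
        if Above (3 * lam - row i) w then c else 0 := fun i w c =>
    if_ctx_congr above_cons (fun _ => rfl) (fun _ => rfl)
  simp only [energy, sum_cons, t, e, ← Finset.mul_sum]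
  rw [pow_succ]; ring

theorem energy_of_nonpos {lam : ℝ} (h : lam ≤ 0) (m : ℕ) (u v : ℝ × ℝ → ℝ) :
    energy lam m u v = 0 := by
  simp [energy, not_above_of_nonpos h]

theorem cellEnergy_eq (u v : ℝ × ℝ → ℝ) : cellEnergy u v =
    (u (corner 0) - u (corner 1)) * (v (corner 0) - v (corner 1)) +
    (u (corner 1) - u (corner 2)) * (v (corner 1) - v (corner 2)) +
    (u (corner 2) - u (corner 0)) * (v (corner 2) - v (corner 0)) := by
  rw [cellEnergy, Fin.sum_univ_three]
  rfl

theorem cellEnergy_self_nonneg (u : ℝ × ℝ → ℝ) : 0 ≤ cellEnergy u u :=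
  Finset.sum_nonneg fun _ _ => mul_self_nonneg _

theorem energy_self_nonneg (lam : ℝ) (m : ℕ) (u : ℝ × ℝ → ℝ) : 0 ≤ energy lam m u u := by
  refine mul_nonneg (by positivity) (Finset.sum_nonneg fun w _ => ?_)
  split_ifs
  · exact cellEnergy_self_nonneg _
  · exact le_rfl

/-- On a full cell the energy of harmonic functions does not depend on the level. -/
theorem energy_of_one_lt {lam : ℝ} (hl : 1 < lam) {u v : ℝ × ℝ → ℝ} (hu : Harm lam u)
    (hv : Harm lam v) (m : ℕ) : energy lam m u v = cellEnergy u v := by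
  induction m generalizing lam u v with
  | zero => rw [energy_zero, if_pos hl]
  | succ m ih =>
    rw [energy_succ]
    have e : ∀ i, energy (3 * lam - row i) m (u ∘ F i) (v ∘ F i) =
        cellEnergy (u ∘ F i) (v ∘ F i) := fun i =>
      ih (one_lt_child hl i) (hu.comp_F i) (hv.comp_F i)
    simp only [e, cellEnergy_eq, Function.comp_apply, hu.fullVal hl, hv.fullVal hl]
    simp [Fin.sum_univ_succ, label, fullVal]
    ring

theorem Harm.energy_mono {lam : ℝ} {u : ℝ × ℝ → ℝ} (h : Harm lam u) {m n : ℕ} (hmn : m ≤ n) :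
    energy lam m u u ≤ energy lam n u u := by
  induction m generalizing lam u n with
  | zero =>
    by_cases hl : 1 < lam
    · rw [energy_of_one_lt hl h h, energy_of_one_lt hl h h]
    · rw [energy_zero, if_neg hl]; exact energy_self_nonneg _ _ _
  | succ m ih =>
    obtain ⟨n, rfl⟩ := Nat.exists_eq_add_of_le' (le_trans (Nat.le_add_left 1 m) hmn)
    rw [energy_succ, energy_succ]
    refine mul_le_mul_of_nonneg_left ?_ (by norm_num)
    exact Finset.sum_le_sum fun i _ => ih (h.comp_F i) (Nat.le_of_succ_le_succ hmn)

/-- The first-level cells that the cut meets from above. -/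
noncomputable def cutCells (lam : ℝ) : Finset (Fin 6) :=
  if lam ≤ 1 / 3 then {0} else if lam ≤ 2 / 3 then {4, 5} else {1, 2, 3}

theorem child_mem_of_mem_cutCells {lam : ℝ} (h0 : 0 < lam) (h1 : lam ≤ 1) {i : Fin 6}
    (hi : i ∈ cutCells lam) : 0 < 3 * lam - row i ∧ 3 * lam - row i ≤ 1 := by
  unfold cutCells at hi
  split_ifs at hi
  all_goals
    fin_cases i <;> simp at hi <;> simp [row] <;> constructor <;> linarith

/-- The defect in Green's formula on the union of the `m`-cells above the cut, for a function `h`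
vanishing on the cut. -/
noncomputable def defect (lam : ℝ) (m : ℕ) (h u : ℝ × ℝ → ℝ) : ℝ :=
  energy lam m h u - h (corner 0) * nd u

theorem defect_zero {lam : ℝ} (h1 : lam ≤ 1) (h u : ℝ × ℝ → ℝ) :
    defect lam 0 h u = -(h (corner 0) * nd u) := by
  rw [defect, energy_zero, if_neg (not_lt.2 h1), zero_sub]

/-- Green's formula on the full first-level cells: the defect comes from the cut cells only. -/
theorem defect_succ {lam : ℝ} (h0 : 0 < lam) (h1 : lam ≤ 1) {h u : ℝ × ℝ → ℝ} (hh : Harm lam h)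
    (hu : Harm lam u) (m : ℕ) :
    defect lam (m + 1) h u =
      15 / 7 * ∑ i ∈ cutCells lam, defect (3 * lam - row i) m (h ∘ F i) (u ∘ F i) := by
  have r0 : row 0 = 0 := rfl
  have r1 : row 1 = 2 := rfl
  have r2 : row 2 = 2 := rfl
  have r3 : row 3 = 2 := rfl
  have r4 : row 4 = 1 := rfl
  have r5 : row 5 = 1 := rfl
  have hfull : ∀ i, 1 < 3 * lam - row i → energy (3 * lam - row i) m (h ∘ F i) (u ∘ F i) =
      cellEnergy (h ∘ F i) (u ∘ F i) := fun i hi => energy_of_one_lt hi (hh.comp_F i) (hu.comp_F i) m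
  have hdead : ∀ i, 3 * lam - row i ≤ 0 → energy (3 * lam - row i) m (h ∘ F i) (u ∘ F i) = 0 :=
    fun i hi => energy_of_nonpos hi m _ _
  have hsum := energy_succ lam m h u
  have e6 : ∀ g : Fin 6 → ℝ, ∑ i, g i = g 0 + g 1 + g 2 + g 3 + g 4 + g 5 := fun g =>
    Fin.sum_univ_six g
  rw [e6] at hsum
  rw [defect, hsum]
  simp only [defect]
  unfold cutCells
  split_ifs with h2 h3
  · rw [hdead 1 (by rw [r1]; linarith), hdead 2 (by rw [r2]; linarith),
      hdead 3 (by rw [r3]; linarith), hdead 4 (by rw [r4]; linarith),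
      hdead 5 (by rw [r5]; linarith), Finset.sum_singleton, hu.nd_eq h0, Function.comp_apply,
      F_zero_corner_zero]
    ring
  · have h2 := not_le.1 h2
    obtain ⟨d, d5, d4⟩ := hu.flux_middle h2 h3
    rw [hfull 0 (by rw [r0]; linarith), hdead 1 (by rw [r1]; linarith),
      hdead 2 (by rw [r2]; linarith), hdead 3 (by rw [r3]; linarith), Finset.sum_pair (by decide), d,
      cellEnergy_eq]
    simp only [Function.comp_apply, F_zero_corner_zero]
    have n3 : F 0 (corner 1) = F 5 (corner 0) := F_corner_of_label rfl
    have n4 : F 0 (corner 2) = F 4 (corner 0) := F_corner_of_label rfl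
    rw [n3, n4]
    linear_combination (15 / 7) * h (F 5 (corner 0)) * d5 + (15 / 7) * h (F 4 (corner 0)) * d4
  · have h3 := not_le.1 h3
    obtain ⟨d, d3, d4, d5, d7, d6⟩ := hu.flux_bottom h3 h1
    rw [hfull 0 (by rw [r0]; linarith), hfull 4 (by rw [r4]; linarith),
      hfull 5 (by rw [r5]; linarith), Finset.sum_insert (by decide), Finset.sum_pair (by decide), d,
      cellEnergy_eq, cellEnergy_eq, cellEnergy_eq]
    simp only [Function.comp_apply, F_zero_corner_zero]
    have n3 : F 5 (corner 0) = F 0 (corner 1) := F_corner_of_label rfl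
    have n4 : F 4 (corner 0) = F 0 (corner 2) := F_corner_of_label rfl
    have n5 : F 5 (corner 1) = F 1 (corner 0) := F_corner_of_label rfl
    have n6 : F 5 (corner 2) = F 3 (corner 0) := F_corner_of_label rfl
    have n6' : F 4 (corner 1) = F 3 (corner 0) := F_corner_of_label rfl
    have n7 : F 4 (corner 2) = F 2 (corner 0) := F_corner_of_label rfl
    rw [n3, n4, n5, n6, n6', n7]
    linear_combination (15 / 7) * h (F 0 (corner 1)) * d3 + (15 / 7) * h (F 0 (corner 2)) * d4 +
      (15 / 7) * h (F 1 (corner 0)) * d5 + (15 / 7) * h (F 2 (corner 0)) * d7 +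
      (15 / 7) * h (F 3 (corner 0)) * d6

/-- Continuous harmonic functions vanishing on the cut. -/
structure Vanishing (lam : ℝ) (h : ℝ × ℝ → ℝ) : Prop where
  harm : Harm lam h
  cont : ContinuousOn h {z | z ∈ SG ∧ 1 - z.2 ≤ lam}
  zero : ∀ z ∈ SG, 1 - z.2 = lam → h z = 0

theorem Vanishing.comp_F {lam : ℝ} {h : ℝ × ℝ → ℝ} (hh : Vanishing lam h) (i : Fin 6) :
    Vanishing (3 * lam - row i) (h ∘ F i) where
  harm := hh.harm.comp_F i
  cont := by
    refine hh.cont.comp (continuous_F i).continuousOn fun z hz => ⟨F_mem_SG i hz.1, ?_⟩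
    rw [depth_F]; linarith [hz.2]
  zero z hz hd := hh.zero _ (F_mem_SG i hz) (by rw [depth_F]; linarith)

theorem Vanishing.nd_eq {lam : ℝ} (h0 : 0 < lam) (h1 : lam ≤ 1) {h : ℝ × ℝ → ℝ}
    (hh : Vanishing lam h) : nd h = conductance lam * h (corner 0) :=
  hh.harm.nd_eq_conductance_mul h0 h1 hh.cont hh.zero

theorem Vanishing.defect_self_nonpos {lam : ℝ} (h0 : 0 < lam) (h1 : lam ≤ 1) {h : ℝ × ℝ → ℝ}
    (hh : Vanishing lam h) (m : ℕ) : defect lam m h h ≤ 0 := by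
  induction m generalizing lam h with
  | zero =>
    have := two_le_conductance h0 h1
    rw [defect_zero h1, hh.nd_eq h0 h1]
    nlinarith [mul_self_nonneg (h (corner 0))]
  | succ m ih =>
    rw [defect_succ h0 h1 hh.harm hh.harm]
    refine mul_nonpos_of_nonneg_of_nonpos (by norm_num) (Finset.sum_nonpos fun i hi => ?_)
    obtain ⟨c0, c1⟩ := child_mem_of_mem_cutCells h0 h1 hi
    exact ih c0 c1 (hh.comp_F i)

/-- The square of the normal derivative is controlled by the energy of the top cell. -/
theorem Harm.nd_sq_le_energy {lam : ℝ} (h0 : 1 / 3 < lam) {u : ℝ × ℝ → ℝ} (hu : Harm lam u)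
    {n : ℕ} (hn : 1 ≤ n) : nd u ^ 2 ≤ 30 / 7 * energy lam n u u := by
  refine le_trans ?_ (mul_le_mul_of_nonneg_left (hu.energy_mono hn) (by norm_num))
  have hr : 3 * lam - row 0 = 3 * lam := by simp [row]
  have hs : energy (3 * lam) 0 (u ∘ F 0) (u ∘ F 0) ≤
      ∑ i, energy (3 * lam - row i) 0 (u ∘ F i) (u ∘ F i) := by
    have := Finset.single_le_sum (f := fun i => energy (3 * lam - row i) 0 (u ∘ F i) (u ∘ F i))
      (fun i _ => energy_self_nonneg _ _ _) (Finset.mem_univ 0)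
    beta_reduce at this
    rwa [hr] at this
  rw [energy_zero, if_pos (by linarith), cellEnergy_eq] at hs
  rw [energy_succ, hu.nd_eq (by linarith), hu.comp_F_zero.nd_of_one_lt (by linarith)]
  simp only [Function.comp_apply] at hs ⊢
  nlinarith [sq_nonneg (u (F 0 (corner 1)) - u (F 0 (corner 2)))]

/-- The apex value of `h` is controlled by its normal derivative, and both normal derivatives are
controlled by the energies of a full cell at the apex. -/
theorem eventually_abs_apex_mul_nd_le {lam : ℝ} (h0 : 0 < lam) (h1 : lam ≤ 1) :
    ∀ᶠ n in atTop, ∀ h u, Vanishing lam h → Harm lam u →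
      |h (corner 0) * nd u| ≤ 2 * (energy lam n h h + energy lam n u u) := by
  refine ternary_induction (P := fun lam => ∀ᶠ n in atTop, ∀ h u, Vanishing lam h → Harm lam u →
    |h (corner 0) * nd u| ≤ 2 * (energy lam n h h + energy lam n u u)) ?_ ?_ h0 h1
  · intro lam h0 h1
    filter_upwards [eventually_ge_atTop 1] with n hn h u hh hu
    have a1 := hh.harm.nd_sq_le_energy h0 hn
    have a2 := hu.nd_sq_le_energy h0 hn
    have hc := two_le_conductance (by linarith) h1
    have hnd := congrArg abs (hh.nd_eq (by linarith) h1)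
    rw [abs_mul, abs_of_pos (by linarith : 0 < conductance lam)] at hnd
    have a3 : 2 * |h (corner 0)| ≤ |nd h| := by
      rw [hnd]; exact mul_le_mul_of_nonneg_right hc (abs_nonneg _)
    have e1 := energy_self_nonneg lam n h
    have e2 := energy_self_nonneg lam n u
    rw [abs_mul]
    rw [← sq_abs] at a1 a2
    have a4 := mul_le_mul_of_nonneg_right a3 (abs_nonneg (nd u))
    nlinarith [sq_nonneg (|nd h| - |nd u|)]
  · intro lam h0 h1 ih
    rw [← map_add_atTop_eq_nat 1, eventually_map]
    filter_upwards [ih] with n hn h u hh hu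
    have hr : 3 * lam - row 0 = 3 * lam := by simp [row]
    have hF := hh.comp_F 0
    rw [hr] at hF
    have := hn _ _ hF hu.comp_F_zero
    have hE : ∀ g : ℝ × ℝ → ℝ, 15 / 7 * energy (3 * lam) n (g ∘ F 0) (g ∘ F 0) ≤
        energy lam (n + 1) g g := by
      intro g
      rw [energy_succ]
      refine mul_le_mul_of_nonneg_left ?_ (by norm_num)
      have := Finset.single_le_sum
        (f := fun i => energy (3 * lam - row i) n (g ∘ F i) (g ∘ F i))
        (fun i _ => energy_self_nonneg _ _ _) (Finset.mem_univ 0)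
      beta_reduce at this
      rwa [hr] at this
    have e1 := hE h
    have e2 := hE u
    rw [Function.comp_apply, F_zero_corner_zero] at this
    rw [hu.nd_eq h0, mul_left_comm, abs_mul, abs_of_pos (by norm_num : (0 : ℝ) < 15 / 7)]
    linarith

/-- The defect at level `m` is controlled by the energies of the cells added after level `m`. -/
theorem eventually_abs_defect_le (m : ℕ) {lam : ℝ} (h0 : 0 < lam) (h1 : lam ≤ 1) :
    ∀ᶠ n in atTop, ∀ h u, Vanishing lam h → Harm lam u →
      |defect lam m h u| ≤
        2 * (energy lam n h h - energy lam m h h + (energy lam n u u - energy lam m u u)) := by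
  induction m generalizing lam with
  | zero =>
    filter_upwards [eventually_abs_apex_mul_nd_le h0 h1] with n hn h u hh hu
    rw [defect_zero h1, abs_neg, energy_zero, energy_zero, if_neg (not_lt.2 h1),
      if_neg (not_lt.2 h1), sub_zero, sub_zero]
    exact hn h u hh hu
  | succ m ih =>
    rw [← map_add_atTop_eq_nat 1, eventually_map]
    have hev := (eventually_all_finset (cutCells lam)).2 fun i hi =>
      ih (child_mem_of_mem_cutCells h0 h1 hi).1 (child_mem_of_mem_cutCells h0 h1 hi).2
    filter_upwards [hev, eventually_ge_atTop m] with n hn hmn h u hh hu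
    rw [defect_succ h0 h1 hh.harm hu, abs_mul, abs_of_pos (by norm_num : (0 : ℝ) < 15 / 7)]
    set g : Fin 6 → ℝ := fun i =>
      2 * (energy (3 * lam - row i) n (h ∘ F i) (h ∘ F i) -
        energy (3 * lam - row i) m (h ∘ F i) (h ∘ F i) +
        (energy (3 * lam - row i) n (u ∘ F i) (u ∘ F i) -
        energy (3 * lam - row i) m (u ∘ F i) (u ∘ F i))) with hg
    have e : 2 * (energy lam (n + 1) h h - energy lam (m + 1) h h +
        (energy lam (n + 1) u u - energy lam (m + 1) u u)) = 15 / 7 * ∑ i, g i := by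
      simp only [hg, energy_succ, ← Finset.mul_sum, Finset.sum_add_distrib,
        Finset.sum_sub_distrib]
      ring
    rw [e]
    refine mul_le_mul_of_nonneg_left ?_ (by norm_num)
    calc _ ≤ ∑ i ∈ cutCells lam, |defect (3 * lam - row i) m (h ∘ F i) (u ∘ F i)| :=
          Finset.abs_sum_le_sum_abs _ _
      _ ≤ ∑ i ∈ cutCells lam, g i := Finset.sum_le_sum fun i hi =>
          hn i hi _ _ (hh.comp_F i) (hu.comp_F i)
      _ ≤ ∑ i, g i := Finset.sum_le_sum_of_subset_of_nonneg (Finset.subset_univ _) fun i _ _ => by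
          have a1 := (hh.harm.comp_F i).energy_mono hmn
          have a2 := (hu.comp_F i).energy_mono hmn
          simp only [hg]
          linarith

/-- Green's formula on the upper domain, for functions of finite energy. -/
theorem Vanishing.tendsto_energy {lam : ℝ} (h0 : 0 < lam) (h1 : lam ≤ 1) {h u : ℝ × ℝ → ℝ}
    (hh : Vanishing lam h) (hu : Harm lam u) {e : ℝ}
    (he : Tendsto (fun m => energy lam m u u) atTop (𝓝 e)) :
    Tendsto (fun m => energy lam m h u) atTop (𝓝 (h (corner 0) * nd u)) := by
  obtain ⟨e', he'⟩ : ∃ e', Tendsto (fun m => energy lam m h h) atTop (𝓝 e') := by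
    refine ⟨_, tendsto_atTop_ciSup (fun m n hmn => hh.harm.energy_mono hmn)
      ⟨h (corner 0) * nd h, ?_⟩⟩
    rintro _ ⟨m, rfl⟩
    have := hh.defect_self_nonpos h0 h1 m
    rw [defect] at this
    show energy lam m h h ≤ _
    linarith
  have hb : ∀ m, |defect lam m h u| ≤
      2 * (e' - energy lam m h h + (e - energy lam m u u)) := fun m =>
    ge_of_tendsto (((he'.sub_const _).add (he.sub_const _)).const_mul 2)
      ((eventually_abs_defect_le m h0 h1).mono fun n hn => hn h u hh hu)
  have hz : Tendsto (fun m => 2 * (e' - energy lam m h h + (e - energy lam m u u))) atTop (𝓝 0) := by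
    simpa using ((he'.const_sub e').add (he.const_sub e)).const_mul 2
  have hd : Tendsto (fun m => defect lam m h u) atTop (𝓝 0) := squeeze_zero_norm hb hz
  simpa [defect] using hd.add_const (h (corner 0) * nd u)

theorem vanishing_h0 {lam : ℝ} (h0 : 0 < lam) (h1 : lam ≤ 1) :
    Vanishing lam (UpperDomain.h0 lam) where
  harm := harm_h0 h0 h1
  cont := ((isSolution_iff h0 h1).1 (isSolution_h0 h0 h1)).1
  zero _ hz hd := h0_eq_zero h0 h1 hz hd

theorem hasEnergy_h0 {lam : ℝ} (h0 : 0 < lam) (h1 : lam ≤ 1) {u : ℝ × ℝ → ℝ} {d : ℝ}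
    (hu : Harm lam u) (hd : HasNormalDeriv u d) (hfin : FiniteEnergy lam u) :
    HasEnergy lam (UpperDomain.h0 lam) u d := by
  obtain ⟨e, he⟩ := hfin
  simp only [HasEnergy, graphEnergy_eq_energy h0 h1] at he ⊢
  have := (vanishing_h0 h0 h1).tendsto_energy h0 h1 hu he
  rwa [h0_apex h0 h1, one_mul, hd.nd_eq] at this

end UpperDomain

theorem theorem3p4 (lam : ℝ) (hlam0 : 0 < lam) (hlam1 : lam ≤ 1) :
    IsSolution lam unitData (h0 lam) ∧ HasNormalDeriv (h0 lam) (eta lam) ∧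
    (∃! μ : MeasureTheory.Measure (ℝ × ℝ), IsCutMeasure lam μ) ∧
    ∀ μ : MeasureTheory.Measure (ℝ × ℝ), IsCutMeasure lam μ →
      ∀ f u : ℝ × ℝ → ℝ, ContinuousOn f (bdry lam) → IsSolution lam f u →
        HasNormalDeriv u (eta lam * (f (corner 0) - ∫ x in X lam, f x ∂μ)) ∧
        (FiniteEnergy lam u →
          HasEnergy lam (h0 lam) u (eta lam * (f (corner 0) - ∫ x in X lam, f x ∂μ))) := by
  refine ⟨isSolution_h0 hlam0 hlam1, hasNormalDeriv_h0 hlam0 hlam1,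
    existsUnique_isCutMeasure hlam0 hlam1, fun μ hμ f u _ hu => ?_⟩
  have hd := hμ.hasNormalDeriv hlam0 hlam1 hu
  exact ⟨hd, hasEnergy_h0 hlam0 hlam1 ((isSolution_iff hlam0 hlam1).1 hu).2.1 hd⟩
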